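/- **Model.** Let $X_1,\dots,X_n$ be i.i.d. copies of $X=Y+Z$, where $Y$ and $Z$ are independent, $Z$ has a known probability density $k$ on $\mathbb R$ with characteristic function $\phi_Z$, and $Y=AV$ with $A$ and $V$ independent, $A$ Bernoulli with success probability $1-p$, and $V$ with density $f$ on $\mathbb R$. For $\alpha,K>0$ let $$\Sigma(\alpha,K)=\Big\{f \text{ a probability density}:\ \int_{-\infty}^{\infty}|\phi_f(t)|^2(1+|t|^{2\alpha})\,dt\le K\Big\},\qquad \phi_f(t)=\int e^{itx}f(x)\,dx .$$ Fix $p^*\in[0,1)$. For an estimator $\tilde f_n$ of $f$, that is, a jointly measurable real function $\tilde f_n(X_1,\dots,X_n;x)$, put $$R(\tilde f_n)=\sup_{f\in\Sigma(\alpha,K),\,p\in[0,p^*]}\mathbb E_{p,f}\Big[\int_{-\infty}^{\infty}(\tilde f_n(x)-f(x))^2dx\Big],\qquad \mathcal R_n^*=\inf_{\tilde f_n}R(\tilde f_n).$$ **Theorem.** Let $\alpha\ge 1/2$. There is $K_0=K_0(\alpha)>0$ such that for every $K\ge K_0$, every $p^*\in[0,1)$, every density $k$ and every $\beta>0$ the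 following holds. (i) Suppose that $\phi_Z$ is differentiable and that, for some $d_1>0$, $|\phi_Z(t)|\le d_1/(1+|t|^\beta)$ and $|\phi_Z'(t)|\le d_1/(1+|t|^\beta)$ for all $t\in\mathbb R$. Then there is $c>0$, not depending on $n$, with $\mathcal R_n^*\ge c\,n^{-2\alpha/(2\alpha+2\beta+1)}$ for all $n\ge1$. (ii) Suppose that $\phi_Z$ is differentiable and that, for some $d_1,\gamma>0$, $|\phi_Z(t)|\le d_1e^{-|t|^\beta/\gamma}$ and $|\phi_Z'(t)|\le d_1e^{-|t|^\beta/\gamma}$ for all $t\in\mathbb R$. Then there is $c>0$, not depending on $n$, with $\mathcal R_n^*\ge c\,(\log n)^{-2\alpha/\beta}$ for all $n\ge2$. (iii) Let $\phi_u$ and $\phi_w$ be real-valued, measurable, symmetric functions on $\mathbb R$ vanishing outside $[-1,1]$ (the Fourier transforms of kernels $u$, $w$) such that: $\phi_u$ is continuous in a neighbourhood of $0$, $\int_{-1}^1\phi_u(t)\,dt=2$, $|\phi_u(t)|\le U|t|^\alpha$ for all $t$ and some $U>0$, and $\lim_{t\to0}\phi_u(t)|t|^{-\alpha}$ exists; $\phi_w(0)=1$,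 $|\phi_w(t)-1|\le W|t|^\alpha$ for all $t$ and some $W>0$, and $\int_{-1}^1\phi_w(t)^2dt<\infty$. For a block $S\subseteq\{1,\dots,n\}$ of the sample let $\phi_S(t)=|S|^{-1}\sum_{j\in S}e^{itX_j}$, and for bandwidths $g,h>0$, with $\epsilon_n=1/\log(3n)$, let $$p_{S,g}=\frac g2\int_{-1/g}^{1/g}\frac{\phi_S(t)\phi_u(gt)}{\phi_Z(t)}\,dt,\qquad \hat p_{S,g}=\max\big(-1+\epsilon_n,\min(p_{S,g},1-\epsilon_n)\big),$$ $$\hat f_{S,S',g,h}(x)=\frac1{2\pi}\int_{-\infty}^{\infty}e^{-itx}\,\frac{\phi_{S'}(t)-\hat p_{S,g}\phi_Z(t)}{(1-\hat p_{S,g})\phi_Z(t)}\,\phi_w(ht)\,dt .$$ (a) Under the assumption of (i), suppose moreover that $\phi_Z$ is integrable, has no zero, and, for some $d_0>0$, $|\phi_Z(t)|\ge d_0|t|^{-\beta}$ for all large $|t|$. Let $d>0$, $m=\lfloor n/2\rfloor$, $g=d\,m^{-1/(2\alpha+2\beta)}$, $h=d\,(n-m)^{-1/(2\alpha+2\beta+1)}$,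 $S=\{1,\dots,m\}$, $S'=\{m+1,\dots,n\}$. Then $\hat f_n=\hat f_{S,S',g,h}$ is rate-optimal with rate $r_n=n^{-2\alpha/(2\alpha+2\beta+1)}$: it is an estimator, and for some $C>0$ not depending on $n$, $R(\hat f_n)\le C\,r_n$ and $R(\hat f_n)\le C\,\mathcal R_n^*$ for all $n\ge2$. (b) Under the assumption of (ii), suppose moreover that $\phi_Z$ is integrable, has no zero, and, for some $d_0,\gamma'>0$ and $\beta_0\in\mathbb R$, $|\phi_Z(t)|\ge d_0|t|^{\beta_0}e^{-|t|^\beta/\gamma'}$ for all large $|t|$. Let $g=h=(4/\gamma')^{1/\beta}(\log n)^{-1/\beta}$ and $S=S'=\{1,\dots,n\}$. Then $\hat f_n=\hat f_{S,S',g,h}$ is rate-optimal, in the same sense, with rate $r_n=(\log n)^{-2\alpha/\beta}$. -/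

import Mathlib

open MeasureTheory Filter Topology
open scoped ENNReal

namespace AtomicDeconv

/-- `f` is a probability density on the real line. -/
structure IsDensity (f : ℝ → ℝ) : Prop where
  measurable : Measurable f
  nonneg : ∀ x, 0 ≤ f x
  lintegral_eq_one : ∫⁻ x, ENNReal.ofReal (f x) = 1

/-- The distribution on `ℝ` with density `f`. -/
noncomputable def densityLaw (f : ℝ → ℝ) : Measure ℝ :=
  volume.withDensity fun x => ENNReal.ofReal (f x)

/-- The characteristic function `φ_f(t) = ∫ e^{itx} f(x) dx` of the distribution with
density `f`. -/
noncomputable def phi (f : ℝ → ℝ) (t : ℝ) : ℂ :=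
  charFun (densityLaw f) t

/-- The Sobolev class `Σ(α, K)` of probability densities `f` with
`∫ |φ_f(t)|² (1 + |t|^{2α}) dt ≤ K`. -/
def sobolevClass (α K : ℝ) : Set (ℝ → ℝ) :=
  {f | IsDensity f ∧
    ∫⁻ t, ENNReal.ofReal (‖phi f t‖ ^ 2 * (1 + |t| ^ (2 * α))) ≤ ENNReal.ofReal K}

/-! ### The statistical model -/

/-- The distribution of `Y = A V`, where `A` is Bernoulli with success probability `1 - p` and
`V`, independent of `A`, has density `f`. -/
noncomputable def signalLaw (p : ℝ) (f : ℝ → ℝ) : Measure ℝ :=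
  ENNReal.ofReal p • Measure.dirac 0 + ENNReal.ofReal (1 - p) • densityLaw f

/-- The distribution of one observation `X = Y + Z`, where `Z`, independent of `Y`, has
density `k`. -/
noncomputable def obsLaw (k : ℝ → ℝ) (p : ℝ) (f : ℝ → ℝ) : Measure ℝ :=
  Measure.conv (signalLaw p f) (densityLaw k)

/-- The distribution of the i.i.d. sample `(X₁, …, Xₙ)`. -/
noncomputable def sampleLaw (n : ℕ) (k : ℝ → ℝ) (p : ℝ) (f : ℝ → ℝ) : Measure (Fin n → ℝ) :=
  Measure.pi fun _ => obsLaw k p f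

/-- Estimators of `f` based on a sample of size `n`: real functions of the sample and of a point
of the line, jointly measurable. -/
def IsEstimator {n : ℕ} (fe : (Fin n → ℝ) → ℝ → ℝ) : Prop :=
  Measurable (Function.uncurry fe)

/-- The mean integrated squared error `E_{p,f} ∫ (fe(x) - f(x))² dx`, with values in `[0, ∞]`. -/
noncomputable def mise {n : ℕ} (k : ℝ → ℝ) (fe : (Fin n → ℝ) → ℝ → ℝ) (p : ℝ) (f : ℝ → ℝ) :
    ℝ≥0∞ :=
  ∫⁻ X, ∫⁻ x, ENNReal.ofReal ((fe X x - f x) ^ 2) ∂volume ∂(sampleLaw n k p f)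

/-- The supremum of the mean integrated squared error over `f ∈ Σ(α, K)` and `p ∈ [0, p*]`. -/
noncomputable def maxRisk {n : ℕ} (k : ℝ → ℝ) (α K pstar : ℝ) (fe : (Fin n → ℝ) → ℝ → ℝ) :
    ℝ≥0∞ :=
  ⨆ f ∈ sobolevClass α K, ⨆ p ∈ Set.Icc (0 : ℝ) pstar, mise k fe p f

/-- The minimax risk for the estimation of `f` from a sample of size `n`. -/
noncomputable def minimaxRisk (n : ℕ) (k : ℝ → ℝ) (α K pstar : ℝ) : ℝ≥0∞ :=
  ⨅ (fe : (Fin n → ℝ) → ℝ → ℝ) (_ : IsEstimator fe), maxRisk k α K pstar fe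

/-! ### Conditions on the error density -/

/-- Polynomial upper bounds of order `β` on `φ_Z` and on its derivative. -/
def PolyDecay (k : ℝ → ℝ) (β : ℝ) : Prop :=
  Differentiable ℝ (phi k) ∧ ∃ d₁ > 0, ∀ t : ℝ,
    ‖phi k t‖ ≤ d₁ / (1 + |t| ^ β) ∧ ‖deriv (phi k) t‖ ≤ d₁ / (1 + |t| ^ β)

/-- Exponential upper bounds with exponent `|t|^β / γ` on `φ_Z` and on its derivative. -/
def ExpDecay (k : ℝ → ℝ) (β γ : ℝ) : Prop :=
  Differentiable ℝ (phi k) ∧ ∃ d₁ > 0, ∀ t : ℝ,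
    ‖phi k t‖ ≤ d₁ * Real.exp (-(|t| ^ β / γ)) ∧
    ‖deriv (phi k) t‖ ≤ d₁ * Real.exp (-(|t| ^ β / γ))

/-- The ordinary smooth case: `φ_Z` is integrable, has no zero, and
`|φ_Z(t)| ≥ d₀ |t|^{-β}` for all large `|t|`. -/
def OrdinarySmooth (k : ℝ → ℝ) (β : ℝ) : Prop :=
  (∀ t, phi k t ≠ 0) ∧ Integrable (phi k) ∧
    ∃ d₀ > 0, ∀ᶠ t : ℝ in cocompact ℝ, d₀ * |t| ^ (-β) ≤ ‖phi k t‖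

/-- The supersmooth case: `φ_Z` is integrable, has no zero, and
`|φ_Z(t)| ≥ d₀ |t|^{β₀} e^{-|t|^β / γ}` for all large `|t|`. -/
def SuperSmooth (k : ℝ → ℝ) (β γ : ℝ) : Prop :=
  (∀ t, phi k t ≠ 0) ∧ Integrable (phi k) ∧
    ∃ d₀ > 0, ∃ β₀ : ℝ, ∀ᶠ t : ℝ in cocompact ℝ,
      d₀ * |t| ^ β₀ * Real.exp (-(|t| ^ β / γ)) ≤ ‖phi k t‖

/-! ### Conditions on the kernels, through their Fourier transforms -/

/-- The conditions on the Fourier transform `φ_u` of the kernel used to estimate `p`. -/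
structure IsAtomKernel (α : ℝ) (φu : ℝ → ℝ) : Prop where
  measurable : Measurable φu
  symm : ∀ t, φu (-t) = φu t
  continuous_near_zero : ∀ᶠ t in 𝓝 (0 : ℝ), ContinuousAt φu t
  support : ∀ t, 1 < |t| → φu t = 0
  integral_eq_two : ∫ t in (-1 : ℝ)..1, φu t = 2
  bound : ∃ U > 0, ∀ t, |φu t| ≤ U * |t| ^ α
  limit : ∃ l : ℝ, Tendsto (fun t => φu t / |t| ^ α) (𝓝[≠] 0) (𝓝 l)

/-- The conditions on the Fourier transform `φ_w` of the kernel used to estimate `f`. -/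
structure IsDensityKernel (α : ℝ) (φw : ℝ → ℝ) : Prop where
  measurable : Measurable φw
  symm : ∀ t, φw (-t) = φw t
  support : ∀ t, 1 < |t| → φw t = 0
  at_zero : φw 0 = 1
  bound : ∃ W > 0, ∀ t, |φw t - 1| ≤ W * |t| ^ α
  sq_integrable : IntegrableOn (fun t => φw t ^ 2) (Set.Icc (-1) 1)

/-! ### The estimators -/

/-- The empirical characteristic function of the part `(X_j)_{j ∈ s}` of the sample. -/
noncomputable def phiEmp {n : ℕ} (s : Finset (Fin n)) (X : Fin n → ℝ) (t : ℝ) : ℂ :=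
  (s.card : ℂ)⁻¹ * ∑ j ∈ s, Complex.exp (Complex.I * t * X j)

/-- The Fourier estimator of `p` with bandwidth `g`, based on `(X_j)_{j ∈ s}`:
`(g/2) ∫_{-1/g}^{1/g} φ_emp(t) φ_u(g t) / φ_Z(t) dt`, which is real. -/
noncomputable def pEst {n : ℕ} (k φu : ℝ → ℝ) (g : ℝ) (s : Finset (Fin n)) (X : Fin n → ℝ) : ℝ :=
  ((g / 2 : ℂ) *
    ∫ t in (-(1 / g))..(1 / g), phiEmp s X t * (φu (g * t) : ℂ) / phi k t).re

/-- The estimator of `p` truncated to `[-1 + ε, 1 - ε]`. -/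
noncomputable def pEstTrunc {n : ℕ} (k φu : ℝ → ℝ) (g ε : ℝ) (s : Finset (Fin n))
    (X : Fin n → ℝ) : ℝ :=
  max (-1 + ε) (min (pEst k φu g s X) (1 - ε))

/-- The estimator of `f` with bandwidth `h`, where `φ_emp` is based on `(X_j)_{j ∈ s}` and
`q` is the plugged-in value of `p`:
`(1/2π) ∫ e^{-itx} (φ_emp(t) - q φ_Z(t)) / ((1 - q) φ_Z(t)) φ_w(h t) dt`, which is real. -/
noncomputable def fEst {n : ℕ} (k φw : ℝ → ℝ) (h : ℝ) (s : Finset (Fin n)) (q : ℝ)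
    (X : Fin n → ℝ) (x : ℝ) : ℝ :=
  ((1 / (2 * Real.pi) : ℂ) *
    ∫ t : ℝ, Complex.exp (-(Complex.I * t * x)) *
      ((phiEmp s X t - q * phi k t) / ((1 - q) * phi k t)) * (φw (h * t) : ℂ)).re

/-- The truncation level `ε_n = 1 / log (3 n)`. -/
noncomputable def truncLevel (n : ℕ) : ℝ := (Real.log (3 * n))⁻¹

/-- The estimator of `f` in the ordinary smooth case. The sample is split: `p` is estimated from
the first `⌊n/2⌋` observations, and the empirical characteristic function in the estimator of `f`
uses the others. The bandwidths are `g = d ⌊n/2⌋^{-1/(2α+2β)}` and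
`h = d (n - ⌊n/2⌋)^{-1/(2α+2β+1)}`. -/
noncomputable def ordinaryEstimator (k φu φw : ℝ → ℝ) (α β d : ℝ) (n : ℕ)
    (X : Fin n → ℝ) : ℝ → ℝ :=
  let g : ℝ := d * ((n / 2 : ℕ) : ℝ) ^ (-(1 / (2 * α + 2 * β)))
  let h : ℝ := d * ((n - n / 2 : ℕ) : ℝ) ^ (-(1 / (2 * α + 2 * β + 1)))
  fEst k φw h {j : Fin n | n / 2 ≤ (j : ℕ)}
    (pEstTrunc k φu g (truncLevel n) {j : Fin n | (j : ℕ) < n / 2} X) X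

/-- The estimator of `f` in the supersmooth case, with bandwidths
`g = h = (4/γ)^{1/β} (log n)^{-1/β}` and without splitting of the sample. -/
noncomputable def superEstimator (k φu φw : ℝ → ℝ) (β γ : ℝ) (n : ℕ)
    (X : Fin n → ℝ) : ℝ → ℝ :=
  let h : ℝ := (4 / γ) ^ (1 / β) * Real.log n ^ (-(1 / β))
  fEst k φw h Finset.univ (pEstTrunc k φu h (truncLevel n) Finset.univ X) X

/-- The sequence of estimators `fe n`, `n ≥ 2`, is rate-optimal with rate `r`: its maximal risk
is at most of the order `r n`, and at most of the order of the minimax risk. -/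
def IsRateOptimal (k : ℝ → ℝ) (α K pstar : ℝ) (fe : (n : ℕ) → (Fin n → ℝ) → ℝ → ℝ)
    (r : ℕ → ℝ) : Prop :=
  (∀ n ≥ 2, IsEstimator (fe n)) ∧
    ∃ C > 0, ∀ n ≥ 2,
      maxRisk k α K pstar (fe n) ≤ ENNReal.ofReal (C * r n) ∧
      maxRisk k α K pstar (fe n) ≤ ENNReal.ofReal C * minimaxRisk n k α K pstar

end AtomicDeconv

open AtomicDeconv

/-! Upper bounds. An observation has characteristic function `(p + (1 - p) φ_f) φ_Z`. With a value
`q` plugged in for `p`, the frequency-side error of the estimator of `f` is a sum of three terms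
(`symbol_sub_eq`): the relative error `(p - q) / (1 - q)`, spread over the frequencies up to `1/h`;
the noise of the empirical characteristic function divided by `φ_Z`; and the smoothing bias. A
Plancherel inequality (`lintegral_inverse_sub_sq_le`) turns this into the integrated squared error.

The estimator of `p` is a sample mean. Its squared bias is of order `g^(2α+1)` (`atomBias_sq_le`),
and its variance is controlled by a Schur test (`integral_norm_sq_integral_exp_le`) that uses the
integrability of `φ_Z`. Truncation keeps `1 - q ≥ ε`; the price `ε⁻²`, a squared logarithm, is paid
on the noise of `q` but not on its bias (`trunc_ratio_sq_le`). In the ordinary smooth case `p` is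
estimated with a polynomial margin over what is needed, which absorbs the logarithm, and sample
splitting makes `(1 - q)⁻²` independent of the noise of the characteristic function
(`mise_split_le`). In the supersmooth case all variance terms are `n^(-1/2)` up to powers of `log
n`, so only the bias matters and no splitting is needed.

Lower bounds. The subproblem `p = 0` is already hard enough. The Cauchy density is perturbed by `N`
waves of frequencies `N, …, 2N - 1`, with arbitrary signs and amplitude `a` of order `N^(-(α+1/2))`,
the largest that the Sobolev constraint allows; positivity requires `a N` to be bounded, which is
where `α ≥ 1/2` is used. Flipping one sign changes the law of an observation by a chi-square
distance of order `a² δ²`, where `δ` bounds `φ_Z` and `φ_Z'` beyond the frequency `N`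
(`exists_density_ratio`). The derivative enters because the chi-square distance divides by a density
with Cauchy tails, hence weights by `1 + x²`, and multiplication by `x` is differentiation in
frequency. If `n a² δ²` is small, no sign can be recovered, and Assouad's argument with Bessel's
inequality gives a risk of order `N a²`, that is `N^(-2α)` (`exists_le_minimaxRisk`). It remains to
take `N` as small as the condition on `n` permits. -/

namespace AtomicDeconv

/-! ### A Plancherel inequality for integrable functions. -/

open scoped FourierTransform SchwartzMap

theorem continuous_fourier_of_integrable {f : ℝ → ℂ} (hf : Integrable f) : Continuous (𝓕 f) :=
  VectorFourier.fourierIntegral_continuous Real.continuous_fourierChar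
    (L := innerₗ ℝ) (by fun_prop) hf

theorem norm_fourier_le_integral_norm (f : ℝ → ℂ) (x : ℝ) : ‖𝓕 f x‖ ≤ ∫ y, ‖f y‖ :=
  VectorFourier.norm_fourierIntegral_le_integral_norm _ _ _ _ _

theorem integral_fourier_mul_eq {f g : ℝ → ℂ} (hf : Integrable f) (hg : Integrable g) :
    ∫ x, 𝓕 f x * g x = ∫ x, f x * 𝓕 g x := by
  have := VectorFourier.integral_fourierIntegral_smul_eq_flip (μ := volume) (ν := volume)
    (L := innerₗ ℝ) Real.continuous_fourierChar (by fun_prop) hf hg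
  simpa [Real.fourier_eq, VectorFourier.fourierIntegral, mul_comm] using this

theorem integral_fourierInv_mul_eq {f g : ℝ → ℂ} (hf : Integrable f) (hg : Integrable g) :
    ∫ x, 𝓕⁻ f x * g x = ∫ x, f x * 𝓕⁻ g x := by
  have h := integral_fourier_mul_eq hf hg.comp_neg
  have e1 : ∀ x, 𝓕⁻ f x = 𝓕 f (-x) := fun x => Real.fourierInv_eq_fourier_neg f x
  have e2 : ∀ x, 𝓕⁻ g x = 𝓕 (fun y => g (-y)) x := fun x => by
    rw [Real.fourierInv_eq_fourier_comp_neg]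
  simp_rw [e1, e2, ← h]
  rw [← integral_neg_eq_self]
  simp

/-- Neither `f` nor `Φ` need be square integrable, so the isometry cannot be applied to them
separately. When the right side is finite, `Φ - 𝓕⁻ f` lies in `L²`; its `L²` Fourier transform is
identified with `𝓕 Φ - f` by pairing with smooth compactly supported functions, and the isometry
then applies to the difference. -/
theorem lintegral_fourier_sub_sq_le {Φ f : ℝ → ℂ} (hΦ : Integrable Φ) (hf : Integrable f) :
    ∫⁻ x, ‖𝓕 Φ x - f x‖ₑ ^ 2 ≤ ∫⁻ s, ‖Φ s - 𝓕⁻ f s‖ₑ ^ 2 := by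
  by_cases htop : ∫⁻ s, ‖Φ s - 𝓕⁻ f s‖ₑ ^ 2 = ∞
  · simp [htop]
  have hcont : Continuous (𝓕⁻ f) := by
    have : (𝓕⁻ f) = fun x => 𝓕 f (-x) := funext fun x => Real.fourierInv_eq_fourier_neg f x
    rw [this]
    exact (continuous_fourier_of_integrable hf).comp continuous_neg
  have hcont' : Continuous (𝓕 Φ) := continuous_fourier_of_integrable hΦ
  have hD : MemLp (fun s => Φ s - 𝓕⁻ f s) 2 := by
    refine ⟨hΦ.1.sub hcont.aestronglyMeasurable, ?_⟩
    rw [eLpNorm_lt_top_iff_lintegral_rpow_enorm_lt_top (by norm_num) (by norm_num)]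
    simpa using lt_top_iff_ne_top.2 htop
  set u : Lp ℂ 2 (volume : Measure ℝ) := 𝓕 (hD.toLp _) with hu
  have hloc : LocallyIntegrable (fun x => 𝓕 Φ x - f x) :=
    hcont'.locallyIntegrable.sub hf.locallyIntegrable
  have hae : (fun x => 𝓕 Φ x - f x) =ᵐ[volume] u := by
    refine ae_eq_of_integral_contDiff_smul_eq hloc
      ((Lp.memLp u).locallyIntegrable (by norm_num)) fun g hg hgc => ?_
    set G : 𝓢(ℝ, ℂ) := HasCompactSupport.toSchwartzMap
      (hgc.comp_left (g := ((↑) : ℝ → ℂ)) Complex.ofReal_zero)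
      (Complex.ofRealCLM.contDiff.comp hg) with hG
    have hGa : ∀ x, G x = (g x : ℂ) := fun x => rfl
    have hGi : Integrable (fun x => G x) := G.integrable
    have hFi : Integrable (fun x => (𝓕 G) x) := (𝓕 G).integrable
    have hcoe : ∀ x, (𝓕 G) x = 𝓕 (fun x => G x) x := fun x => by
      rw [SchwartzMap.fourier_coe]
    -- The `L²` transform agrees with the distributional one, so the Fourier transform can be moved
    -- onto the test function.
    have e1 : ∫ x, g x • u x = ∫ s, (𝓕 G) s * (Φ s - 𝓕⁻ f s) := by
      have a1 : ∫ x, g x • u x = Lp.toTemperedDistribution u G := by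
        rw [Lp.toTemperedDistribution_apply]
        simp [hGa]
      rw [a1, hu, ← Lp.fourier_toTemperedDistribution_eq, TemperedDistribution.fourier_apply,
        Lp.toTemperedDistribution_apply]
      refine integral_congr_ae (hD.coeFn_toLp.mono fun x hx => ?_)
      simp only [hx, smul_eq_mul]
    have hb1 : ∀ x, ‖𝓕 Φ x‖ ≤ ∫ y, ‖Φ y‖ := fun x => norm_fourier_le_integral_norm Φ x
    have hb2 : ∀ x, ‖𝓕⁻ f x‖ ≤ ∫ y, ‖f y‖ := fun x => by
      rw [Real.fourierInv_eq_fourier_neg]; exact norm_fourier_le_integral_norm f _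
    obtain ⟨C, hC⟩ : ∃ C, ∀ x, ‖(𝓕 G) x‖ ≤ C := by
      refine ⟨∫ y, ‖G y‖, fun x => ?_⟩
      rw [hcoe]; exact norm_fourier_le_integral_norm _ _
    obtain ⟨C', hC'⟩ : ∃ C, ∀ x, ‖G x‖ ≤ C := by
      have := G.decay 0 0
      obtain ⟨C, -, hC⟩ := this
      exact ⟨C, fun x => by simpa using hC x⟩
    have i1 : Integrable (fun s => (𝓕 G) s * Φ s) :=
      hΦ.bdd_mul (𝓕 G).continuous.aestronglyMeasurable (Eventually.of_forall hC)
    have i2 : Integrable (fun s => (𝓕 G) s * 𝓕⁻ f s) :=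
      hFi.mul_bdd hcont.aestronglyMeasurable (Eventually.of_forall hb2)
    have i3 : Integrable (fun s => G s * 𝓕 Φ s) :=
      hGi.mul_bdd hcont'.aestronglyMeasurable (Eventually.of_forall hb1)
    have i4 : Integrable (fun s => G s * f s) :=
      hf.bdd_mul G.continuous.aestronglyMeasurable (Eventually.of_forall hC')
    rw [e1]
    have e2 : ∫ x, g x • (𝓕 Φ x - f x) = ∫ x, (G x * 𝓕 Φ x - G x * f x) := by
      refine integral_congr_ae (Eventually.of_forall fun x => ?_)
      simp [hGa, mul_sub]
    rw [e2, integral_sub i3 i4]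
    simp_rw [mul_sub]
    rw [integral_sub i1 i2]
    congr 1
    · simp_rw [hcoe]
      rw [integral_fourier_mul_eq hGi hΦ]
    · have := integral_fourierInv_mul_eq (f := fun x => (𝓕 G) x) hFi hf
      rw [← this]
      refine integral_congr_ae (Eventually.of_forall fun x => ?_)
      show G x * f x = _ * f x
      congr 1
      have : (𝓕⁻ (𝓕 G)) x = G x := by rw [FourierTransform.fourierInv_fourier_eq]
      rw [← this, SchwartzMap.fourierInv_coe]
  have h1 : ∫⁻ x, ‖𝓕 Φ x - f x‖ₑ ^ 2 = eLpNorm u 2 volume ^ 2 := by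
    rw [eLpNorm_eq_lintegral_rpow_enorm_toReal (by norm_num) (by norm_num)]
    rw [lintegral_congr_ae (hae.mono fun x hx => by
      show _ = ‖u x‖ₑ ^ 2
      simp only at hx
      rw [hx])]
    rw [← ENNReal.rpow_natCast, ← ENNReal.rpow_mul]
    simp
  have h2 : ∫⁻ s, ‖Φ s - 𝓕⁻ f s‖ₑ ^ 2 = eLpNorm (fun s => Φ s - 𝓕⁻ f s) 2 volume ^ 2 := by
    rw [eLpNorm_eq_lintegral_rpow_enorm_toReal (by norm_num) (by norm_num)]
    rw [← ENNReal.rpow_natCast, ← ENNReal.rpow_mul]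
    simp
  rw [h1, h2]
  have h3 : ‖u‖ = ‖hD.toLp _‖ := Lp.norm_fourier_eq _
  rw [Lp.norm_toLp, Lp.norm_def, ENNReal.toReal_eq_toReal_iff' (Lp.eLpNorm_ne_top u) hD.2.ne] at h3
  rw [h3]

theorem lintegral_comp_mul_left_real {F : ℝ → ℝ≥0∞} {a : ℝ} (ha : 0 < a) :
    ∫⁻ x, F (a * x) = ENNReal.ofReal a⁻¹ * ∫⁻ x, F x := by
  have h := Real.map_volume_mul_left ha.ne'
  have e : MeasurableEmbedding (fun x : ℝ => a * x) :=
    (Homeomorph.mulLeft₀ a ha.ne').measurableEmbedding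
  rw [← e.lintegral_map, h, lintegral_smul_measure, abs_of_pos (inv_pos.2 ha), smul_eq_mul]

theorem fourier_comp_two_pi_mul (Φ : ℝ → ℂ) (x : ℝ) :
    𝓕 (fun s => Φ (2 * Real.pi * s)) x
      = (1 / (2 * Real.pi) : ℂ) * ∫ t : ℝ, Complex.exp (-(Complex.I * t * x)) * Φ t := by
  rw [Real.fourier_eq']
  have := Measure.integral_comp_mul_left
    (fun t : ℝ => Complex.exp (-(Complex.I * t * x)) * Φ t) (2 * Real.pi)
  rw [abs_of_pos (by positivity), Complex.real_smul] at this
  push_cast at this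
  rw [one_div, ← this]
  refine integral_congr_ae (Eventually.of_forall fun s => ?_)
  simp only [RCLike.inner_apply, conj_trivial, smul_eq_mul]
  congr 2
  push_cast
  ring

theorem fourierInv_eq_integral_exp (f : ℝ → ℂ) (s : ℝ) :
    𝓕⁻ f s = ∫ x : ℝ, Complex.exp (Complex.I * (2 * Real.pi * s : ℝ) * x) * f x := by
  rw [Real.fourierInv_eq']
  refine integral_congr_ae (Eventually.of_forall fun x => ?_)
  simp only [RCLike.inner_apply, conj_trivial, smul_eq_mul]
  congr 2
  push_cast
  ring

/-- The Plancherel inequality in angular frequency. -/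
theorem lintegral_inverse_sub_sq_le {Φ f : ℝ → ℂ} (hΦ : Integrable Φ) (hf : Integrable f) :
    ∫⁻ x : ℝ, ‖(1 / (2 * Real.pi) : ℂ) * (∫ t : ℝ, Complex.exp (-(Complex.I * t * x)) * Φ t)
        - f x‖ₑ ^ 2
      ≤ ENNReal.ofReal (2 * Real.pi)⁻¹ *
        ∫⁻ t : ℝ, ‖Φ t - ∫ x : ℝ, Complex.exp (Complex.I * t * x) * f x‖ₑ ^ 2 := by
  have hi : Integrable (fun s => Φ (2 * Real.pi * s)) := hΦ.comp_mul_left' (by positivity)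
  have h := lintegral_fourier_sub_sq_le hi hf
  simp_rw [fourier_comp_two_pi_mul] at h
  refine h.trans (le_of_eq ?_)
  rw [← lintegral_comp_mul_left_real (by positivity)]
  simp_rw [fourierInv_eq_integral_exp]

end AtomicDeconv

/-! ### The law of an observation and the variance of sample means. -/

namespace AtomicDeconv

open ProbabilityTheory

section Model

variable {f k : ℝ → ℝ} {p : ℝ}

theorem IsDensity.isProbabilityMeasure (hf : IsDensity f) :
    IsProbabilityMeasure (densityLaw f) :=
  ⟨by simp [densityLaw, hf.lintegral_eq_one]⟩

theorem IsDensity.integrable (hf : IsDensity f) : Integrable f := by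
  refine ⟨hf.measurable.aestronglyMeasurable, ?_⟩
  rw [hasFiniteIntegral_iff_ofReal (Eventually.of_forall hf.nonneg), hf.lintegral_eq_one]
  simp

theorem integral_densityLaw {E : Type*} [NormedAddCommGroup E] [NormedSpace ℝ E]
    (hf : IsDensity f) (g : ℝ → E) : ∫ x, g x ∂(densityLaw f) = ∫ x, f x • g x := by
  rw [densityLaw, integral_withDensity_eq_integral_toReal_smul hf.measurable.ennreal_ofReal
    (Eventually.of_forall fun _ => ENNReal.ofReal_lt_top)]
  simp [ENNReal.toReal_ofReal (hf.nonneg _)]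

theorem phi_eq_integral (hf : IsDensity f) (t : ℝ) :
    phi f t = ∫ x : ℝ, Complex.exp (Complex.I * t * x) * (f x : ℂ) := by
  rw [phi, charFun_apply_real, integral_densityLaw hf]
  refine integral_congr_ae (Eventually.of_forall fun x => ?_)
  simp only [Complex.real_smul]
  rw [mul_comm]
  congr 2
  ring

theorem norm_phi_le_one (hf : IsDensity f) (t : ℝ) : ‖phi f t‖ ≤ 1 := by
  have := hf.isProbabilityMeasure
  exact norm_charFun_le_one t

theorem continuous_phi (hf : IsDensity f) : Continuous (phi f) := by
  have := hf.isProbabilityMeasure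
  exact continuous_charFun

theorem isProbabilityMeasure_signalLaw (hf : IsDensity f) (h0 : 0 ≤ p) (h1 : p ≤ 1) :
    IsProbabilityMeasure (signalLaw p f) := by
  have := hf.isProbabilityMeasure
  refine ⟨?_⟩
  simp only [signalLaw, Measure.add_apply, Measure.smul_apply, measure_univ, smul_eq_mul, mul_one]
  rw [← ENNReal.ofReal_add h0 (by linarith)]
  simp

theorem isProbabilityMeasure_obsLaw (hk : IsDensity k) (hf : IsDensity f) (h0 : 0 ≤ p)
    (h1 : p ≤ 1) : IsProbabilityMeasure (obsLaw k p f) := by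
  have := isProbabilityMeasure_signalLaw hf h0 h1
  have := hk.isProbabilityMeasure
  unfold obsLaw
  infer_instance

theorem charFun_signalLaw (hf : IsDensity f) (h0 : 0 ≤ p) (h1 : p ≤ 1) (t : ℝ) :
    charFun (signalLaw p f) t = p + (1 - p) * phi f t := by
  have := hf.isProbabilityMeasure
  have hi : ∀ (μ : Measure ℝ) [IsFiniteMeasure μ],
      Integrable (fun x : ℝ => Complex.exp (t * x * Complex.I)) μ := fun μ _ => by
    refine Integrable.of_bound (C := 1) (by fun_prop) (Eventually.of_forall fun x => ?_)
    rw [← Complex.ofReal_mul, Complex.norm_exp_ofReal_mul_I]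
  rw [signalLaw, charFun_apply_real, integral_add_measure]
  · rw [integral_smul_measure, integral_smul_measure, ENNReal.toReal_ofReal h0,
      ENNReal.toReal_ofReal (by linarith), phi, charFun_apply_real]
    simp
  · exact (hi _).smul_measure ENNReal.ofReal_ne_top
  · exact (hi _).smul_measure ENNReal.ofReal_ne_top

theorem charFun_obsLaw (hk : IsDensity k) (hf : IsDensity f) (h0 : 0 ≤ p) (h1 : p ≤ 1) (t : ℝ) :
    charFun (obsLaw k p f) t = (p + (1 - p) * phi f t) * phi k t := by
  have := isProbabilityMeasure_signalLaw hf h0 h1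
  have := hk.isProbabilityMeasure
  rw [obsLaw, charFun_conv, charFun_signalLaw hf h0 h1, phi, phi]

/-- The factor contributed by the signal has modulus at most one, whatever `p` and `f`. This makes
the variance bounds uniform over the model. -/
theorem norm_charFun_obsLaw_le (hk : IsDensity k) (hf : IsDensity f) (h0 : 0 ≤ p) (h1 : p ≤ 1)
    (t : ℝ) : ‖charFun (obsLaw k p f) t‖ ≤ ‖phi k t‖ := by
  rw [charFun_obsLaw hk hf h0 h1, norm_mul]
  refine mul_le_of_le_one_left (norm_nonneg _) ?_
  have := isProbabilityMeasure_signalLaw hf h0 h1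
  rw [← charFun_signalLaw hf h0 h1]
  exact norm_charFun_le_one t

end Model

section Variance

variable {n : ℕ} {μ : Measure ℝ} [IsProbabilityMeasure μ]

theorem integral_mean_sub_sq_le {G : ℝ → ℝ} (hG : Measurable G) {C : ℝ} (hC : ∀ x, |G x| ≤ C)
    (s : Finset (Fin n)) (hs : s.Nonempty) :
    ∫ X : Fin n → ℝ, ((s.card : ℝ)⁻¹ * ∑ j ∈ s, G (X j) - ∫ x, G x ∂μ) ^ 2
        ∂(Measure.pi fun _ => μ)
      ≤ (∫ x, G x ^ 2 ∂μ) / s.card := by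
  have hcard : (0 : ℝ) < s.card := by exact_mod_cast hs.card_pos
  have hmp : ∀ j : Fin n, MeasurePreserving (Function.eval j) (Measure.pi fun _ => μ) μ :=
    fun j => measurePreserving_eval (μ := fun _ : Fin n => μ) j
  have hL : MemLp G 2 μ := MemLp.of_bound hG.aestronglyMeasurable C (Eventually.of_forall hC)
  have hLj : ∀ j, MemLp (fun X : Fin n → ℝ => G (X j)) 2 (Measure.pi fun _ => μ) := fun j =>
    hL.comp_measurePreserving (hmp j)
  have hE : ∀ j, ∫ X : Fin n → ℝ, G (X j) ∂(Measure.pi fun _ => μ) = ∫ x, G x ∂μ := fun j => by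
    conv_rhs => rw [← (hmp j).map_eq]
    rw [integral_map (measurable_pi_apply j).aemeasurable hG.aestronglyMeasurable]
  have hV : ∀ j, Var[fun X : Fin n → ℝ => G (X j); Measure.pi fun _ => μ] = Var[G; μ] := fun j => by
    conv_rhs => rw [← (hmp j).map_eq]
    rw [variance_map hG.aemeasurable (measurable_pi_apply j).aemeasurable]
    rfl
  have hind : iIndepFun (fun (j : Fin n) (X : Fin n → ℝ) => G (X j)) (Measure.pi fun _ => μ) :=
    iIndepFun_pi (X := fun _ => G) (fun _ => hG.aemeasurable)
  have hsum : Var[∑ j ∈ s, fun X : Fin n → ℝ => G (X j); Measure.pi fun _ => μ]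
      = s.card * Var[G; μ] := by
    rw [IndepFun.variance_sum (fun j _ => hLj j)
      (fun i _ j _ hij => hind.indepFun hij)]
    simp [hV]
  have hmean : ∫ X : Fin n → ℝ, (s.card : ℝ)⁻¹ * ∑ j ∈ s, G (X j) ∂(Measure.pi fun _ => μ)
      = ∫ x, G x ∂μ := by
    rw [integral_const_mul, integral_finsetSum _ fun j _ => (hLj j).integrable (by norm_num)]
    simp [hE, hcard.ne']
  have hvar : ∫ X : Fin n → ℝ, ((s.card : ℝ)⁻¹ * ∑ j ∈ s, G (X j) - ∫ x, G x ∂μ) ^ 2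
        ∂(Measure.pi fun _ => μ)
      = Var[fun X : Fin n → ℝ => (s.card : ℝ)⁻¹ * ∑ j ∈ s, G (X j); Measure.pi fun _ => μ] := by
    rw [variance_eq_integral (by fun_prop : Measurable _).aemeasurable, hmean]
  rw [hvar, variance_const_mul]
  have : (fun X : Fin n → ℝ => ∑ j ∈ s, G (X j)) = ∑ j ∈ s, fun X : Fin n → ℝ => G (X j) := by
    ext X; simp
  rw [this, hsum]
  have hv : Var[G; μ] ≤ ∫ x, G x ^ 2 ∂μ := variance_le_expectation_sq hG.aestronglyMeasurable
  calc ((s.card : ℝ)⁻¹) ^ 2 * (s.card * Var[G; μ]) = Var[G; μ] / s.card := by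
        field_simp
    _ ≤ _ := by gcongr

/-- The real variance bound is applied to real and imaginary parts and the two are added. -/
theorem lintegral_mean_sub_sq_le {H : ℝ → ℂ} (hH : Measurable H) {C : ℝ} (hC : ∀ x, ‖H x‖ ≤ C)
    (s : Finset (Fin n)) (hs : s.Nonempty) :
    ∫⁻ X : Fin n → ℝ, ‖(s.card : ℂ)⁻¹ * ∑ j ∈ s, H (X j) - ∫ x, H x ∂μ‖ₑ ^ 2
        ∂(Measure.pi fun _ => μ)
      ≤ ENNReal.ofReal ((∫ x, ‖H x‖ ^ 2 ∂μ) / s.card) := by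
  have hre := integral_mean_sub_sq_le (μ := μ) (G := fun x => (H x).re) (by fun_prop)
    (fun x => (Complex.abs_re_le_norm _).trans (hC x)) s hs
  have him := integral_mean_sub_sq_le (μ := μ) (G := fun x => (H x).im) (by fun_prop)
    (fun x => (Complex.abs_im_le_norm _).trans (hC x)) s hs
  have hHi : Integrable H μ := Integrable.of_bound hH.aestronglyMeasurable C
    (Eventually.of_forall hC)
  have hb : ∀ (G : ℝ → ℝ), Measurable G → (∀ x, |G x| ≤ C) →
      Integrable (fun X : Fin n → ℝ => ((s.card : ℝ)⁻¹ * ∑ j ∈ s, G (X j) - ∫ x, G x ∂μ) ^ 2)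
        (Measure.pi fun _ => μ) := fun G hG hGC => by
    refine Integrable.of_bound (C := ((s.card : ℝ)⁻¹ * (s.card * C) + |∫ x, G x ∂μ|) ^ 2)
      (by fun_prop : Measurable _).aestronglyMeasurable (Eventually.of_forall fun X => ?_)
    rw [norm_pow, Real.norm_eq_abs]
    gcongr
    refine (abs_sub _ _).trans ?_
    gcongr
    rw [abs_mul, abs_of_nonneg (by positivity : (0 : ℝ) ≤ (s.card : ℝ)⁻¹)]
    gcongr
    refine (Finset.abs_sum_le_sum_abs _ _).trans ?_
    refine (Finset.sum_le_card_nsmul _ _ C fun j _ => hGC _).trans ?_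
    simp
  have hsq : ∀ (G : ℝ → ℝ), Measurable G → (∀ x, |G x| ≤ C) →
      Integrable (fun x => G x ^ 2) μ := fun G hG hGC => by
    refine Integrable.of_bound (C := C ^ 2) (by fun_prop) (Eventually.of_forall fun X => ?_)
    rw [norm_pow, Real.norm_eq_abs]
    gcongr
    exact hGC _
  have e1 : (∫ x, ‖H x‖ ^ 2 ∂μ) = (∫ x, (H x).re ^ 2 ∂μ) + ∫ x, (H x).im ^ 2 ∂μ := by
    rw [← integral_add]
    · refine integral_congr_ae (Eventually.of_forall fun x => ?_)
      simp only
      rw [Complex.sq_norm, Complex.normSq_apply]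
      ring
    · exact hsq _ (by fun_prop) (fun x => (Complex.abs_re_le_norm _).trans (hC x))
    · exact hsq _ (by fun_prop) (fun x => (Complex.abs_im_le_norm _).trans (hC x))
  have e2 : ∀ X : Fin n → ℝ, ‖(s.card : ℂ)⁻¹ * ∑ j ∈ s, H (X j) - ∫ x, H x ∂μ‖ₑ ^ 2
      = ENNReal.ofReal (((s.card : ℝ)⁻¹ * ∑ j ∈ s, (H (X j)).re - ∫ x, (H x).re ∂μ) ^ 2
        + ((s.card : ℝ)⁻¹ * ∑ j ∈ s, (H (X j)).im - ∫ x, (H x).im ∂μ) ^ 2) := fun X => by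
    rw [← ofReal_norm, ← ENNReal.ofReal_pow (norm_nonneg _), Complex.sq_norm,
      Complex.normSq_apply]
    have h1 : (∫ x, H x ∂μ).re = ∫ x, (H x).re ∂μ := (integral_re hHi).symm
    have h2 : (∫ x, H x ∂μ).im = ∫ x, (H x).im ∂μ := (integral_im hHi).symm
    have h3 : (s.card : ℂ)⁻¹ = (((s.card : ℝ)⁻¹ : ℝ) : ℂ) := by push_cast; rfl
    rw [h3, Complex.sub_re, Complex.sub_im, Complex.re_ofReal_mul, Complex.im_ofReal_mul,
      Complex.re_sum, Complex.im_sum, h1, h2]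
    congr 1
    ring
  have b1 := hb _ (by fun_prop) (fun x => (Complex.abs_re_le_norm _).trans (hC x))
  have b2 := hb _ (by fun_prop) (fun x => (Complex.abs_im_le_norm _).trans (hC x))
  have b3 := ofReal_integral_eq_lintegral_ofReal (b1.add b2)
    (Eventually.of_forall fun X => add_nonneg (sq_nonneg _) (sq_nonneg _))
  simp only [Pi.add_apply] at b3
  rw [lintegral_congr e2, ← b3]
  refine ENNReal.ofReal_le_ofReal ?_
  rw [integral_add b1 b2, e1, add_div]
  exact add_le_add hre him

end Variance

theorem lintegral_mul_sq_le {Ω : Type*} [MeasurableSpace Ω] (ν : Measure Ω) {f g : Ω → ℝ≥0∞}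
    (hf : AEMeasurable f ν) (hg : AEMeasurable g ν) :
    (∫⁻ x, f x * g x ∂ν) ^ 2 ≤ (∫⁻ x, f x ^ 2 ∂ν) * ∫⁻ x, g x ^ 2 ∂ν := by
  have h := ENNReal.lintegral_mul_le_Lp_mul_Lq ν Real.HolderConjugate.two_two hf hg
  calc (∫⁻ x, f x * g x ∂ν) ^ 2 ≤ _ := pow_le_pow_left' h 2
    _ = _ := by
      rw [mul_pow, ← ENNReal.rpow_natCast, ← ENNReal.rpow_natCast, ← ENNReal.rpow_mul,
        ← ENNReal.rpow_mul]
      simp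

theorem two_mul_le_sq_add_sq (a b : ℝ≥0∞) : 2 * (a * b) ≤ a ^ 2 + b ^ 2 := by
  rcases eq_or_ne a ∞ with rfl | ha
  · simp
  rcases eq_or_ne b ∞ with rfl | hb
  · simp
  lift a to NNReal using ha
  lift b to NNReal using hb
  norm_cast
  have := two_mul_le_add_sq a b
  linarith

end AtomicDeconv

/-! ### Second moments of trigonometric averages. -/

namespace AtomicDeconv

open ProbabilityTheory

section Averages

variable {μ : Measure ℝ} [IsProbabilityMeasure μ] {ψ : ℝ → ℂ}

theorem norm_exp_I_mul (t x : ℝ) : ‖Complex.exp (Complex.I * t * x)‖ = 1 := by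
  rw [show Complex.I * t * x = ((t * x : ℝ) : ℂ) * Complex.I by push_cast; ring,
    Complex.norm_exp_ofReal_mul_I]

theorem charFun_eq_integral_exp (μ : Measure ℝ) (t : ℝ) :
    charFun μ t = ∫ x : ℝ, Complex.exp (Complex.I * t * x) ∂μ := by
  rw [charFun_apply_real]
  refine integral_congr_ae (Eventually.of_forall fun x => ?_)
  simp only
  congr 1
  ring

theorem integrable_mul_exp_prod (hψ : Integrable ψ) :
    Integrable (Function.uncurry fun (x t : ℝ) => ψ t * Complex.exp (Complex.I * t * x))
      (μ.prod volume) := by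
  have h1 : Integrable (fun z : ℝ × ℝ => ψ z.2) (μ.prod volume) := hψ.comp_snd μ
  refine h1.mul_bdd (c := 1) (by fun_prop) (Eventually.of_forall fun z => ?_)
  exact (norm_exp_I_mul _ _).le

theorem integral_integral_exp (hψ : Integrable ψ) :
    ∫ x, (∫ t, ψ t * Complex.exp (Complex.I * t * x)) ∂μ = ∫ t, ψ t * charFun μ t := by
  rw [integral_integral_swap (integrable_mul_exp_prod hψ)]
  simp_rw [integral_const_mul, charFun_eq_integral_exp]

theorem norm_integral_exp_le (x : ℝ) :
    ‖∫ t, ψ t * Complex.exp (Complex.I * t * x)‖ ≤ ∫ t, ‖ψ t‖ := by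
  refine (norm_integral_le_integral_norm _).trans (le_of_eq ?_)
  simp [norm_exp_I_mul]

theorem stronglyMeasurable_integral_exp (hψ : Measurable ψ) :
    StronglyMeasurable fun x : ℝ => ∫ t, ψ t * Complex.exp (Complex.I * t * x) := by
  refine StronglyMeasurable.integral_prod_right'
    (f := fun z : ℝ × ℝ => ψ z.2 * Complex.exp (Complex.I * z.2 * z.1)) ?_
  exact (by fun_prop : Measurable _).stronglyMeasurable

/-- Writing the square as `G` times its conjugate and applying Fubini twice gives a quadratic form
in `ψ` whose kernel is the characteristic function at `t - s`. -/
theorem integral_norm_sq_integral_exp (hψm : Measurable ψ) (hψ : Integrable ψ) :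
    ((∫ x, ‖∫ t, ψ t * Complex.exp (Complex.I * t * x)‖ ^ 2 ∂μ : ℝ) : ℂ)
      = ∫ t, ψ t * ∫ s, (starRingEnd ℂ) (ψ s) * charFun μ (t - s) := by
  set G : ℝ → ℂ := fun x => ∫ t, ψ t * Complex.exp (Complex.I * t * x) with hG
  have hGm : Measurable G := (stronglyMeasurable_integral_exp hψm).measurable
  have hGb : ∀ x, ‖G x‖ ≤ ∫ t, ‖ψ t‖ := norm_integral_exp_le
  have hc : ∀ x, (starRingEnd ℂ) (G x)
      = ∫ s, (starRingEnd ℂ) (ψ s) * Complex.exp (-(Complex.I * s * x)) := fun x => by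
    rw [hG, ← integral_conj]
    refine integral_congr_ae (Eventually.of_forall fun s => ?_)
    simp only [map_mul, ← Complex.exp_conj, Complex.conj_I, Complex.conj_ofReal]
    congr 2
    ring
  have e1 : ((∫ x, ‖G x‖ ^ 2 ∂μ : ℝ) : ℂ)
      = ∫ x, (∫ t, ψ t * Complex.exp (Complex.I * t * x) * (starRingEnd ℂ) (G x)) ∂μ := by
    rw [← integral_complex_ofReal]
    refine integral_congr_ae (Eventually.of_forall fun x => ?_)
    simp only
    rw [integral_mul_const, Complex.mul_conj, Complex.normSq_eq_norm_sq]
  have i1 : Integrable (Function.uncurry fun (x t : ℝ) =>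
      ψ t * Complex.exp (Complex.I * t * x) * (starRingEnd ℂ) (G x)) (μ.prod volume) := by
    refine (integrable_mul_exp_prod hψ).mul_bdd (c := ∫ t, ‖ψ t‖)
      (g := fun z : ℝ × ℝ => (starRingEnd ℂ) (G z.1)) ?_ (Eventually.of_forall fun z => ?_)
    · exact (Complex.continuous_conj.measurable.comp (hGm.comp measurable_fst)).aestronglyMeasurable
    · simpa using hGb z.1
  rw [e1, integral_integral_swap i1]
  refine integral_congr_ae (Eventually.of_forall fun t => ?_)
  simp only
  simp_rw [mul_assoc (ψ t), integral_const_mul, hc]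
  congr 1
  have e2 : ∀ x : ℝ, Complex.exp (Complex.I * t * x)
      * ∫ s : ℝ, (starRingEnd ℂ) (ψ s) * Complex.exp (-(Complex.I * s * x))
      = ∫ s : ℝ, (starRingEnd ℂ) (ψ s) * Complex.exp (Complex.I * (t - s : ℝ) * x) := fun x => by
    rw [← integral_const_mul]
    refine integral_congr_ae (Eventually.of_forall fun s => ?_)
    simp only
    rw [mul_left_comm, ← Complex.exp_add]
    congr 2
    push_cast
    ring
  simp_rw [e2]
  rw [integral_integral_swap]
  · simp_rw [integral_const_mul, charFun_eq_integral_exp]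
  · have h1 : Integrable (fun z : ℝ × ℝ => (starRingEnd ℂ) (ψ z.2)) (μ.prod volume) :=
      Integrable.comp_snd (f := fun s => (starRingEnd ℂ) (ψ s))
        (hψ.mono (by fun_prop) (Eventually.of_forall fun s => by simp)) μ
    refine h1.mul_bdd (c := 1) (by fun_prop) (Eventually.of_forall fun z => ?_)
    exact (norm_exp_I_mul _ _).le

/-- A Schur test: the second moment of a trigonometric average under a law whose characteristic
function is dominated by an integrable function. -/
theorem integral_norm_sq_integral_exp_le (hψm : Measurable ψ) (hψ : Integrable ψ) {φ : ℝ → ℂ}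
    (hφm : Measurable φ) (hφ : ∀ t, ‖charFun μ t‖ ≤ ‖φ t‖) :
    ENNReal.ofReal (∫ x, ‖∫ t, ψ t * Complex.exp (Complex.I * t * x)‖ ^ 2 ∂μ)
      ≤ (∫⁻ t, ‖ψ t‖ₑ ^ 2) * ∫⁻ t, ‖φ t‖ₑ := by
  have h0 : ENNReal.ofReal (∫ x, ‖∫ t, ψ t * Complex.exp (Complex.I * t * x)‖ ^ 2 ∂μ)
      = ‖((∫ x, ‖∫ t, ψ t * Complex.exp (Complex.I * t * x)‖ ^ 2 ∂μ : ℝ) : ℂ)‖ₑ := by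
    rw [← ofReal_norm, Complex.norm_real, Real.norm_of_nonneg
      (integral_nonneg fun x => sq_nonneg _)]
  rw [h0, integral_norm_sq_integral_exp hψm hψ]
  have h1 : ‖∫ t, ψ t * ∫ s, (starRingEnd ℂ) (ψ s) * charFun μ (t - s)‖ₑ
      ≤ ∫⁻ t, ∫⁻ s, ‖ψ t‖ₑ * ‖ψ s‖ₑ * ‖φ (t - s)‖ₑ := by
    refine (enorm_integral_le_lintegral_enorm _).trans (lintegral_mono fun t => ?_)
    rw [enorm_mul]
    calc ‖ψ t‖ₑ * ‖∫ s, (starRingEnd ℂ) (ψ s) * charFun μ (t - s)‖ₑ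
        ≤ ‖ψ t‖ₑ * ∫⁻ s, ‖ψ s‖ₑ * ‖φ (t - s)‖ₑ := by
          gcongr
          refine (enorm_integral_le_lintegral_enorm _).trans (lintegral_mono fun s => ?_)
          rw [enorm_mul, RCLike.enorm_conj]
          gcongr
          rw [enorm_le_iff_norm_le]
          exact hφ _
      _ = _ := by
          rw [← lintegral_const_mul _ (by fun_prop)]
          simp_rw [mul_assoc]
  have hA : ∫⁻ t, ∫⁻ s, ‖ψ t‖ₑ ^ 2 * ‖φ (t - s)‖ₑ
      = (∫⁻ t, ‖ψ t‖ₑ ^ 2) * ∫⁻ t, ‖φ t‖ₑ := by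
    rw [← lintegral_mul_const _ (by fun_prop)]
    refine lintegral_congr fun t => ?_
    rw [lintegral_const_mul _ (by fun_prop), lintegral_sub_left_eq_self (fun s => ‖φ s‖ₑ) t]
  have hB : ∫⁻ t, ∫⁻ s, ‖ψ s‖ₑ ^ 2 * ‖φ (t - s)‖ₑ
      = (∫⁻ t, ‖ψ t‖ₑ ^ 2) * ∫⁻ t, ‖φ t‖ₑ := by
    rw [lintegral_lintegral_swap (by fun_prop), ← lintegral_mul_const _ (by fun_prop)]
    refine lintegral_congr fun s => ?_
    rw [lintegral_const_mul _ (by fun_prop), lintegral_sub_right_eq_self (fun s => ‖φ s‖ₑ) s]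
  refine h1.trans ?_
  -- By `2 |ψ t| |ψ s| ≤ |ψ t|² + |ψ s|²`, the variable that is free in each square integrates out
  -- against `φ`; by invariance of Lebesgue measure both halves (`hA`, `hB`) have the same value.
  have h2 : 2 * ∫⁻ t, ∫⁻ s, ‖ψ t‖ₑ * ‖ψ s‖ₑ * ‖φ (t - s)‖ₑ
      ≤ 2 * ((∫⁻ t, ‖ψ t‖ₑ ^ 2) * ∫⁻ t, ‖φ t‖ₑ) := by
    nth_rewrite 2 [two_mul]
    nth_rewrite 1 [← hA]
    rw [← hB, ← lintegral_add_left (by fun_prop), ← lintegral_const_mul _ (by fun_prop)]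
    refine lintegral_mono fun t => ?_
    rw [← lintegral_add_left (by fun_prop), ← lintegral_const_mul _ (by fun_prop)]
    refine lintegral_mono fun s => ?_
    simp only
    rw [← add_mul, ← mul_assoc]
    gcongr
    exact two_mul_le_sq_add_sq _ _
  exact (ENNReal.mul_le_mul_iff_right (by norm_num) (by norm_num)).1 h2

end Averages

end AtomicDeconv

/-! ### Bias and variance of the estimator of `p`. -/

namespace AtomicDeconv

open ProbabilityTheory

/-- The integral of `|φ_k|⁻²` over the frequencies up to `1/h`. -/
noncomputable def invSqMass (k : ℝ → ℝ) (h : ℝ) : ℝ≥0∞ :=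
  ∫⁻ t in Set.Icc (-h⁻¹) h⁻¹, ENNReal.ofReal ((‖phi k t‖ ^ 2)⁻¹)

/-- The function whose Fourier transform is averaged over the sample in the estimator of `p`. -/
noncomputable def atomWeight (k φu : ℝ → ℝ) (g : ℝ) : ℝ → ℂ :=
  (Set.Icc (-g⁻¹) g⁻¹).indicator fun t => (g / 2 : ℂ) * (φu (g * t) / phi k t)

/-- The stochastic error of the average of `x ↦ ∫ ψ(t) e^{itx} dt` over a part of the sample. -/
noncomputable def avgError {n : ℕ} (μ : Measure ℝ) (ψ : ℝ → ℂ) (s : Finset (Fin n))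
    (X : Fin n → ℝ) : ℂ :=
  (s.card : ℂ)⁻¹ * ∑ j ∈ s, (∫ t, ψ t * Complex.exp (Complex.I * t * X j))
    - ∫ x, (∫ t, ψ t * Complex.exp (Complex.I * t * x)) ∂μ

/-- The bias of the estimator of `p`. -/
noncomputable def atomBias (f φu : ℝ → ℝ) (p g : ℝ) : ℝ :=
  ((1 - p : ℂ) * ((g / 2 : ℂ) * ∫ t in Set.Icc (-g⁻¹) g⁻¹, φu (g * t) * phi f t)).re

section

variable {k f φu : ℝ → ℝ} {α K p g : ℝ}

theorem IsAtomKernel.exists_bound (hu : IsAtomKernel α φu) (hα : 0 ≤ α) :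
    ∃ U > 0, (∀ t, |φu t| ≤ U * |t| ^ α) ∧ ∀ t, |φu t| ≤ U := by
  obtain ⟨U, hU, h⟩ := hu.bound
  refine ⟨U, hU, h, fun t => ?_⟩
  rcases le_or_gt |t| 1 with ht | ht
  · exact (h t).trans (mul_le_of_le_one_right hU.le (Real.rpow_le_one (abs_nonneg _) ht hα))
  · simp [hu.support t ht, hU.le]

theorem exists_bound_inv_phi (hk : IsDensity k) (h0 : ∀ t, phi k t ≠ 0) (a b : ℝ) :
    ∃ C, ∀ t ∈ Set.Icc a b, ‖(phi k t)⁻¹‖ ≤ C :=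
  isCompact_Icc.exists_bound_of_continuousOn ((continuous_phi hk).inv₀ h0).continuousOn

theorem measurable_phi (hk : IsDensity k) : Measurable (phi k) := (continuous_phi hk).measurable

theorem measurable_atomWeight (hk : IsDensity k) (hu : Measurable φu) :
    Measurable (atomWeight k φu g) := by
  have := measurable_phi hk
  exact Measurable.indicator (by fun_prop) measurableSet_Icc

theorem integrable_atomWeight (hk : IsDensity k) (h0 : ∀ t, phi k t ≠ 0) (hu : Measurable φu)
    {U : ℝ} (hU : ∀ t, |φu t| ≤ U) : Integrable (atomWeight k φu g) := by
  obtain ⟨C, hC⟩ := exists_bound_inv_phi hk h0 (-g⁻¹) g⁻¹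
  have hm := measurable_phi hk
  refine (integrable_indicator_iff measurableSet_Icc).2 ?_
  refine Measure.integrableOn_of_bounded (M := ‖(g / 2 : ℂ)‖ * (U * C)) (by simp)
    (by fun_prop : Measurable _).aestronglyMeasurable ?_
  refine (ae_restrict_iff' measurableSet_Icc).2 (Eventually.of_forall fun t ht => ?_)
  rw [norm_mul, div_eq_mul_inv (φu _ : ℂ), norm_mul, Complex.norm_real, Real.norm_eq_abs]
  have := (abs_nonneg _).trans (hU 0)
  gcongr
  · exact hU _
  · exact hC t ht

/-- This exhibits the estimator as a sample mean of a bounded function of one observation, to which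
the variance bounds apply. -/
theorem pEst_eq_re (hk : IsDensity k) (h0 : ∀ t, phi k t ≠ 0) (hu : Measurable φu)
    {U : ℝ} (hU : ∀ t, |φu t| ≤ U) (hg : 0 < g) {n : ℕ} (s : Finset (Fin n)) (X : Fin n → ℝ) :
    pEst k φu g s X = ((s.card : ℂ)⁻¹ * ∑ j ∈ s,
      (∫ t, atomWeight k φu g t * Complex.exp (Complex.I * t * X j))).re := by
  rw [pEst]
  congr 1
  have hi : ∀ j, Integrable fun t : ℝ =>
      atomWeight k φu g t * Complex.exp (Complex.I * t * X j) := fun j =>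
    (integrable_atomWeight hk h0 hu hU).mul_bdd (c := 1) (by fun_prop)
      (Eventually.of_forall fun t => (norm_exp_I_mul _ _).le)
  have hg' : 0 < g⁻¹ := inv_pos.2 hg
  rw [← integral_finsetSum _ fun j _ => hi j, ← integral_const_mul, one_div,
    intervalIntegral.integral_of_le (by linarith), ← integral_Icc_eq_integral_Ioc,
    ← integral_const_mul, ← integral_indicator measurableSet_Icc]
  refine integral_congr_ae (Eventually.of_forall fun t => ?_)
  simp only [atomWeight, Set.indicator, phiEmp]
  split_ifs
  · simp_rw [Finset.mul_sum, Finset.sum_mul, Finset.sum_div, Finset.mul_sum]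
    refine Finset.sum_congr rfl fun j _ => ?_
    ring
  · simp

theorem integral_kernel_eq (hu : IsAtomKernel α φu) (hg : 0 < g) :
    ∫ t in Set.Icc (-g⁻¹) g⁻¹, φu (g * t) = 2 / g := by
  have hg' : 0 < g⁻¹ := inv_pos.2 hg
  rw [integral_Icc_eq_integral_Ioc, ← intervalIntegral.integral_of_le (by linarith),
    intervalIntegral.integral_comp_mul_left _ hg.ne']
  rw [mul_neg, mul_inv_cancel₀ hg.ne', hu.integral_eq_two, smul_eq_mul]
  ring

theorem integrableOn_kernel (hu : Measurable φu) {U : ℝ} (hU : ∀ t, |φu t| ≤ U) :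
    IntegrableOn (fun t => φu (g * t)) (Set.Icc (-g⁻¹) g⁻¹) :=
  Measure.integrableOn_of_bounded (M := U) (by simp)
    (by fun_prop : Measurable _).aestronglyMeasurable (Eventually.of_forall fun _ => hU _)

/-- The factor `φ_Z` cancels. The atom contributes `p` exactly, because `φ_u` integrates to `2`;
what remains comes from `φ_f`. -/
theorem integral_atomWeight (hk : IsDensity k) (hf : IsDensity f) (h0 : ∀ t, phi k t ≠ 0)
    (hu : IsAtomKernel α φu) {U : ℝ} (hU : ∀ t, |φu t| ≤ U) (hg : 0 < g) (hp0 : 0 ≤ p)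
    (hp1 : p ≤ 1) :
    (∫ x, (∫ t, atomWeight k φu g t * Complex.exp (Complex.I * t * x)) ∂(obsLaw k p f)).re
      = p + atomBias f φu p g := by
  have := isProbabilityMeasure_obsLaw hk hf hp0 hp1
  rw [integral_integral_exp (integrable_atomWeight hk h0 hu.measurable hU)]
  have i1 := integrableOn_kernel (g := g) hu.measurable hU
  have i2 : IntegrableOn (fun t => (φu (g * t) : ℂ) * phi f t) (Set.Icc (-g⁻¹) g⁻¹) :=
    (i1.ofReal (𝕜 := ℂ)).mul_bdd (c := 1) (continuous_phi hf).aestronglyMeasurable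
      (Eventually.of_forall (norm_phi_le_one hf))
  have e1 : ∫ t, atomWeight k φu g t * charFun (obsLaw k p f) t
      = ∫ t in Set.Icc (-g⁻¹) g⁻¹, (((p : ℂ) * (g / 2)) * (φu (g * t) : ℂ)
        + ((1 - p : ℂ) * (g / 2)) * ((φu (g * t) : ℂ) * phi f t)) := by
    rw [← integral_indicator measurableSet_Icc]
    refine integral_congr_ae (Eventually.of_forall fun t => ?_)
    simp only [atomWeight, Set.indicator, charFun_obsLaw hk hf hp0 hp1]
    split_ifs
    · have := h0 t
      field_simp
    · simp
  have i3 : IntegrableOn (fun t => (φu (g * t) : ℂ)) (Set.Icc (-g⁻¹) g⁻¹) := i1.ofReal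
  rw [e1, integral_add (i3.const_mul _) (i2.const_mul _), integral_const_mul,
    integral_const_mul, integral_complex_ofReal, integral_kernel_eq hu hg, Complex.add_re, atomBias,
    mul_assoc (1 - p : ℂ)]
  congr 1
  have : (g : ℂ) ≠ 0 := by exact_mod_cast hg.ne'
  rw [show (p : ℂ) * (g / 2) * ((2 / g : ℝ) : ℂ) = p by push_cast; field_simp, Complex.ofReal_re]

theorem pEst_sub_eq (hk : IsDensity k) (hf : IsDensity f) (h0 : ∀ t, phi k t ≠ 0)
    (hu : IsAtomKernel α φu) {U : ℝ} (hU : ∀ t, |φu t| ≤ U) (hg : 0 < g) (hp0 : 0 ≤ p)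
    (hp1 : p ≤ 1) {n : ℕ} (s : Finset (Fin n)) (X : Fin n → ℝ) :
    pEst k φu g s X - p
      = (avgError (obsLaw k p f) (atomWeight k φu g) s X).re + atomBias f φu p g := by
  rw [pEst_eq_re hk h0 hu.measurable hU hg, avgError, Complex.sub_re,
    integral_atomWeight hk hf h0 hu hU hg hp0 hp1]
  ring

/-- The sample-mean variance bound reduces this to a second moment under one observation, which the
Schur test bounds. -/
theorem lintegral_avgError_sq_le {μ : Measure ℝ} [IsProbabilityMeasure μ] {ψ φ : ℝ → ℂ}
    (hψm : Measurable ψ) (hψ : Integrable ψ)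
    (hφm : Measurable φ) (hφ : ∀ t, ‖charFun μ t‖ ≤ ‖φ t‖) {n : ℕ} {s : Finset (Fin n)}
    (hs : s.Nonempty) :
    ∫⁻ X, ‖avgError μ ψ s X‖ₑ ^ 2 ∂(Measure.pi fun _ => μ)
      ≤ (∫⁻ t, ‖ψ t‖ₑ ^ 2) * (∫⁻ t, ‖φ t‖ₑ) / s.card := by
  refine (lintegral_mean_sub_sq_le (stronglyMeasurable_integral_exp hψm).measurable
    norm_integral_exp_le s hs).trans ?_
  rw [ENNReal.ofReal_div_of_pos (by exact_mod_cast hs.card_pos), ENNReal.ofReal_natCast]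
  gcongr
  exact integral_norm_sq_integral_exp_le hψm hψ hφm hφ

theorem lintegral_atomWeight_sq_le {U : ℝ} (hU : ∀ t, |φu t| ≤ U) (hg : 0 < g) :
    ∫⁻ t, ‖atomWeight k φu g t‖ₑ ^ 2 ≤ ENNReal.ofReal (g ^ 2 / 4 * U ^ 2) * invSqMass k g := by
  rw [invSqMass, ← lintegral_const_mul' _ _ ENNReal.ofReal_ne_top,
    ← lintegral_indicator measurableSet_Icc]
  refine lintegral_mono fun t => ?_
  simp only [atomWeight, Set.indicator]
  split_ifs
  · rw [← ofReal_norm, ← ENNReal.ofReal_pow (norm_nonneg _), ← ENNReal.ofReal_mul (by positivity)]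
    refine ENNReal.ofReal_le_ofReal ?_
    rw [norm_mul, norm_div, norm_div, Complex.norm_real, Complex.norm_real, Real.norm_eq_abs,
      Real.norm_eq_abs, Complex.norm_ofNat, abs_of_pos hg, mul_pow, div_pow, div_pow,
      ← div_eq_mul_inv, mul_div_assoc]
    have h : |φu (g * t)| ^ 2 ≤ U ^ 2 := pow_le_pow_left₀ (abs_nonneg _) (hU _) 2
    norm_num at h ⊢
    gcongr
  · simp

/-- Cauchy–Schwarz on an interval of length `2 / g`: the vanishing of `φ_u` at zero yields `g^α
|t|^α`, and the Sobolev norm absorbs `|t|^α`. The prefactor `g / 2` squared times the length leaves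
one power of `g` beyond `g^(2α)`, which later compensates the `1 / h` in the risk. -/
theorem atomBias_sq_le (hf : f ∈ sobolevClass α K) {U : ℝ}
    (hU0 : 0 < U) (hU : ∀ t, |φu t| ≤ U * |t| ^ α) (hg : 0 < g) (hK : 0 ≤ K) (hp0 : 0 ≤ p)
    (hp1 : p ≤ 1) :
    atomBias f φu p g ^ 2 ≤ U ^ 2 * K / 2 * g ^ (2 * α + 1) := by
  have hfd := hf.1
  have hm := measurable_phi hfd
  set J : ℂ := ∫ t in Set.Icc (-g⁻¹) g⁻¹, φu (g * t) * phi f t with hJ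
  have h1 : ‖J‖ₑ ^ 2 ≤ ENNReal.ofReal ((U * g ^ α) ^ 2 * (2 / g * K)) := by
    have a1 : ‖J‖ₑ ≤ ENNReal.ofReal (U * g ^ α) *
        ∫⁻ t in Set.Icc (-g⁻¹) g⁻¹, 1 * ENNReal.ofReal (|t| ^ α * ‖phi f t‖) := by
      rw [← lintegral_const_mul' _ _ ENNReal.ofReal_ne_top]
      refine (enorm_integral_le_lintegral_enorm _).trans (lintegral_mono fun t => ?_)
      simp only
      rw [one_mul, ← ENNReal.ofReal_mul (by positivity), ← ofReal_norm]
      refine ENNReal.ofReal_le_ofReal ?_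
      rw [norm_mul, Complex.norm_real, Real.norm_eq_abs, ← mul_assoc]
      gcongr
      refine (hU _).trans (le_of_eq ?_)
      rw [abs_mul, abs_of_pos hg, Real.mul_rpow hg.le (abs_nonneg _), mul_assoc]
    have a2 := lintegral_mul_sq_le (volume.restrict (Set.Icc (-g⁻¹) g⁻¹)) (f := fun _ => 1)
      (g := fun t => ENNReal.ofReal (|t| ^ α * ‖phi f t‖)) (by fun_prop) (by fun_prop)
    have a3 : ∫⁻ t in Set.Icc (-g⁻¹) g⁻¹, ENNReal.ofReal (|t| ^ α * ‖phi f t‖) ^ 2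
        ≤ ENNReal.ofReal K := by
      refine le_trans ?_ hf.2
      refine (setLIntegral_le_lintegral _ _).trans (lintegral_mono fun t => ?_)
      simp only
      rw [← ENNReal.ofReal_pow (by positivity)]
      refine ENNReal.ofReal_le_ofReal ?_
      rw [mul_pow, ← Real.rpow_mul_natCast (abs_nonneg _), mul_comm α]
      push_cast
      nlinarith [sq_nonneg ‖phi f t‖]
    calc ‖J‖ₑ ^ 2 ≤ _ := pow_le_pow_left' a1 2
      _ ≤ ENNReal.ofReal (U * g ^ α) ^ 2 * (ENNReal.ofReal (2 / g) * ENNReal.ofReal K) := by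
        rw [mul_pow]
        gcongr
        refine a2.trans ?_
        gcongr
        simp only [one_pow, lintegral_const, MeasurableSet.univ, Measure.restrict_apply,
          Set.univ_inter, Real.volume_Icc, one_mul]
        refine ENNReal.ofReal_le_ofReal (le_of_eq ?_)
        field_simp
        norm_num
      _ = _ := by
        rw [← ENNReal.ofReal_pow (by positivity), ← ENNReal.ofReal_mul (by positivity),
          ← ENNReal.ofReal_mul (by positivity)]
  have h2 : ‖J‖ ^ 2 ≤ (U * g ^ α) ^ 2 * (2 / g * K) := by
    rw [← ofReal_norm, ← ENNReal.ofReal_pow (norm_nonneg _)] at h1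
    exact (ENNReal.ofReal_le_ofReal_iff (by positivity)).1 h1
  have h3 : |atomBias f φu p g| ≤ g / 2 * ‖J‖ := by
    rw [atomBias]
    refine (Complex.abs_re_le_norm _).trans ?_
    rw [norm_mul, norm_mul, show (1 - p : ℂ) = ((1 - p : ℝ) : ℂ) by push_cast; rfl,
      Complex.norm_real, Real.norm_of_nonneg (by linarith), norm_div, Complex.norm_real,
      Real.norm_of_nonneg hg.le, Complex.norm_ofNat]
    exact mul_le_of_le_one_left (by positivity) (by linarith)
  calc atomBias f φu p g ^ 2 = |atomBias f φu p g| ^ 2 := (sq_abs _).symm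
    _ ≤ (g / 2 * ‖J‖) ^ 2 := by gcongr
    _ = g ^ 2 / 4 * ‖J‖ ^ 2 := by ring
    _ ≤ g ^ 2 / 4 * ((U * g ^ α) ^ 2 * (2 / g * K)) := by gcongr
    _ = U ^ 2 * K / 2 * (g ^ (2 * α + 1)) := by
      rw [Real.rpow_add hg, Real.rpow_one, mul_comm 2 α, Real.rpow_mul hg.le]
      norm_num
      field_simp
      norm_num

end

end AtomicDeconv

/-! ### The integrated squared error of the density estimator. -/

namespace AtomicDeconv

open ProbabilityTheory

/-- The weighted stochastic error of the empirical characteristic function. -/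
noncomputable def charNoise {n : ℕ} (k : ℝ → ℝ) (μ : Measure ℝ) (h : ℝ) (s : Finset (Fin n))
    (X : Fin n → ℝ) : ℝ≥0∞ :=
  ∫⁻ t in Set.Icc (-h⁻¹) h⁻¹, ‖phiEmp s X t - charFun μ t‖ₑ ^ 2 *
    ENNReal.ofReal ((‖phi k t‖ ^ 2)⁻¹)

section

variable {k f φu φw : ℝ → ℝ} {α K p q h g : ℝ} {n : ℕ}

theorem IsDensityKernel.exists_bound (hw : IsDensityKernel α φw) (hα : 0 ≤ α) :
    ∃ W > 0, (∀ t, |φw t - 1| ≤ W * |t| ^ α) ∧ ∀ t, |φw t| ≤ 1 + W := by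
  obtain ⟨W, hW, h⟩ := hw.bound
  refine ⟨W, hW, h, fun t => ?_⟩
  rcases le_or_gt |t| 1 with ht | ht
  · have h1 : |φw t - 1| ≤ W := (h t).trans
      (mul_le_of_le_one_right hW.le (Real.rpow_le_one (abs_nonneg _) ht hα))
    have h2 := abs_sub_abs_le_abs_sub (φw t) 1
    rw [abs_one] at h2
    linarith
  · simp [hw.support t ht]
    linarith

theorem measurable_phiEmp_uncurry (s : Finset (Fin n)) :
    Measurable fun z : (Fin n → ℝ) × ℝ => phiEmp s z.1 z.2 := by
  unfold phiEmp
  fun_prop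

theorem measurable_phiEmp (s : Finset (Fin n)) (X : Fin n → ℝ) : Measurable (phiEmp s X) := by
  unfold phiEmp
  fun_prop

theorem norm_phiEmp_le_one (s : Finset (Fin n)) (X : Fin n → ℝ) (t : ℝ) : ‖phiEmp s X t‖ ≤ 1 := by
  rw [phiEmp, norm_mul, norm_inv, Complex.norm_natCast]
  have : ‖∑ j ∈ s, Complex.exp (Complex.I * t * X j)‖ ≤ s.card := by
    refine (norm_sum_le _ _).trans ?_
    simp [norm_exp_I_mul]
  calc _ ≤ (s.card : ℝ)⁻¹ * s.card := by gcongr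
    _ ≤ 1 := inv_mul_le_one

theorem kernel_eq_zero_of_notMem (hw : IsDensityKernel α φw) (hh : 0 < h) {t : ℝ}
    (ht : t ∉ Set.Icc (-h⁻¹) h⁻¹) : φw (h * t) = 0 := by
  refine hw.support _ ?_
  by_contra! hc
  refine ht (abs_le.1 ?_)
  rw [abs_mul, abs_of_pos hh] at hc
  rw [inv_eq_one_div, le_div_iff₀ hh]
  linarith

/-- The kernel cuts off the frequencies beyond `1/h`, and `φ_Z`, continuous and without zeros, is
bounded below on the remaining compact interval. -/
theorem integrable_fEst_symbol (hk : IsDensity k) (h0 : ∀ t, phi k t ≠ 0)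
    (hw : IsDensityKernel α φw) {C : ℝ} (hC : ∀ t, |φw t| ≤ C) (hh : 0 < h)
    (s : Finset (Fin n)) (X : Fin n → ℝ) :
    Integrable fun t : ℝ =>
      (phiEmp s X t - q * phi k t) / ((1 - q) * phi k t) * (φw (h * t) : ℂ) := by
  obtain ⟨M, hM⟩ := exists_bound_inv_phi hk h0 (-h⁻¹) h⁻¹
  have hm := measurable_phi hk
  have hm' := measurable_phiEmp s X
  have hwm := hw.measurable
  have hmm : Measurable fun t : ℝ =>
      (phiEmp s X t - q * phi k t) / ((1 - q) * phi k t) * (φw (h * t) : ℂ) := by fun_prop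
  have hM0 : 0 ≤ M := by
    have : (0 : ℝ) < h⁻¹ := inv_pos.2 hh
    exact (norm_nonneg _).trans (hM 0 ⟨by linarith, this.le⟩)
  have hon : IntegrableOn (fun t : ℝ =>
      (phiEmp s X t - q * phi k t) / ((1 - q) * phi k t) * (φw (h * t) : ℂ))
      (Set.Icc (-h⁻¹) h⁻¹) := by
    refine Measure.integrableOn_of_bounded
      (M := (1 + ‖(q : ℂ)‖ * 1) * (‖(1 - q : ℂ)‖⁻¹ * M) * C) (by simp)
      hmm.aestronglyMeasurable ?_
    refine (ae_restrict_iff' measurableSet_Icc).2 (Eventually.of_forall fun t ht => ?_)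
    rw [norm_mul, Complex.norm_real, Real.norm_eq_abs, norm_div, norm_mul, div_eq_mul_inv, mul_inv,
      ← norm_inv (phi k t)]
    gcongr
    · refine (norm_sub_le _ _).trans ?_
      rw [norm_mul]
      gcongr
      · exact norm_phiEmp_le_one s X t
      · exact norm_phi_le_one hk t
    · exact hM t ht
    · exact hC _
  rw [← integrable_indicator_iff measurableSet_Icc] at hon
  refine hon.congr (Eventually.of_forall fun t => ?_)
  simp only [Set.indicator]
  split_ifs with ht
  · rfl
  · simp [kernel_eq_zero_of_notMem hw hh ht]

/-- Replacing the empirical characteristic function by its mean leaves `(p - q + (1 - p) φ_f) / (1 -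
q)`, which differs from `φ_f` by exactly `(p - q) / (1 - q)` times `1 - φ_f`. The other two terms
are the noise and the smoothing bias. -/
theorem symbol_sub_eq (hk : IsDensity k) (hf : IsDensity f) (h0 : ∀ t, phi k t ≠ 0)
    (hp0 : 0 ≤ p) (hp1 : p ≤ 1) (hq : q < 1) (w : ℂ) (s : Finset (Fin n)) (X : Fin n → ℝ)
    (t : ℝ) :
    (phiEmp s X t - q * phi k t) / ((1 - q) * phi k t) * w - phi f t
      = w * (((p - q) / (1 - q) : ℝ) * (1 - phi f t))
        + w * ((((1 - q)⁻¹ : ℝ) : ℂ) * ((phiEmp s X t - charFun (obsLaw k p f) t) / phi k t))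
        + (w - 1) * phi f t := by
  rw [charFun_obsLaw hk hf hp0 hp1]
  have h1 := h0 t
  have h2 : (1 - q : ℂ) ≠ 0 := by
    have : ((1 - q : ℝ) : ℂ) ≠ 0 := by exact_mod_cast (by linarith : (1 - q : ℝ) ≠ 0)
    simpa using this
  push_cast
  field_simp
  ring

theorem sq_norm_add_add_le (a b c : ℂ) :
    ‖a + b + c‖ ^ 2 ≤ 3 * (‖a‖ ^ 2 + ‖b‖ ^ 2 + ‖c‖ ^ 2) := by
  have h : ‖a + b + c‖ ≤ ‖a‖ + ‖b‖ + ‖c‖ := norm_add₃_le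
  calc ‖a + b + c‖ ^ 2 ≤ (‖a‖ + ‖b‖ + ‖c‖) ^ 2 := by gcongr
    _ ≤ _ := by
      nlinarith [sq_nonneg (‖a‖ - ‖b‖), sq_nonneg (‖a‖ - ‖c‖), sq_nonneg (‖b‖ - ‖c‖)]

/-- The integrated squared error of the density estimator with a given value `q` in place
of `p`. -/
theorem lintegral_fEst_sub_sq_le (hk : IsDensity k) (hf : f ∈ sobolevClass α K)
    (h0 : ∀ t, phi k t ≠ 0) (hp0 : 0 ≤ p) (hp1 : p ≤ 1) (hq : q < 1)
    (hw : IsDensityKernel α φw) {W : ℝ} (hW : ∀ t, |φw t - 1| ≤ W * |t| ^ α)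
    (hC : ∀ t, |φw t| ≤ 1 + W) (hh : 0 < h) (s : Finset (Fin n)) (X : Fin n → ℝ) :
    ∫⁻ x, ENNReal.ofReal ((fEst k φw h s q X x - f x) ^ 2)
      ≤ ENNReal.ofReal (8 * (1 + W) ^ 2 / h * ((p - q) / (1 - q)) ^ 2)
        + ENNReal.ofReal ((1 + W) ^ 2 * ((1 - q)⁻¹) ^ 2) * charNoise k (obsLaw k p f) h s X
        + ENNReal.ofReal (W ^ 2 * h ^ (2 * α)) * ENNReal.ofReal K := by
  have hfd := hf.1
  have hmf := measurable_phi hfd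
  have hmk := measurable_phi hk
  have hme := measurable_phiEmp s X
  have hW0 : 0 ≤ W := by
    have := (abs_nonneg _).trans (hW 1); simpa using this
  have hprob := isProbabilityMeasure_obsLaw hk hfd hp0 hp1
  have hmc : Measurable (charFun (obsLaw k p f)) := continuous_charFun.measurable
  -- The estimator is the real part of an inverse transform and `f` is real, so discarding the
  -- imaginary part cannot increase the error.
  have hstep : ∫⁻ x, ENNReal.ofReal ((fEst k φw h s q X x - f x) ^ 2)
      ≤ ENNReal.ofReal (2 * Real.pi)⁻¹ * ∫⁻ t : ℝ,
        ‖(phiEmp s X t - q * phi k t) / ((1 - q) * phi k t) * (φw (h * t) : ℂ) - phi f t‖ₑ ^ 2 := by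
    have hpl := lintegral_inverse_sub_sq_le
      (integrable_fEst_symbol (q := q) hk h0 hw hC hh s X) (hfd.integrable.ofReal (𝕜 := ℂ))
    simp_rw [phi_eq_integral hfd]
    refine le_trans (lintegral_mono fun x => ?_) hpl
    simp only
    rw [← ofReal_norm, ← ENNReal.ofReal_pow (norm_nonneg _)]
    refine ENNReal.ofReal_le_ofReal ?_
    rw [← sq_abs]
    gcongr
    rw [fEst]
    simp_rw [mul_assoc (Complex.exp _)]
    rw [← Complex.ofReal_re (f x), ← Complex.sub_re, Complex.ofReal_re]
    exact Complex.abs_re_le_norm _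
  refine hstep.trans ?_
  have hpt : ∀ t : ℝ,
      ‖(phiEmp s X t - q * phi k t) / ((1 - q) * phi k t) * (φw (h * t) : ℂ) - phi f t‖ₑ ^ 2
      ≤ 3 * ((Set.Icc (-h⁻¹) h⁻¹).indicator
          (fun _ => ENNReal.ofReal (4 * (1 + W) ^ 2 * ((p - q) / (1 - q)) ^ 2)) t
        + (Set.Icc (-h⁻¹) h⁻¹).indicator (fun t =>
          ENNReal.ofReal ((1 + W) ^ 2 * ((1 - q)⁻¹) ^ 2) *
          (‖phiEmp s X t - charFun (obsLaw k p f) t‖ₑ ^ 2 * ENNReal.ofReal ((‖phi k t‖ ^ 2)⁻¹))) t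
        + ENNReal.ofReal (W ^ 2 * h ^ (2 * α)) *
          ENNReal.ofReal (‖phi f t‖ ^ 2 * (1 + |t| ^ (2 * α)))) := fun t => by
    rw [symbol_sub_eq hk hfd h0 hp0 hp1 hq]
    have hthird : ‖((φw (h * t) : ℂ) - 1) * phi f t‖ ^ 2
        ≤ (W ^ 2 * h ^ (2 * α)) * (‖phi f t‖ ^ 2 * (1 + |t| ^ (2 * α))) := by
      have e : ‖(φw (h * t) : ℂ) - 1‖ ≤ W * (h ^ α * |t| ^ α) := by
        rw [← Complex.ofReal_one, ← Complex.ofReal_sub, Complex.norm_real, Real.norm_eq_abs]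
        refine (hW _).trans (le_of_eq ?_)
        rw [abs_mul, abs_of_pos hh, Real.mul_rpow hh.le (abs_nonneg _)]
      rw [norm_mul, mul_pow]
      calc ‖(φw (h * t) : ℂ) - 1‖ ^ 2 * ‖phi f t‖ ^ 2
          ≤ (W * (h ^ α * |t| ^ α)) ^ 2 * ‖phi f t‖ ^ 2 := by gcongr
        _ = (W ^ 2 * h ^ (2 * α)) * (‖phi f t‖ ^ 2 * |t| ^ (2 * α)) := by
          rw [mul_comm 2 α, Real.rpow_mul hh.le, Real.rpow_mul (abs_nonneg t)]
          norm_num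
          ring
        _ ≤ _ := by gcongr; linarith
    have hfirst : ‖(φw (h * t) : ℂ) * (((p - q) / (1 - q) : ℝ) * (1 - phi f t))‖ ^ 2
        ≤ 4 * (1 + W) ^ 2 * ((p - q) / (1 - q)) ^ 2 := by
      have e1 : ‖(1 : ℂ) - phi f t‖ ≤ 2 := by
        refine (norm_sub_le _ _).trans ?_
        have := norm_phi_le_one hfd t
        rw [norm_one]; linarith
      have e2 : |φw (h * t)| ^ 2 ≤ (1 + W) ^ 2 := pow_le_pow_left₀ (abs_nonneg _) (hC _) 2
      rw [norm_mul, norm_mul, Complex.norm_real, Complex.norm_real, Real.norm_eq_abs,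
        Real.norm_eq_abs, mul_pow, mul_pow, sq_abs ((p - q) / (1 - q))]
      calc |φw (h * t)| ^ 2 * (((p - q) / (1 - q)) ^ 2 * ‖(1 : ℂ) - phi f t‖ ^ 2)
          ≤ (1 + W) ^ 2 * (((p - q) / (1 - q)) ^ 2 * 2 ^ 2) := by gcongr
        _ = _ := by ring
    have hsecond : ‖(φw (h * t) : ℂ) * ((((1 - q)⁻¹ : ℝ) : ℂ) *
          ((phiEmp s X t - charFun (obsLaw k p f) t) / phi k t))‖ ^ 2
        ≤ ((1 + W) ^ 2 * ((1 - q)⁻¹) ^ 2) *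
          (‖phiEmp s X t - charFun (obsLaw k p f) t‖ ^ 2 * (‖phi k t‖ ^ 2)⁻¹) := by
      have e2 : |φw (h * t)| ^ 2 ≤ (1 + W) ^ 2 := pow_le_pow_left₀ (abs_nonneg _) (hC _) 2
      rw [norm_mul, norm_mul, Complex.norm_real, Complex.norm_real, Real.norm_eq_abs,
        Real.norm_eq_abs, mul_pow, mul_pow, sq_abs (1 - q)⁻¹, norm_div, div_pow, ← mul_assoc,
        div_eq_mul_inv]
      gcongr
    have hall := sq_norm_add_add_le
      ((φw (h * t) : ℂ) * (((p - q) / (1 - q) : ℝ) * (1 - phi f t)))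
      ((φw (h * t) : ℂ) * ((((1 - q)⁻¹ : ℝ) : ℂ) *
          ((phiEmp s X t - charFun (obsLaw k p f) t) / phi k t)))
      (((φw (h * t) : ℂ) - 1) * phi f t)
    rw [← ofReal_norm, ← ENNReal.ofReal_pow (norm_nonneg _)]
    refine (ENNReal.ofReal_le_ofReal hall).trans ?_
    rw [ENNReal.ofReal_mul (by norm_num), ENNReal.ofReal_add (by positivity) (by positivity),
      ENNReal.ofReal_add (by positivity) (by positivity), ENNReal.ofReal_ofNat]
    rw [← ENNReal.ofReal_mul (p := W ^ 2 * h ^ (2 * α)) (by positivity)]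
    by_cases ht : t ∈ Set.Icc (-h⁻¹) h⁻¹
    · rw [Set.indicator_of_mem ht, Set.indicator_of_mem ht, ← ofReal_norm,
        ← ENNReal.ofReal_pow (norm_nonneg _), ← ENNReal.ofReal_mul (by positivity),
        ← ENNReal.ofReal_mul (by positivity)]
      gcongr
    -- Beyond `1/h` the kernel vanishes and only the bias term survives.
    · rw [Set.indicator_of_notMem ht, Set.indicator_of_notMem ht]
      rw [kernel_eq_zero_of_notMem hw hh ht] at hthird ⊢
      simp only [Complex.ofReal_zero, zero_mul, norm_zero, ne_eq, OfNat.ofNat_ne_zero,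
        not_false_eq_true, zero_pow, ENNReal.ofReal_zero, zero_add]
      gcongr
      simpa using hthird
  -- The factor `3` from squaring a sum of three terms is absorbed by the Plancherel constant.
  have h3 : ENNReal.ofReal (2 * Real.pi)⁻¹ * 3 ≤ 1 := by
    rw [← ENNReal.ofReal_ofNat, ← ENNReal.ofReal_mul (by positivity), ENNReal.ofReal_le_one]
    rw [inv_mul_le_iff₀ (by positivity)]
    have := Real.pi_gt_three
    linarith
  calc _ ≤ ENNReal.ofReal (2 * Real.pi)⁻¹ * (3 * _) := by
        gcongr
        refine (lintegral_mono hpt).trans (le_of_eq ?_)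
        rw [lintegral_const_mul' _ _ (by norm_num)]
    _ ≤ 1 * _ := by
        rw [← mul_assoc]
        gcongr
    _ = _ := by
        have hmK : Measurable fun t => ENNReal.ofReal (W ^ 2 * h ^ (2 * α)) *
          ENNReal.ofReal (‖phi f t‖ ^ 2 * (1 + |t| ^ (2 * α))) := by fun_prop
        rw [one_mul, lintegral_add_right _ hmK,
          lintegral_add_left (measurable_const.indicator measurableSet_Icc),
          lintegral_indicator measurableSet_Icc, lintegral_indicator measurableSet_Icc,
          lintegral_const_mul' _ _ ENNReal.ofReal_ne_top,
          lintegral_const_mul' _ _ ENNReal.ofReal_ne_top]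
    _ ≤ _ := by
        gcongr
        · rw [lintegral_const, Measure.restrict_apply MeasurableSet.univ, Set.univ_inter,
            Real.volume_Icc, ← ENNReal.ofReal_mul (by positivity)]
          refine ENNReal.ofReal_le_ofReal (le_of_eq ?_)
          ring
        · exact le_rfl
        · exact hf.2

/-- At each frequency a mean of independent unimodular variables has mean square error at most one
over the sample size; Tonelli does the rest. -/
theorem lintegral_charNoise_le (hk : IsDensity k) {μ : Measure ℝ} [IsProbabilityMeasure μ]
    {s : Finset (Fin n)} (hs : s.Nonempty) :
    ∫⁻ X, charNoise k μ h s X ∂(Measure.pi fun _ => μ) ≤ invSqMass k h / s.card := by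
  have hmk := measurable_phi hk
  have hme := measurable_phiEmp_uncurry s
  have hmc : Measurable (charFun μ) := continuous_charFun.measurable
  simp_rw [charNoise, invSqMass]
  rw [lintegral_lintegral_swap (by fun_prop), div_eq_mul_inv, mul_comm,
    ← lintegral_const_mul' _ _ (by simp [hs.ne_empty])]
  refine lintegral_mono fun t => ?_
  simp only
  rw [lintegral_mul_const' _ _ ENNReal.ofReal_ne_top]
  gcongr
  have := lintegral_mean_sub_sq_le (μ := μ) (H := fun x => Complex.exp (Complex.I * t * x))
    (by fun_prop) (fun x => (norm_exp_I_mul t x).le) s hs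
  simp only [norm_exp_I_mul, one_pow, integral_const, probReal_univ, smul_eq_mul, mul_one] at this
  rw [ENNReal.ofReal_div_of_pos (by exact_mod_cast hs.card_pos), ENNReal.ofReal_natCast,
    ENNReal.ofReal_one, one_div] at this
  refine le_trans (le_of_eq ?_) this
  simp_rw [phiEmp, charFun_eq_integral_exp]

theorem measurable_pEst (hk : IsDensity k) (h0 : ∀ t, phi k t ≠ 0) (hu : Measurable φu)
    {U : ℝ} (hU : ∀ t, |φu t| ≤ U) (hg : 0 < g) (s : Finset (Fin n)) :
    Measurable fun X => pEst k φu g s X := by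
  simp_rw [pEst_eq_re hk h0 hu hU hg]
  have := (stronglyMeasurable_integral_exp (measurable_atomWeight (g := g) hk hu)).measurable
  have h2 : ∀ j, Measurable fun X : Fin n → ℝ =>
      ∫ t, atomWeight k φu g t * Complex.exp (Complex.I * t * X j) := fun j =>
    this.comp (measurable_pi_apply j)
  fun_prop

theorem isEstimator_fEst (hk : IsDensity k) (hw : Measurable φw) (s : Finset (Fin n))
    {Q : (Fin n → ℝ) → ℝ} (hQ : Measurable Q) :
    IsEstimator fun X x => fEst k φw h s (Q X) X x := by
  have hmk := measurable_phi hk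
  have hme := measurable_phiEmp_uncurry s
  unfold IsEstimator Function.uncurry fEst
  have h1 : StronglyMeasurable fun z : ((Fin n → ℝ) × ℝ) => ∫ t : ℝ,
      Complex.exp (-(Complex.I * t * z.2)) *
      ((phiEmp s z.1 t - Q z.1 * phi k t) / ((1 - Q z.1) * phi k t)) * (φw (h * t) : ℂ) := by
    refine StronglyMeasurable.integral_prod_right' (f := fun z : ((Fin n → ℝ) × ℝ) × ℝ =>
      Complex.exp (-(Complex.I * z.2 * z.1.2)) *
      ((phiEmp s z.1.1 z.2 - Q z.1.1 * phi k z.2) / ((1 - Q z.1.1) * phi k z.2))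
        * (φw (h * z.2) : ℂ)) ?_
    have h2 : Measurable fun z : ((Fin n → ℝ) × ℝ) × ℝ => phiEmp s z.1.1 z.2 :=
      hme.comp (f := fun z : ((Fin n → ℝ) × ℝ) × ℝ => (z.1.1, z.2)) (by fun_prop)
    exact (by fun_prop : Measurable _).stronglyMeasurable
  have := h1.measurable
  fun_prop

end

end AtomicDeconv

/-! ### Truncation of the estimator of `p`, and risk bounds with and without sample splitting. -/

namespace AtomicDeconv

open ProbabilityTheory

/-- A function of the coordinates in `s` factors through the restriction to `s`, recovered by
extending the restricted sample by zero; restrictions to disjoint sets of coordinates are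
independent. -/
theorem lintegral_mul_eq_of_disjoint {n : ℕ} {μ : Measure ℝ} [IsProbabilityMeasure μ]
    {s s' : Finset (Fin n)} (hs : Disjoint s s') {A B : (Fin n → ℝ) → ℝ≥0∞} (hA : Measurable A)
    (hB : Measurable B) (hAs : ∀ X X', (∀ j ∈ s, X j = X' j) → A X = A X')
    (hBs : ∀ X X', (∀ j ∈ s', X j = X' j) → B X = B X') :
    ∫⁻ X, A X * B X ∂(Measure.pi fun _ => μ)
      = (∫⁻ X, A X ∂(Measure.pi fun _ => μ)) * ∫⁻ X, B X ∂(Measure.pi fun _ => μ) := by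
  have hind : iIndepFun (fun (j : Fin n) (X : Fin n → ℝ) => X j) (Measure.pi fun _ => μ) :=
    iIndepFun_pi (X := fun _ => id) (fun _ => aemeasurable_id)
  have hfin := hind.indepFun_finset s s' hs (fun j => measurable_pi_apply j)
  let ext : (t : Finset (Fin n)) → ((t → ℝ) → Fin n → ℝ) := fun t y j =>
    if h : j ∈ t then y ⟨j, h⟩ else 0
  have hext : ∀ t, Measurable (ext t) := fun t => by
    refine measurable_pi_lambda _ fun j => ?_
    by_cases h : j ∈ t
    · simp only [ext, h, dite_true]
      exact measurable_pi_apply _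
    · simp only [ext, h, dite_false]
      exact measurable_const
  have hcomp := hfin.comp (hA.comp (hext s)) (hB.comp (hext s'))
  have eA : ((A ∘ ext s) ∘ fun (X : Fin n → ℝ) (i : s) => X i) = A := by
    ext X
    refine hAs _ _ fun j hj => ?_
    simp [ext, hj]
  have eB : ((B ∘ ext s') ∘ fun (X : Fin n → ℝ) (i : s') => X i) = B := by
    ext X
    refine hBs _ _ fun j hj => ?_
    simp [ext, hj]
  rw [eA, eB] at hcomp
  exact lintegral_mul_eq_lintegral_mul_lintegral_of_indepFun hA hB hcomp

/-- The residual term which is nonzero only for the sample sizes at which the truncation may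
interfere. -/
noncomputable def truncRemainder (ε D B : ℝ) : ℝ :=
  open Classical in if ε ≤ D ∧ B ≤ (D / 2) ^ 2 then 0 else 4 * ε⁻¹ ^ 2

theorem truncRemainder_nonneg (ε D B : ℝ) : 0 ≤ truncRemainder ε D B := by
  unfold truncRemainder
  split_ifs
  · exact le_rfl
  · positivity

/-- Since `q` may come within `ε` of `1`, dividing by `1 - q` naively would multiply bias and noise
alike by `ε⁻¹`. Here only the noise `ν` pays this; the bias `b` is divided by `1 - pstar`, by an
absorption argument. When that argument is not available, `|p - q| ≤ 2` and `1 - q ≥ ε` give the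
remainder term. -/
theorem trunc_ratio_sq_le {p pstar ε ps ν b B q : ℝ} (hp0 : 0 ≤ p) (hp : p ≤ pstar)
    (hpstar : pstar < 1) (hε : 0 < ε) (hε1 : ε < 1) (hps : ps - p = ν + b) (hb : b ^ 2 ≤ B)
    (hq : q = max (-1 + ε) (min ps (1 - ε))) :
    ((p - q) / (1 - q)) ^ 2
      ≤ 8 * B / (1 - pstar) ^ 2 + truncRemainder ε (1 - pstar) B + 8 * ε⁻¹ ^ 2 * ν ^ 2 := by
  have hB : 0 ≤ B := (sq_nonneg b).trans hb
  have hD : 0 < 1 - pstar := by linarith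
  have hq1 : q ≤ 1 - ε := by
    rw [hq]; exact max_le (by linarith) (min_le_right _ _)
  have hq2 : -1 + ε ≤ q := by rw [hq]; exact le_max_left _ _
  have hq3 : 0 < 1 - q := by linarith
  unfold truncRemainder
  split_ifs with hc
  · obtain ⟨h1, h2⟩ := hc
    -- As `ε ≤ 1 - pstar`, the true `p` lies in the truncation interval, and projecting onto an
    -- interval does not increase the distance to its points.
    have hproj : |p - q| ≤ |ν| + |b| := by
      have : |p - q| ≤ |ps - p| := by
        rw [hq, abs_le]
        rcases max_cases (-1 + ε) (min ps (1 - ε)) with ⟨h, h'⟩ | ⟨h, h'⟩ <;>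
        rcases min_cases ps (1 - ε) with ⟨h3, h4⟩ | ⟨h3, h4⟩ <;>
        rcases abs_cases (ps - p) with ⟨h5, h6⟩ | ⟨h5, h6⟩ <;>
        constructor <;> linarith
      rw [hps] at this
      exact this.trans (abs_add_le _ _)
    set x := |p - q| / (1 - q) with hx
    have hx0 : 0 ≤ x := by positivity
    have hxm : x * (1 - q) = |p - q| := by rw [hx]; field_simp
    have hb2 : |b| ≤ (1 - pstar) / 2 := abs_le_of_sq_le_sq (hb.trans h2) (by linarith)
    -- This is `1 - p = (1 - q) - (p - q)`: the random `1 - q` can be small only if the relative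
    -- error `x` is large.
    have hDq : 1 - pstar ≤ (1 - q) * (1 + x) := by
      have := neg_abs_le (p - q)
      nlinarith
    -- The smallness `|b| ≤ (1 - pstar) / 2` gives `x` the coefficient `1/2`, so that it can be
    -- moved to the left side in `hxle`.
    have hbq : |b| / (1 - q) ≤ |b| / (1 - pstar) + x / 2 := by
      rw [div_le_iff₀ hq3]
      have e1 : |b| * (1 - pstar) ≤ |b| * ((1 - q) * (1 + x)) := by gcongr
      have e2 : |b| ≤ (1 - q) * (1 + x) * (|b| / (1 - pstar)) := by
        rw [mul_div_assoc', le_div_iff₀ hD]; linarith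
      have e3 : |b| / (1 - pstar) ≤ 1 / 2 := by rw [div_le_iff₀ hD]; linarith
      have e4 : (1 - q) * x * (|b| / (1 - pstar)) ≤ (1 - q) * x * (1 / 2) := by gcongr
      linarith
    have hνq : |ν| / (1 - q) ≤ |ν| * ε⁻¹ := by
      rw [div_eq_mul_inv]
      gcongr
      linarith
    have hxle : x ≤ 2 * (|b| / (1 - pstar) + |ν| * ε⁻¹) := by
      have : x ≤ |ν| / (1 - q) + |b| / (1 - q) := by
        rw [hx, ← add_div]; gcongr
      linarith
    have hxx : ((p - q) / (1 - q)) ^ 2 = x ^ 2 := by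
      rw [hx, div_pow, div_pow, sq_abs]
    rw [hxx]
    have e5 : (|b| / (1 - pstar)) ^ 2 ≤ B / (1 - pstar) ^ 2 := by
      rw [div_pow, sq_abs]; gcongr
    have e6 : (|ν| * ε⁻¹) ^ 2 = ε⁻¹ ^ 2 * ν ^ 2 := by rw [mul_pow, sq_abs]; ring
    calc x ^ 2 ≤ (2 * (|b| / (1 - pstar) + |ν| * ε⁻¹)) ^ 2 := by gcongr
      _ ≤ 8 * (|b| / (1 - pstar)) ^ 2 + 8 * (|ν| * ε⁻¹) ^ 2 := by
        nlinarith [sq_nonneg (|b| / (1 - pstar) - |ν| * ε⁻¹)]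
      _ ≤ _ := by
        rw [e6]
        have : 8 * (|b| / (1 - pstar)) ^ 2 ≤ 8 * (B / (1 - pstar) ^ 2) := by gcongr
        rw [mul_div_assoc]
        linarith
  · have h1 : ((p - q) / (1 - q)) ^ 2 ≤ 4 * ε⁻¹ ^ 2 := by
      rw [div_eq_mul_inv, mul_pow]
      gcongr
      · nlinarith
      · linarith
    have : 0 ≤ 8 * B / (1 - pstar) ^ 2 := by positivity
    have : 0 ≤ 8 * ε⁻¹ ^ 2 * ν ^ 2 := by positivity
    linarith

/-- From `1 - p = (1 - q) - (p - q)` follows `(1 - p)² ≤ 2 (1 - q)² + 2 (p - q)²`. Hence a bound on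
the mean squared relative error bounds the mean of `(1 - q)⁻²` without a further power of `ε⁻¹`. -/
theorem inv_sq_le {p pstar q : ℝ} (hp : p ≤ pstar) (hpstar : pstar < 1) (hq : q < 1) :
    ((1 - q)⁻¹) ^ 2 ≤ 2 / (1 - pstar) ^ 2 * (1 + ((p - q) / (1 - q)) ^ 2) := by
  have hD : 0 < 1 - pstar := by linarith
  have hq3 : 0 < 1 - q := by linarith
  rw [div_pow, inv_pow, inv_eq_one_div, div_le_iff₀ (by positivity), div_mul_eq_mul_div,
    div_mul_eq_mul_div, le_div_iff₀ (by positivity), mul_assoc, add_mul,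
    div_mul_cancel₀ _ (by positivity)]
  have : (1 - pstar) ^ 2 ≤ (1 - p) ^ 2 := by gcongr
  nlinarith [sq_nonneg ((1 - q) + (p - q))]

theorem isProbabilityMeasure_sampleLaw (n : ℕ) {k f : ℝ → ℝ} {p : ℝ} (hk : IsDensity k)
    (hf : IsDensity f) (h0 : 0 ≤ p) (h1 : p ≤ 1) : IsProbabilityMeasure (sampleLaw n k p f) := by
  have := isProbabilityMeasure_obsLaw hk hf h0 h1
  unfold sampleLaw
  infer_instance

section

variable {k f φu φw : ℝ → ℝ} {α K p pstar q h g ε U W : ℝ} {n : ℕ}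

/-- The bound for the mean square of the relative error of the estimator of `p`. -/
noncomputable def atomRisk (α K pstar ε U Λ g J : ℝ) (m : ℕ) : ℝ :=
  8 * (U ^ 2 * K / 2 * g ^ (2 * α + 1)) / (1 - pstar) ^ 2
    + truncRemainder ε (1 - pstar) (U ^ 2 * K / 2 * g ^ (2 * α + 1))
    + 8 * ε⁻¹ ^ 2 * (g ^ 2 / 4 * U ^ 2 * J * Λ / m)

theorem atomRisk_nonneg {Λ J : ℝ} {m : ℕ} (hK : 0 ≤ K) (hg : 0 < g) (hΛ : 0 ≤ Λ) (hJ : 0 ≤ J) :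
    0 ≤ atomRisk α K pstar ε U Λ g J m := by
  unfold atomRisk
  have := truncRemainder_nonneg ε (1 - pstar) (U ^ 2 * K / 2 * g ^ (2 * α + 1))
  positivity

theorem pEstTrunc_le (hε1 : ε < 1) (s : Finset (Fin n)) (X : Fin n → ℝ) :
    pEstTrunc k φu g ε s X ≤ 1 - ε :=
  max_le (by linarith) (min_le_right _ _)

theorem measurable_pEstTrunc (hk : IsDensity k) (h0 : ∀ t, phi k t ≠ 0) (hu : Measurable φu)
    (hU : ∀ t, |φu t| ≤ U) (hg : 0 < g) (s : Finset (Fin n)) :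
    Measurable fun X => pEstTrunc k φu g ε s X := by
  have := measurable_pEst hk h0 hu hU hg s
  unfold pEstTrunc
  fun_prop

/-- The pointwise bound is integrated: bias and truncation remainder are deterministic, and the
noise is controlled by the Schur bound, with the `L¹` norm of `φ_Z` as its constant. -/
theorem lintegral_ratio_sq_le (hk : IsDensity k) (hki : Integrable (phi k))
    (hf : f ∈ sobolevClass α K)
    (h0 : ∀ t, phi k t ≠ 0) (hp0 : 0 ≤ p) (hp : p ≤ pstar) (hpstar : pstar < 1) (hε : 0 < ε)
    (hε1 : ε < 1) (hu : IsAtomKernel α φu) (hU0 : 0 < U) (hUα : ∀ t, |φu t| ≤ U * |t| ^ α)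
    (hU : ∀ t, |φu t| ≤ U) (hK : 0 ≤ K) (hg : 0 < g) {J : ℝ} (hJ0 : 0 ≤ J)
    (hJ : invSqMass k g ≤ ENNReal.ofReal J) {s : Finset (Fin n)} (hs : s.Nonempty) :
    ∫⁻ X, ENNReal.ofReal (((p - pEstTrunc k φu g ε s X) / (1 - pEstTrunc k φu g ε s X)) ^ 2)
        ∂(sampleLaw n k p f)
      ≤ ENNReal.ofReal (atomRisk α K pstar ε U (∫ t, ‖phi k t‖) g J s.card) := by
  have hfd := hf.1
  have hp1 : p ≤ 1 := by linarith
  have hprob := isProbabilityMeasure_obsLaw hk hfd hp0 hp1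
  have hΛ : 0 ≤ ∫ t, ‖phi k t‖ := integral_nonneg fun _ => norm_nonneg _
  have hcard : (0 : ℝ) < s.card := by exact_mod_cast hs.card_pos
  set B := U ^ 2 * K / 2 * g ^ (2 * α + 1) with hB
  have hB0 : 0 ≤ B := by positivity
  have hR := truncRemainder_nonneg ε (1 - pstar) B
  have hpt : ∀ X : Fin n → ℝ,
      ENNReal.ofReal (((p - pEstTrunc k φu g ε s X) / (1 - pEstTrunc k φu g ε s X)) ^ 2)
      ≤ ENNReal.ofReal (8 * B / (1 - pstar) ^ 2 + truncRemainder ε (1 - pstar) B)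
        + ENNReal.ofReal (8 * ε⁻¹ ^ 2) *
          ‖avgError (obsLaw k p f) (atomWeight k φu g) s X‖ₑ ^ 2 := fun X => by
    have := trunc_ratio_sq_le hp0 hp hpstar hε hε1
      (pEst_sub_eq hk hfd h0 hu hU hg hp0 hp1 s X)
      (atomBias_sq_le hf hU0 hUα hg hK hp0 hp1) (q := pEstTrunc k φu g ε s X) rfl
    rw [← ofReal_norm, ← ENNReal.ofReal_pow (norm_nonneg _), ← ENNReal.ofReal_mul (by positivity),
      ← ENNReal.ofReal_add (by positivity) (by positivity)]
    have hre : (avgError (obsLaw k p f) (atomWeight k φu g) s X).re ^ 2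
        ≤ ‖avgError (obsLaw k p f) (atomWeight k φu g) s X‖ ^ 2 := by
      rw [← sq_abs]
      exact pow_le_pow_left₀ (abs_nonneg _) (Complex.abs_re_le_norm _) 2
    refine ENNReal.ofReal_le_ofReal (this.trans ?_)
    rw [hB]
    gcongr
  refine (lintegral_mono hpt).trans ?_
  rw [lintegral_add_left measurable_const, lintegral_const_mul' _ _ ENNReal.ofReal_ne_top]
  have hv := lintegral_avgError_sq_le (μ := obsLaw k p f)
    (measurable_atomWeight (g := g) hk hu.measurable)
    (integrable_atomWeight hk h0 hu.measurable hU) (measurable_phi hk)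
    (norm_charFun_obsLaw_le hk hfd hp0 hp1) hs
  have hw := lintegral_atomWeight_sq_le (k := k) hU hg
  have hΛ' : ∫⁻ t, ‖phi k t‖ₑ = ENNReal.ofReal (∫ t, ‖phi k t‖) := by
    rw [ofReal_integral_eq_lintegral_ofReal hki.norm (Eventually.of_forall fun _ => norm_nonneg _)]
    simp_rw [ofReal_norm]
  have hvar : ∫⁻ X, ‖avgError (obsLaw k p f) (atomWeight k φu g) s X‖ₑ ^ 2
      ∂(sampleLaw n k p f)
      ≤ ENNReal.ofReal (g ^ 2 / 4 * U ^ 2 * J * (∫ t, ‖phi k t‖) / s.card) := by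
    refine hv.trans ?_
    rw [ENNReal.ofReal_div_of_pos hcard, ENNReal.ofReal_natCast, hΛ',
      ENNReal.ofReal_mul (by positivity), ENNReal.ofReal_mul (by positivity)]
    gcongr
    refine hw.trans ?_
    gcongr
  unfold atomRisk
  have := isProbabilityMeasure_sampleLaw n hk hfd hp0 hp1
  rw [lintegral_const, measure_univ, mul_one, ← hB,
    ENNReal.ofReal_add (q := 8 * ε⁻¹ ^ 2 * _) (by positivity) (by positivity),
    ENNReal.ofReal_mul (p := 8 * ε⁻¹ ^ 2) (by positivity)]
  gcongr

theorem pEst_congr {s : Finset (Fin n)} {X X' : Fin n → ℝ} (h : ∀ j ∈ s, X j = X' j) :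
    pEst k φu g s X = pEst k φu g s X' := by
  have : ∀ t, phiEmp s X t = phiEmp s X' t := fun t => by
    unfold phiEmp
    rw [Finset.sum_congr rfl fun j hj => by rw [h j hj]]
  unfold pEst
  simp_rw [this]

theorem charNoise_congr {μ : Measure ℝ} {s : Finset (Fin n)} {X X' : Fin n → ℝ}
    (h : ∀ j ∈ s, X j = X' j) : charNoise k μ g s X = charNoise k μ g s X' := by
  have : ∀ t, phiEmp s X t = phiEmp s X' t := fun t => by
    unfold phiEmp
    rw [Finset.sum_congr rfl fun j hj => by rw [h j hj]]
  unfold charNoise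
  simp_rw [this]

theorem measurable_charNoise (hk : IsDensity k) {μ : Measure ℝ} [IsProbabilityMeasure μ]
    (s : Finset (Fin n)) : Measurable (charNoise k μ h s) := by
  have hmk := measurable_phi hk
  have hme := measurable_phiEmp_uncurry s
  have hmc : Measurable (charFun μ) := continuous_charFun.measurable
  unfold charNoise
  exact Measurable.lintegral_prod_right' (f := fun z : (Fin n → ℝ) × ℝ =>
    ‖phiEmp s z.1 z.2 - charFun μ z.2‖ₑ ^ 2 * ENNReal.ofReal ((‖phi k z.2‖ ^ 2)⁻¹)) (by fun_prop)

/-- The mean integrated squared error in terms of the relative error of the estimator of `p` and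
of the stochastic error of the empirical characteristic function. -/
theorem mise_fEst_le (hk : IsDensity k) (hf : f ∈ sobolevClass α K)
    (h0 : ∀ t, phi k t ≠ 0) (hp0 : 0 ≤ p) (hp1 : p ≤ 1) (hε : 0 < ε) (hε1 : ε < 1)
    (hu : IsAtomKernel α φu) (hU : ∀ t, |φu t| ≤ U) (hg : 0 < g)
    (hw : IsDensityKernel α φw) (hW : ∀ t, |φw t - 1| ≤ W * |t| ^ α)
    (hC : ∀ t, |φw t| ≤ 1 + W) (hh : 0 < h) (s s' : Finset (Fin n)) :
    mise k (fun X => fEst k φw h s' (pEstTrunc k φu g ε s X) X) p f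
      ≤ ENNReal.ofReal (8 * (1 + W) ^ 2 / h) * (∫⁻ X, ENNReal.ofReal
          (((p - pEstTrunc k φu g ε s X) / (1 - pEstTrunc k φu g ε s X)) ^ 2)
          ∂(sampleLaw n k p f))
        + ENNReal.ofReal ((1 + W) ^ 2) *
          (∫⁻ X, ENNReal.ofReal (((1 - pEstTrunc k φu g ε s X)⁻¹) ^ 2) *
            charNoise k (obsLaw k p f) h s' X ∂(sampleLaw n k p f))
        + ENNReal.ofReal (W ^ 2 * h ^ (2 * α)) * ENNReal.ofReal K := by
  have hprob := isProbabilityMeasure_obsLaw hk hf.1 hp0 hp1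
  have hm := measurable_pEstTrunc (ε := ε) hk h0 hu.measurable hU hg s
  have hn := measurable_charNoise (h := h) (μ := obsLaw k p f) hk s'
  unfold mise
  refine (lintegral_mono fun X => lintegral_fEst_sub_sq_le hk hf h0 hp0 hp1
    ((pEstTrunc_le hε1 s X).trans_lt (by linarith)) hw hW hC hh s' X).trans (le_of_eq ?_)
  have e1 : ∀ X, ENNReal.ofReal (8 * (1 + W) ^ 2 / h *
        ((p - pEstTrunc k φu g ε s X) / (1 - pEstTrunc k φu g ε s X)) ^ 2)
      = ENNReal.ofReal (8 * (1 + W) ^ 2 / h) * ENNReal.ofReal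
        (((p - pEstTrunc k φu g ε s X) / (1 - pEstTrunc k φu g ε s X)) ^ 2) := fun X =>
    ENNReal.ofReal_mul (by positivity)
  have e2 : ∀ X, ENNReal.ofReal ((1 + W) ^ 2 * ((1 - pEstTrunc k φu g ε s X)⁻¹) ^ 2) *
        charNoise k (obsLaw k p f) h s' X
      = ENNReal.ofReal ((1 + W) ^ 2) * (ENNReal.ofReal (((1 - pEstTrunc k φu g ε s X)⁻¹) ^ 2) *
        charNoise k (obsLaw k p f) h s' X) := fun X => by
    rw [ENNReal.ofReal_mul (by positivity), mul_assoc]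
  simp_rw [e1, e2]
  unfold sampleLaw
  rw [lintegral_add_right _ measurable_const, lintegral_add_left (by fun_prop),
    lintegral_const_mul' _ _ ENNReal.ofReal_ne_top, lintegral_const_mul' _ _ ENNReal.ofReal_ne_top,
    lintegral_const, measure_univ, mul_one]

/-- The risk of the estimator computed from two independent parts of the sample. -/
theorem mise_split_le (hk : IsDensity k) (hki : Integrable (phi k)) (hf : f ∈ sobolevClass α K)
    (h0 : ∀ t, phi k t ≠ 0) (hp0 : 0 ≤ p) (hp : p ≤ pstar) (hpstar : pstar < 1) (hε : 0 < ε)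
    (hε1 : ε < 1) (hu : IsAtomKernel α φu) (hU0 : 0 < U) (hUα : ∀ t, |φu t| ≤ U * |t| ^ α)
    (hU : ∀ t, |φu t| ≤ U) (hK : 0 ≤ K) (hg : 0 < g) (hw : IsDensityKernel α φw)
    (hW : ∀ t, |φw t - 1| ≤ W * |t| ^ α) (hC : ∀ t, |φw t| ≤ 1 + W) (hh : 0 < h)
    {J J' : ℝ} (hJ0 : 0 ≤ J) (hJ0' : 0 ≤ J') (hJ : invSqMass k g ≤ ENNReal.ofReal J)
    (hJ' : invSqMass k h ≤ ENNReal.ofReal J') {s s' : Finset (Fin n)} (hs : s.Nonempty)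
    (hs' : s'.Nonempty) (hss : Disjoint s s') :
    mise k (fun X => fEst k φw h s' (pEstTrunc k φu g ε s X) X) p f
      ≤ ENNReal.ofReal (8 * (1 + W) ^ 2 / h
            * atomRisk α K pstar ε U (∫ t, ‖phi k t‖) g J s.card
          + (1 + W) ^ 2 * (2 / (1 - pstar) ^ 2
            * (1 + atomRisk α K pstar ε U (∫ t, ‖phi k t‖) g J s.card) * (J' / s'.card))
          + W ^ 2 * h ^ (2 * α) * K) := by
  have hfd := hf.1
  have hp1 : p ≤ 1 := by linarith
  have hprob := isProbabilityMeasure_obsLaw hk hfd hp0 hp1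
  have hΛ : 0 ≤ ∫ t, ‖phi k t‖ := integral_nonneg fun _ => norm_nonneg _
  have hA0 := atomRisk_nonneg (α := α) (K := K) (pstar := pstar) (ε := ε) (U := U)
    (Λ := ∫ t, ‖phi k t‖) (g := g) (J := J) (m := s.card) hK hg hΛ hJ0
  have hm := measurable_pEstTrunc (ε := ε) hk h0 hu.measurable hU hg s
  have hn := measurable_charNoise (h := h) (μ := obsLaw k p f) hk s'
  have hcard : (0 : ℝ) < s'.card := by exact_mod_cast hs'.card_pos
  have hr := lintegral_ratio_sq_le hk hki hf h0 hp0 hp hpstar hε hε1 hu hU0 hUα hU hK hg hJ0 hJ hs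
  refine (mise_fEst_le hk hf h0 hp0 hp1 hε hε1 hu hU hg hw hW hC hh s s').trans ?_
  rw [ENNReal.ofReal_add (by positivity) (by positivity),
    ENNReal.ofReal_add (by positivity) (by positivity),
    ENNReal.ofReal_mul (p := 8 * (1 + W) ^ 2 / h) (by positivity),
    ENNReal.ofReal_mul (p := (1 + W) ^ 2) (by positivity),
    ENNReal.ofReal_mul (p := W ^ 2 * h ^ (2 * α)) (by positivity)]
  refine add_le_add (add_le_add (mul_le_mul_right hr _) (mul_le_mul_right ?_ _)) le_rfl
  unfold sampleLaw
  -- Here splitting pays: `(1 - q)⁻²` and the noise depend on disjoint parts of the sample, so the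
  -- expectation factorises.
  rw [lintegral_mul_eq_of_disjoint hss (by fun_prop) hn
    (fun X X' hX => by unfold pEstTrunc; rw [pEst_congr hX])
    (fun X X' hX => charNoise_congr hX), ENNReal.ofReal_mul (by positivity)]
  gcongr
  · rw [ENNReal.ofReal_mul (by positivity), ENNReal.ofReal_add (by norm_num) hA0]
    refine (lintegral_mono fun X => ENNReal.ofReal_le_ofReal (inv_sq_le hp hpstar
      ((pEstTrunc_le hε1 s X).trans_lt (by linarith)))).trans ?_
    simp_rw [ENNReal.ofReal_mul (p := 2 / (1 - pstar) ^ 2) (by positivity)]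
    rw [lintegral_const_mul' _ _ ENNReal.ofReal_ne_top]
    gcongr
    simp_rw [ENNReal.ofReal_add zero_le_one (sq_nonneg _)]
    rw [lintegral_add_left measurable_const, lintegral_const, measure_univ, mul_one]
    gcongr
    exact hr
  · refine (lintegral_charNoise_le hk hs').trans ?_
    rw [ENNReal.ofReal_div_of_pos hcard, ENNReal.ofReal_natCast]
    gcongr

/-- The risk of the estimator computed without splitting the sample. -/
theorem mise_unsplit_le (hk : IsDensity k) (hki : Integrable (phi k)) (hf : f ∈ sobolevClass α K)
    (h0 : ∀ t, phi k t ≠ 0) (hp0 : 0 ≤ p) (hp : p ≤ pstar) (hpstar : pstar < 1) (hε : 0 < ε)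
    (hε1 : ε < 1) (hu : IsAtomKernel α φu) (hU0 : 0 < U) (hUα : ∀ t, |φu t| ≤ U * |t| ^ α)
    (hU : ∀ t, |φu t| ≤ U) (hK : 0 ≤ K) (hg : 0 < g) (hw : IsDensityKernel α φw)
    (hW : ∀ t, |φw t - 1| ≤ W * |t| ^ α) (hC : ∀ t, |φw t| ≤ 1 + W) (hh : 0 < h)
    {J J' : ℝ} (hJ0 : 0 ≤ J) (hJ0' : 0 ≤ J') (hJ : invSqMass k g ≤ ENNReal.ofReal J)
    (hJ' : invSqMass k h ≤ ENNReal.ofReal J') {s s' : Finset (Fin n)} (hs : s.Nonempty)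
    (hs' : s'.Nonempty) :
    mise k (fun X => fEst k φw h s' (pEstTrunc k φu g ε s X) X) p f
      ≤ ENNReal.ofReal (8 * (1 + W) ^ 2 / h
            * atomRisk α K pstar ε U (∫ t, ‖phi k t‖) g J s.card
          + (1 + W) ^ 2 * (ε⁻¹ ^ 2 * (J' / s'.card)) + W ^ 2 * h ^ (2 * α) * K) := by
  have hfd := hf.1
  have hp1 : p ≤ 1 := by linarith
  have hprob := isProbabilityMeasure_obsLaw hk hfd hp0 hp1
  have hΛ : 0 ≤ ∫ t, ‖phi k t‖ := integral_nonneg fun _ => norm_nonneg _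
  have hA0 := atomRisk_nonneg (α := α) (K := K) (pstar := pstar) (ε := ε) (U := U)
    (Λ := ∫ t, ‖phi k t‖) (g := g) (J := J) (m := s.card) hK hg hΛ hJ0
  have hcard : (0 : ℝ) < s'.card := by exact_mod_cast hs'.card_pos
  have hr := lintegral_ratio_sq_le hk hki hf h0 hp0 hp hpstar hε hε1 hu hU0 hUα hU hK hg hJ0 hJ hs
  refine (mise_fEst_le hk hf h0 hp0 hp1 hε hε1 hu hU hg hw hW hC hh s s').trans ?_
  rw [ENNReal.ofReal_add (by positivity) (by positivity),
    ENNReal.ofReal_add (by positivity) (by positivity),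
    ENNReal.ofReal_mul (p := 8 * (1 + W) ^ 2 / h) (by positivity),
    ENNReal.ofReal_mul (p := (1 + W) ^ 2) (by positivity),
    ENNReal.ofReal_mul (p := W ^ 2 * h ^ (2 * α)) (by positivity)]
  refine add_le_add (add_le_add (mul_le_mul_right hr _) (mul_le_mul_right ?_ _)) le_rfl
  rw [ENNReal.ofReal_mul (by positivity)]
  -- Without independence the deterministic bound `1 - q ≥ ε` is used instead.
  calc _ ≤ ∫⁻ X, ENNReal.ofReal (ε⁻¹ ^ 2) * charNoise k (obsLaw k p f) h s' X
          ∂(sampleLaw n k p f) := by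
        refine lintegral_mono fun X => ?_
        have := pEstTrunc_le (k := k) (φu := φu) (g := g) hε1 s X
        have h1 : 0 < 1 - pEstTrunc k φu g ε s X := by linarith
        simp only
        gcongr
        linarith
    _ ≤ _ := by
        rw [lintegral_const_mul' _ _ ENNReal.ofReal_ne_top]
        gcongr
        refine (lintegral_charNoise_le hk hs').trans ?_
        rw [ENNReal.ofReal_div_of_pos hcard, ENNReal.ofReal_natCast]
        gcongr

end

end AtomicDeconv

/-! ### From asymptotic risk bounds to rates; the mass of `|φ_Z|⁻²` at low frequencies. -/

namespace AtomicDeconv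

open Asymptotics

/-- The asymptotic comparison is silent on finitely many sample sizes. As the rate is positive from
`n = 2` on, their ratios are absorbed into the constant, and the lower bound then converts the rate
into the minimax risk. -/
theorem isRateOptimal_of_isBigO {k : ℝ → ℝ} {α K pstar : ℝ}
    {fe : (n : ℕ) → (Fin n → ℝ) → ℝ → ℝ} {r A : ℕ → ℝ} (hest : ∀ n ≥ 2, IsEstimator (fe n))
    (hr : ∀ n ≥ 2, 0 < r n) (hA : ∀ n ≥ 2, maxRisk k α K pstar (fe n) ≤ ENNReal.ofReal (A n))
    (hAr : A =O[atTop] r) {c : ℝ} (hc : 0 < c)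
    (hlow : ∀ n : ℕ, 2 ≤ n → ENNReal.ofReal (c * r n) ≤ minimaxRisk n k α K pstar) :
    IsRateOptimal k α K pstar fe r := by
  obtain ⟨C₀, hC₀⟩ := hAr.bound
  obtain ⟨N, hN⟩ := eventually_atTop.1 hC₀
  set C₁ : ℝ := |C₀| + ∑ n ∈ Finset.range N, |A n / r n| + 1 with hC₁
  have hS : 0 ≤ ∑ n ∈ Finset.range N, |A n / r n| := Finset.sum_nonneg fun _ _ => abs_nonneg _
  have hC₁0 : 0 < C₁ := by positivity
  have hup : ∀ n ≥ 2, A n ≤ C₁ * r n := fun n hn => by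
    have hrn := hr n hn
    rcases le_or_gt N n with h | h
    · have h1 := hN n h
      rw [Real.norm_eq_abs, Real.norm_eq_abs, abs_of_pos hrn] at h1
      refine (le_abs_self _).trans (h1.trans ?_)
      gcongr
      have := le_abs_self C₀
      linarith
    · rw [← div_le_iff₀ hrn]
      have h1 := Finset.single_le_sum (f := fun n => |A n / r n|) (fun _ _ => abs_nonneg _)
        (Finset.mem_range.2 h)
      have h2 := le_abs_self (A n / r n)
      have h3 := abs_nonneg C₀
      linarith
  refine ⟨hest, max C₁ (C₁ / c), lt_max_of_lt_left hC₁0, fun n hn => ?_⟩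
  have hrn := hr n hn
  have hle := (hA n hn).trans (ENNReal.ofReal_le_ofReal (hup n hn))
  constructor
  · refine hle.trans (ENNReal.ofReal_le_ofReal ?_)
    gcongr
    exact le_max_left _ _
  · calc _ ≤ ENNReal.ofReal (C₁ * r n) := hle
      _ = ENNReal.ofReal (C₁ / c) * ENNReal.ofReal (c * r n) := by
        rw [← ENNReal.ofReal_mul (by positivity)]
        congr 1
        field_simp
      _ ≤ _ := by
        gcongr
        · exact le_max_right _ _
        · exact hlow n hn

theorem invSqMass_le {k : ℝ → ℝ} {h B : ℝ} (hh : 0 < h)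
    (hB : ∀ t, |t| ≤ h⁻¹ → (‖phi k t‖ ^ 2)⁻¹ ≤ B) :
    invSqMass k h ≤ ENNReal.ofReal (2 / h * B) := by
  have hB0 : 0 ≤ B := le_trans (by positivity) (hB 0 (by rw [abs_zero]; positivity))
  calc invSqMass k h ≤ ∫⁻ _ in Set.Icc (-h⁻¹) h⁻¹, ENNReal.ofReal B := by
        refine setLIntegral_mono' measurableSet_Icc fun t ht => ?_
        exact ENNReal.ofReal_le_ofReal (hB t (abs_le.2 ht))
    _ = _ := by
        rw [lintegral_const, Measure.restrict_apply MeasurableSet.univ, Set.univ_inter,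
          Real.volume_Icc, ← ENNReal.ofReal_mul hB0]
        congr 1
        ring

/-- On a compact interval `φ_Z` is bounded away from zero. The second alternative records `1 ≤ |t|`,
where `F` is positive and powers of `|t|` increase with the exponent. -/
theorem exists_bound_inv_sq_of_eventually {k : ℝ → ℝ} (hk : IsDensity k)
    (h0 : ∀ t, phi k t ≠ 0) {F : ℝ → ℝ} (hF : ∀ t, 1 ≤ |t| → 0 < F t)
    (h : ∀ᶠ t : ℝ in cocompact ℝ, F t ≤ ‖phi k t‖) :
    ∃ M ≥ 0, ∀ t, (‖phi k t‖ ^ 2)⁻¹ ≤ M ∨ (1 ≤ |t| ∧ (‖phi k t‖ ^ 2)⁻¹ ≤ (F t ^ 2)⁻¹) := by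
  obtain ⟨T, hT⟩ : ∃ T, ∀ t, T < ‖t‖ → F t ≤ ‖phi k t‖ := by
    have h2 := (hasBasis_cobounded_norm (E := ℝ)).eventually_iff.1
      (by rwa [Metric.cobounded_eq_cocompact])
    obtain ⟨T, -, hT⟩ := h2
    exact ⟨T, fun t ht => hT (by simpa using ht.le)⟩
  set T' := max T 1
  obtain ⟨C, hC⟩ := exists_bound_inv_phi hk h0 (-T') T'
  have hC0 : 0 ≤ C := (norm_nonneg _).trans (hC 0 (by
    have : (0 : ℝ) ≤ T' := zero_le_one.trans (le_max_right _ _)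
    exact ⟨by linarith, this⟩))
  refine ⟨C ^ 2, by positivity, fun t => ?_⟩
  rcases le_or_gt |t| T' with ht | ht
  · left
    rw [← inv_pow, ← norm_inv]
    exact pow_le_pow_left₀ (norm_nonneg _) (hC t (abs_le.1 ht)) 2
  · right
    have h1 : 1 ≤ |t| := (le_max_right _ _).trans ht.le
    refine ⟨h1, ?_⟩
    have h2 := hT t ((le_max_left _ _).trans_lt ht)
    have h3 := hF t h1
    gcongr

/-- The restriction `g ≤ H` lets the constant coming from bounded frequencies be dominated by a
multiple of `g^(-2β)`. -/
theorem OrdinarySmooth.invSqMass_le {k : ℝ → ℝ} {β : ℝ} (hk : IsDensity k) (hβ : 0 < β)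
    (h : OrdinarySmooth k β) (H : ℝ) (hH : 0 < H) :
    ∃ C > 0, ∀ g, 0 < g → g ≤ H → invSqMass k g ≤ ENNReal.ofReal (C * g ^ (-(2 * β + 1))) := by
  obtain ⟨h0, -, d₀, hd₀, hd⟩ := h
  obtain ⟨M, hM0, hM⟩ := exists_bound_inv_sq_of_eventually hk h0
    (fun t ht => by positivity) hd
  refine ⟨2 * (M * H ^ (2 * β) + (d₀ ^ 2)⁻¹), by positivity, fun g hg hgH => ?_⟩
  refine (AtomicDeconv.invSqMass_le (B := (M * H ^ (2 * β) + (d₀ ^ 2)⁻¹) * g ^ (-(2 * β))) hg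
    fun t ht => ?_).trans (ENNReal.ofReal_le_ofReal (le_of_eq ?_))
  · have hgp : 0 < g ^ (-(2 * β)) := by positivity
    rcases hM t with h1 | ⟨h1, h2⟩
    · have h2 : 1 ≤ H ^ (2 * β) * g ^ (-(2 * β)) := by
        rw [Real.rpow_neg hg.le, ← div_eq_mul_inv, one_le_div (by positivity)]
        gcongr
      have h3 : 0 ≤ (d₀ ^ 2)⁻¹ * g ^ (-(2 * β)) := by positivity
      nlinarith
    · refine h2.trans ?_
      have h3 : ((d₀ * |t| ^ (-β)) ^ 2)⁻¹ = (d₀ ^ 2)⁻¹ * |t| ^ (2 * β) := by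
        rw [mul_pow, mul_inv, ← Real.rpow_mul_natCast (abs_nonneg _), ← Real.rpow_neg (abs_nonneg _)]
        congr 2
        push_cast
        ring
      have h4 : |t| ^ (2 * β) ≤ g ^ (-(2 * β)) := by
        rw [Real.rpow_neg hg.le, ← Real.inv_rpow hg.le]
        gcongr
      have h5 : 0 ≤ M * H ^ (2 * β) * g ^ (-(2 * β)) := by positivity
      rw [h3]
      calc (d₀ ^ 2)⁻¹ * |t| ^ (2 * β) ≤ (d₀ ^ 2)⁻¹ * g ^ (-(2 * β)) := by gcongr
        _ ≤ _ := by linarith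
  · rw [neg_add, Real.rpow_add hg, Real.rpow_neg_one]
    ring

/-- The sign of `β₀` is unknown, so `|t|^(-2β₀)` is bounded with `|β₀|`; this loses a power of `g`,
which is harmless against the exponential. The summand `1` accounts for bounded frequencies. -/
theorem SuperSmooth.invSqMass_le {k : ℝ → ℝ} {β γ : ℝ} (hk : IsDensity k) (hβ : 0 < β)
    (hγ : 0 < γ) (h : SuperSmooth k β γ) :
    ∃ C > 0, ∃ b : ℝ, ∀ g : ℝ, 0 < g → invSqMass k g
      ≤ ENNReal.ofReal (2 / g * (C * (1 + g ^ (-b) * Real.exp (2 * (g⁻¹ ^ β / γ))))) := by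
  obtain ⟨h0, -, d₀, hd₀, β₀, hd⟩ := h
  obtain ⟨M, hM0, hM⟩ := exists_bound_inv_sq_of_eventually hk h0
    (fun t ht => by positivity) hd
  refine ⟨M + (d₀ ^ 2)⁻¹, by positivity, 2 * |β₀|, fun g hg =>
    AtomicDeconv.invSqMass_le hg fun t ht => ?_⟩
  have hE : 0 ≤ g ^ (-(2 * |β₀|)) * Real.exp (2 * (g⁻¹ ^ β / γ)) := by positivity
  have hd2 : 0 ≤ (d₀ ^ 2)⁻¹ := by positivity
  rcases hM t with h1 | ⟨h1, h2⟩
  · nlinarith [mul_nonneg hM0 hE, mul_nonneg hd2 hE]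
  · refine h2.trans ?_
    have ht0 : 0 < |t| := by linarith
    have h3 : ((d₀ * |t| ^ β₀ * Real.exp (-(|t| ^ β / γ))) ^ 2)⁻¹
        = (d₀ ^ 2)⁻¹ * (|t| ^ (-(2 * β₀)) * Real.exp (2 * (|t| ^ β / γ))) := by
      rw [mul_pow, mul_pow, mul_inv, mul_inv, ← Real.rpow_mul_natCast (abs_nonneg _),
        ← Real.rpow_neg (abs_nonneg _), ← Real.exp_nat_mul, ← Real.exp_neg, mul_assoc]
      congr 3 <;> push_cast <;> ring_nf
    have h4 : |t| ^ (-(2 * β₀)) ≤ g ^ (-(2 * |β₀|)) := by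
      calc |t| ^ (-(2 * β₀)) ≤ |t| ^ (2 * |β₀|) := by
            refine Real.rpow_le_rpow_of_exponent_le h1 ?_
            have := neg_abs_le β₀
            linarith
        _ ≤ g⁻¹ ^ (2 * |β₀|) := by gcongr
        _ = _ := by rw [Real.rpow_neg hg.le, ← Real.inv_rpow hg.le]
    rw [h3]
    calc (d₀ ^ 2)⁻¹ * (|t| ^ (-(2 * β₀)) * Real.exp (2 * (|t| ^ β / γ)))
        ≤ (d₀ ^ 2)⁻¹ * (g ^ (-(2 * |β₀|)) * Real.exp (2 * (g⁻¹ ^ β / γ))) := by gcongr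
      _ ≤ _ := by nlinarith [mul_nonneg hM0 hE]

theorem truncLevel_pos {n : ℕ} (hn : 2 ≤ n) : 0 < truncLevel n := by
  have : (2 : ℝ) ≤ n := by exact_mod_cast hn
  exact inv_pos.2 (Real.log_pos (by linarith))

theorem truncLevel_lt_one {n : ℕ} (hn : 2 ≤ n) : truncLevel n < 1 := by
  have : (2 : ℝ) ≤ n := by exact_mod_cast hn
  refine inv_lt_one_of_one_lt₀ ((Real.lt_log_iff_exp_lt (by linarith)).2 ?_)
  have := Real.exp_one_lt_d9
  linarith

theorem tendsto_truncLevel : Tendsto truncLevel atTop (𝓝 0) := by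
  refine Tendsto.inv_tendsto_atTop (Real.tendsto_log_atTop.comp ?_)
  exact tendsto_natCast_atTop_atTop.const_mul_atTop (by norm_num)

theorem inv_truncLevel (n : ℕ) : (truncLevel n)⁻¹ = Real.log (3 * n) := by
  rw [truncLevel, inv_inv]

theorem truncRemainder_eventuallyEq {D : ℝ} (hD : 0 < D) {B : ℕ → ℝ}
    (hB : Tendsto B atTop (𝓝 0)) :
    (fun n => truncRemainder (truncLevel n) D (B n)) =ᶠ[atTop] fun _ => 0 := by
  filter_upwards [tendsto_truncLevel.eventually_le_const hD,
    hB.eventually_le_const (show (0 : ℝ) < (D / 2) ^ 2 by positivity)] with n h1 h2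
  rw [truncRemainder, if_pos ⟨h1, h2⟩]

end AtomicDeconv

/-! ### The rate of the risk bound in the ordinary smooth case. -/

namespace AtomicDeconv

open Asymptotics

/-- The fraction `1/3` is attained by `n / 2` at `n = 3`, because of the integer division. -/
theorem half_bounds {n : ℕ} (hn : 2 ≤ n) :
    (n : ℝ) / 3 ≤ ((n / 2 : ℕ) : ℝ) ∧ ((n / 2 : ℕ) : ℝ) ≤ n ∧
    (n : ℝ) / 3 ≤ ((n - n / 2 : ℕ) : ℝ) ∧ ((n - n / 2 : ℕ) : ℝ) ≤ n := by
  have h1 : n ≤ 3 * (n / 2) := by omega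
  have h2 : n ≤ 3 * (n - n / 2) := by omega
  have h3 : n / 2 ≤ n := by omega
  have h4 : n - n / 2 ≤ n := by omega
  have h1' : (n : ℝ) ≤ 3 * ((n / 2 : ℕ) : ℝ) := by exact_mod_cast h1
  have h2' : (n : ℝ) ≤ 3 * ((n - n / 2 : ℕ) : ℝ) := by exact_mod_cast h2
  have h3' : ((n / 2 : ℕ) : ℝ) ≤ n := by exact_mod_cast h3
  have h4' : ((n - n / 2 : ℕ) : ℝ) ≤ n := by exact_mod_cast h4
  exact ⟨by linarith, h3', by linarith, h4'⟩

theorem isBigO_rpow_of_bounds {m : ℕ → ℝ}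
    (hm : ∀ n : ℕ, 2 ≤ n → (n : ℝ) / 3 ≤ m n ∧ m n ≤ n) (e : ℝ) :
    (fun n => m n ^ e) =O[atTop] fun n : ℕ => (n : ℝ) ^ e := by
  refine IsBigO.of_bound (max 1 (3 ^ (-e))) ?_
  filter_upwards [eventually_ge_atTop 2] with n hn
  obtain ⟨h1, h2⟩ := hm n hn
  have hn0 : (0 : ℝ) < n := by
    have : 0 < n := by omega
    exact_mod_cast this
  have hm0 : 0 < m n := by linarith
  rw [Real.norm_of_nonneg (by positivity), Real.norm_of_nonneg (by positivity)]
  rcases le_or_gt 0 e with he | he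
  · calc m n ^ e ≤ (n : ℝ) ^ e := by gcongr
      _ = 1 * (n : ℝ) ^ e := (one_mul _).symm
      _ ≤ _ := by gcongr; exact le_max_left _ _
  · calc m n ^ e ≤ ((n : ℝ) / 3) ^ e := Real.rpow_le_rpow_of_nonpos (by positivity) h1 he.le
      _ = 3 ^ (-e) * (n : ℝ) ^ e := by
        rw [Real.div_rpow hn0.le (by norm_num), Real.rpow_neg (by norm_num)]
        field_simp
      _ ≤ _ := by gcongr; exact le_max_right _ _

theorem isBigO_log_three_mul_sq {η : ℝ} (hη : 0 < η) :
    (fun n : ℕ => Real.log (3 * n) ^ 2) =O[atTop] fun n : ℕ => (n : ℝ) ^ η := by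
  have h1 : (fun x : ℝ => Real.log x) =O[atTop] fun x => x ^ (η / 2) :=
    (isLittleO_log_rpow_atTop (by positivity)).isBigO
  have h2 : Tendsto (fun n : ℕ => (3 : ℝ) * n) atTop atTop :=
    tendsto_natCast_atTop_atTop.const_mul_atTop (by norm_num)
  have h3 := (h1.comp_tendsto h2).pow 2
  refine h3.trans ?_
  refine IsBigO.of_bound (3 ^ η) (Eventually.of_forall fun n => ?_)
  have hn : (0 : ℝ) ≤ n := n.cast_nonneg
  simp only [Function.comp]
  rw [← Real.rpow_mul_natCast (by positivity), Real.norm_of_nonneg (by positivity),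
    Real.norm_of_nonneg (by positivity), Real.mul_rpow (by norm_num) hn]
  push_cast
  rw [div_mul_cancel₀ _ (by norm_num)]

theorem isBigO_rpow_rpow {a b : ℝ} (hab : a ≤ b) :
    (fun n : ℕ => (n : ℝ) ^ a) =O[atTop] fun n : ℕ => (n : ℝ) ^ b := by
  refine IsBigO.of_bound 1 ?_
  filter_upwards [eventually_ge_atTop 1] with n hn
  have : (1 : ℝ) ≤ n := by exact_mod_cast hn
  rw [Real.norm_of_nonneg (by positivity), Real.norm_of_nonneg (by positivity), one_mul]
  exact Real.rpow_le_rpow_of_exponent_le this hab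

theorem isBigO_rpow_mul {u v : ℕ → ℝ} {a b e : ℝ} (hu : u =O[atTop] fun n : ℕ => (n : ℝ) ^ a)
    (hv : v =O[atTop] fun n : ℕ => (n : ℝ) ^ b) (h : a + b ≤ e) :
    (fun n => u n * v n) =O[atTop] fun n : ℕ => (n : ℝ) ^ e := by
  refine (hu.mul hv).trans (IsBigO.trans ?_ (isBigO_rpow_rpow h))
  refine EventuallyEq.isBigO ?_
  filter_upwards [eventually_ge_atTop 1] with n hn
  have : (0 : ℝ) < n := by exact_mod_cast hn
  rw [Real.rpow_add this]

theorem tendsto_zero_of_isBigO_rpow {u : ℕ → ℝ} {a : ℝ} (ha : a < 0)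
    (hu : u =O[atTop] fun n : ℕ => (n : ℝ) ^ a) : Tendsto u atTop (𝓝 0) := by
  refine hu.trans_tendsto ?_
  have := (tendsto_rpow_neg_atTop (y := -a) (by linarith)).comp
    (tendsto_natCast_atTop_atTop (R := ℝ))
  simpa [Function.comp_def] using this

theorem isBigO_bandwidth_rpow {m : ℕ → ℝ}
    (hm : ∀ n : ℕ, 2 ≤ n → (n : ℝ) / 3 ≤ m n ∧ m n ≤ n) {d : ℝ} (hd : 0 < d) (r e : ℝ) :
    (fun n => (d * m n ^ (-r)) ^ e) =O[atTop] fun n : ℕ => (n : ℝ) ^ (-(r * e)) := by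
  refine IsBigO.trans (g := fun n => d ^ e * m n ^ (-(r * e))) ?_
    ((isBigO_rpow_of_bounds hm _).const_mul_left _)
  refine EventuallyEq.isBigO ?_
  filter_upwards [eventually_ge_atTop 2] with n hn
  have hm0 : 0 ≤ m n := le_trans (by positivity) (hm n hn).1
  rw [Real.mul_rpow hd.le (by positivity), ← Real.rpow_mul hm0]
  congr 2
  ring

/-- The rate of the risk bound in the ordinary smooth case. -/
theorem ordinary_bound_isBigO {α β d K D U W Λ C C' : ℝ} (hα : 0 < α) (hβ : 0 < β)
    (hd : 0 < d) (hD : 0 < D) {m m' : ℕ → ℕ}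
    (hm : ∀ n : ℕ, 2 ≤ n → (n : ℝ) / 3 ≤ m n ∧ (m n : ℝ) ≤ n)
    (hm' : ∀ n : ℕ, 2 ≤ n → (n : ℝ) / 3 ≤ m' n ∧ (m' n : ℝ) ≤ n) {g h : ℕ → ℝ}
    (hg : ∀ n, g n = d * (m n : ℝ) ^ (-(1 / (2 * α + 2 * β))))
    (hh : ∀ n, h n = d * (m' n : ℝ) ^ (-(1 / (2 * α + 2 * β + 1)))) :
    (fun n => 8 * (1 + W) ^ 2 / h n
        * atomRisk α K (1 - D) (truncLevel n) U Λ (g n) (C * g n ^ (-(2 * β + 1))) (m n)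
      + (1 + W) ^ 2 * (2 / D ^ 2
        * (1 + atomRisk α K (1 - D) (truncLevel n) U Λ (g n) (C * g n ^ (-(2 * β + 1))) (m n))
        * (C' * h n ^ (-(2 * β + 1)) / m' n))
      + W ^ 2 * h n ^ (2 * α) * K)
      =O[atTop] fun n : ℕ => (n : ℝ) ^ (-(2 * α) / (2 * α + 2 * β + 1)) := by
  set r := 1 / (2 * α + 2 * β) with hr
  set r' := 1 / (2 * α + 2 * β + 1) with hr'
  have hrp : 0 < r := by positivity
  have hrp' : 0 < r' := by positivity
  have hrr : r' < r := by
    rw [hr, hr']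
    exact one_div_lt_one_div_of_lt (by positivity) (by linarith)
  have er : r * (2 * α + 2 * β) = 1 := by rw [hr]; field_simp
  have er' : r' * (2 * α + 2 * β + 1) = 1 := by rw [hr']; field_simp
  have hrate : -(2 * α) / (2 * α + 2 * β + 1) = -(2 * α * r') := by rw [hr']; field_simp
  have hgO : ∀ e, (fun n => g n ^ e) =O[atTop] fun n : ℕ => (n : ℝ) ^ (-(r * e)) := fun e => by
    simp_rw [hg]; exact isBigO_bandwidth_rpow hm hd r e
  have hhO : ∀ e, (fun n => h n ^ e) =O[atTop] fun n : ℕ => (n : ℝ) ^ (-(r' * e)) := fun e => by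
    simp_rw [hh]; exact isBigO_bandwidth_rpow hm' hd r' e
  have hmO : (fun n => (m n : ℝ)⁻¹) =O[atTop] fun n : ℕ => (n : ℝ) ^ (-1 : ℝ) := by
    simpa [Real.rpow_neg_one] using isBigO_rpow_of_bounds hm (-1)
  have hmO' : (fun n => (m' n : ℝ)⁻¹) =O[atTop] fun n : ℕ => (n : ℝ) ^ (-1 : ℝ) := by
    simpa [Real.rpow_neg_one] using isBigO_rpow_of_bounds hm' (-1)
  -- This is the margin with which `p` is estimated: `r' - r (2α + 1) = -2α r' - η`. It pays for the
  -- squared logarithm of the truncation.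
  set η := (2 * α + 1) * (r - r') with hη
  have hη0 : 0 < η := by
    have : 0 < r - r' := by linarith
    positivity
  set Br : ℕ → ℝ := fun n => U ^ 2 * K / 2 * g n ^ (2 * α + 1) with hB
  have hBO : Br =O[atTop] fun n : ℕ => (n : ℝ) ^ (-(r * (2 * α + 1))) :=
    (hgO _).const_mul_left _
  have hB0 : Tendsto Br atTop (𝓝 0) := by
    refine tendsto_zero_of_isBigO_rpow ?_ hBO
    have : 0 < r * (2 * α + 1) := by positivity
    linarith
  have hη' : -(r * (2 * α + 1)) ≤ η - r * (2 * α + 1) := by linarith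
  have hgpos : ∀ᶠ n in atTop, 0 < g n := by
    filter_upwards [eventually_ge_atTop 2] with n hn
    have h1 := (hm n hn).1
    have h2 : (2 : ℝ) ≤ n := by exact_mod_cast hn
    have h3 : (0 : ℝ) < m n := by linarith
    rw [hg]; positivity
  have hRO : (fun n => atomRisk α K (1 - D) (truncLevel n) U Λ (g n)
      (C * g n ^ (-(2 * β + 1))) (m n)) =O[atTop]
      fun n : ℕ => (n : ℝ) ^ (η - r * (2 * α + 1)) := by
    unfold atomRisk
    rw [sub_sub_cancel]
    refine IsBigO.add (IsBigO.add ?_ ?_) ?_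
    · refine ((hBO.trans (isBigO_rpow_rpow hη')).const_mul_left (8 / D ^ 2)).congr_left fun n => ?_
      rw [hB]
      ring
    · exact (truncRemainder_eventuallyEq hD hB0).isBigO.trans (isBigO_zero _ _)
    -- The bandwidth `g` balances the variance `g^(1 - 2β) / m` against the squared bias `g^(2α +
    -- 1)`.
    · have h1 : (fun n => g n ^ (2 - (2 * β + 1)) * (m n : ℝ)⁻¹) =O[atTop]
          fun n : ℕ => (n : ℝ) ^ (-(r * (2 * α + 1))) := by
        refine isBigO_rpow_mul (hgO _) hmO (le_of_eq ?_)
        linarith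
      have h2 := isBigO_rpow_mul (isBigO_log_three_mul_sq hη0) h1
        (e := η - r * (2 * α + 1)) (by linarith)
      refine IsBigO.trans (EventuallyEq.isBigO ?_)
        (h2.const_mul_left (8 * (U ^ 2 * C * Λ / 4)))
      filter_upwards [hgpos] with n hn
      rw [inv_truncLevel, sub_eq_add_neg, Real.rpow_add hn, Real.rpow_two]
      ring
  have hR1 : (fun n => 1 + atomRisk α K (1 - D) (truncLevel n) U Λ (g n)
      (C * g n ^ (-(2 * β + 1))) (m n)) =O[atTop] fun n : ℕ => (n : ℝ) ^ (0 : ℝ) := by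
    refine IsBigO.add ?_ (hRO.trans (isBigO_rpow_rpow ?_))
    · simpa using isBigO_refl (fun _ : ℕ => (1 : ℝ)) atTop
    · have : 0 < r' * (2 * α + 1) := by positivity
      linarith
  have hJO : (fun n => h n ^ (-(2 * β + 1)) * (m' n : ℝ)⁻¹) =O[atTop]
      fun n : ℕ => (n : ℝ) ^ (-(2 * α * r')) := by
    refine isBigO_rpow_mul (hhO _) hmO' (le_of_eq ?_)
    linarith
  have hinv : (fun n => (h n)⁻¹) =O[atTop] fun n : ℕ => (n : ℝ) ^ r' := by
    simpa [Real.rpow_neg_one] using hhO (-1)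
  rw [hrate]
  refine IsBigO.add (IsBigO.add ?_ ?_) ?_
  · have := isBigO_rpow_mul hinv hRO (e := -(2 * α * r')) (le_of_eq (by linarith))
    refine (this.const_mul_left (8 * (1 + W) ^ 2)).congr_left fun n => ?_
    ring
  · have := isBigO_rpow_mul hR1 hJO (e := -(2 * α * r')) (by linarith)
    refine (this.const_mul_left ((1 + W) ^ 2 * (2 / D ^ 2) * C')).congr_left fun n => ?_
    ring
  · refine (((hhO (2 * α)).trans (isBigO_rpow_rpow (le_of_eq ?_))).const_mul_left
      (W ^ 2 * K)).congr_left fun n => ?_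
    · ring
    · ring

end AtomicDeconv

/-! ### Rate-optimality in both cases, with the supersmooth rate. -/

namespace AtomicDeconv

open Asymptotics

theorem isRateOptimal_ordinaryEstimator {k φu φw : ℝ → ℝ} {α K pstar β d : ℝ} (hα : 0 < α)
    (hK : 0 ≤ K) (hpstar : pstar < 1) (hk : IsDensity k) (hβ : 0 < β) (hd : 0 < d)
    (hos : OrdinarySmooth k β) (hu : IsAtomKernel α φu) (hw : IsDensityKernel α φw) {c : ℝ}
    (hc : 0 < c)
    (hlow : ∀ n : ℕ, 2 ≤ n →
      ENNReal.ofReal (c * (n : ℝ) ^ (-(2 * α) / (2 * α + 2 * β + 1))) ≤ minimaxRisk n k α K pstar) :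
    IsRateOptimal k α K pstar (ordinaryEstimator k φu φw α β d)
      (fun n => (n : ℝ) ^ (-(2 * α) / (2 * α + 2 * β + 1))) := by
  obtain ⟨U, hU0, hUα, hU⟩ := hu.exists_bound hα.le
  obtain ⟨W, hW0, hW, hC⟩ := hw.exists_bound hα.le
  obtain ⟨C, hC0, hJ⟩ := hos.invSqMass_le hk hβ d hd
  have h0 := hos.1
  have hki := hos.2.1
  set g : ℕ → ℝ := fun n => d * ((n / 2 : ℕ) : ℝ) ^ (-(1 / (2 * α + 2 * β))) with hg
  set h : ℕ → ℝ := fun n => d * ((n - n / 2 : ℕ) : ℝ) ^ (-(1 / (2 * α + 2 * β + 1))) with hh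
  have hbig := ordinary_bound_isBigO (K := K) (U := U) (W := W) (Λ := ∫ t, ‖phi k t‖) (C := C)
    (C' := C) hα hβ hd (D := 1 - pstar) (by linarith)
    (m := fun n => n / 2) (m' := fun n => n - n / 2) (g := g) (h := h)
    (fun n hn => ⟨(half_bounds hn).1, (half_bounds hn).2.1⟩)
    (fun n hn => (half_bounds hn).2.2) (fun n => rfl) (fun n => rfl)
  have hpow : ∀ (m : ℕ) (e : ℝ), 1 ≤ m → 0 < e →
      0 < d * (m : ℝ) ^ (-e) ∧ d * (m : ℝ) ^ (-e) ≤ d := fun m e hm he => by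
    have hm1 : (1 : ℝ) ≤ m := by exact_mod_cast hm
    refine ⟨by positivity, mul_le_of_le_one_right hd.le ?_⟩
    exact Real.rpow_le_one_of_one_le_of_nonpos hm1 (by linarith)
  refine isRateOptimal_of_isBigO (fun n hn => ?_) (fun n hn => ?_) (fun n hn => ?_) hbig hc hlow
  · have hgn := (hpow (n / 2) (1 / (2 * α + 2 * β)) (by omega) (by positivity)).1
    exact isEstimator_fEst hk hw.measurable _ (measurable_pEstTrunc hk h0 hu.measurable hU hgn _)
  · have : (0 : ℝ) < n := by
      have : 0 < n := by omega
      exact_mod_cast this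
    positivity
  · obtain ⟨hgn, hgd⟩ := hpow (n / 2) (1 / (2 * α + 2 * β)) (by omega) (by positivity)
    obtain ⟨hhn, hhd⟩ := hpow (n - n / 2) (1 / (2 * α + 2 * β + 1)) (by omega) (by positivity)
    simp only [maxRisk, iSup_le_iff]
    intro f hf p hp
    have hcard : (Finset.univ.filter fun j : Fin n => (j : ℕ) < n / 2).card = n / 2 := by
      rw [Fin.card_filter_val_lt]
      omega
    have hcard' : (Finset.univ.filter fun j : Fin n => n / 2 ≤ (j : ℕ)).card = n - n / 2 := by
      have := Finset.card_filter_add_card_filter_not (s := (Finset.univ : Finset (Fin n)))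
        (fun j : Fin n => (j : ℕ) < n / 2)
      simp only [not_lt, Finset.card_univ, Fintype.card_fin, hcard] at this
      omega
    have key := mise_split_le (n := n) (s := Finset.univ.filter fun j : Fin n => (j : ℕ) < n / 2)
      (s' := Finset.univ.filter fun j : Fin n => n / 2 ≤ (j : ℕ)) hk hki hf h0 hp.1 hp.2 hpstar
      (truncLevel_pos hn) (truncLevel_lt_one hn) hu hU0 hUα hU hK hgn hw hW hC hhn
      (J := C * g n ^ (-(2 * β + 1))) (J' := C * h n ^ (-(2 * β + 1)))
      (by positivity) (by positivity) (hJ _ hgn hgd) (hJ _ hhn hhd)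
      (Finset.card_pos.1 (by rw [hcard]; omega)) (Finset.card_pos.1 (by rw [hcard']; omega))
      (by
        rw [Finset.disjoint_left]
        intro j hj hj'
        simp only [Finset.mem_filter, Finset.mem_univ, true_and] at hj hj'
        omega)
    rw [hcard, hcard'] at key
    simp only [sub_sub_cancel]
    exact key

/-- Both exponents are arbitrary: a factor `n^(-1/2)` beats every power of the logarithm, which
makes all supersmooth variance terms negligible. -/
theorem isBigO_log_rpow_mul_inv_sqrt (s t : ℝ) :
    (fun n : ℕ => Real.log n ^ s * (n : ℝ) ^ (-(1 / 2) : ℝ)) =O[atTop]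
      fun n : ℕ => Real.log n ^ t := by
  have h1 : (fun x : ℝ => Real.log x ^ (s - t)) =O[atTop] fun x => x ^ (1 / 2 : ℝ) :=
    (isLittleO_log_rpow_rpow_atTop _ (by norm_num)).isBigO
  have h2 := h1.comp_tendsto (tendsto_natCast_atTop_atTop (R := ℝ))
  have h3 := (h2.mul (isBigO_refl (fun n : ℕ => Real.log n ^ t) atTop)).mul
    (isBigO_refl (fun n : ℕ => (n : ℝ) ^ (-(1 / 2) : ℝ)) atTop)
  refine IsBigO.trans (EventuallyEq.isBigO ?_) (h3.trans (EventuallyEq.isBigO ?_))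
  · filter_upwards [eventually_ge_atTop 2] with n hn
    have h5 : (1 : ℝ) < n := by exact_mod_cast hn
    have h4 : 0 < Real.log n := Real.log_pos h5
    simp only [Function.comp]
    rw [← Real.rpow_add h4, sub_add_cancel]
  · filter_upwards [eventually_ge_atTop 2] with n hn
    have h5 : (0 : ℝ) < n := by
      have : 0 < n := by omega
      exact_mod_cast this
    simp only [Function.comp]
    rw [mul_right_comm, ← Real.rpow_add h5]
    simp

theorem isBigO_log_three_mul :
    (fun n : ℕ => Real.log (3 * n) ^ 2) =O[atTop] fun n : ℕ => Real.log n ^ (2 : ℝ) := by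
  refine IsBigO.of_bound 9 ?_
  filter_upwards [eventually_ge_atTop 3] with n hn
  have h5 : (3 : ℝ) ≤ n := by exact_mod_cast hn
  have h4 : 0 < Real.log n := Real.log_pos (by linarith)
  have h6 : Real.log 3 ≤ Real.log n := Real.log_le_log (by norm_num) h5
  have h7 : 0 < Real.log 3 := Real.log_pos (by norm_num)
  rw [Real.rpow_two, Real.norm_of_nonneg (by positivity), Real.norm_of_nonneg (by positivity),
    Real.log_mul (by norm_num) (by linarith)]
  nlinarith

/-- The rate of the risk bound in the supersmooth case. -/
theorem super_bound_isBigO {α β c K D U W Λ C b : ℝ} (hα : 0 < α) (hβ : 0 < β)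
    (hc : 0 < c) (hD : 0 < D) {h J : ℕ → ℝ}
    (hh : ∀ n, h n = c * Real.log n ^ (-(1 / β)))
    (hJ : ∀ n ≥ 2, J n = 2 / h n * (C * (1 + h n ^ (-b) * (n : ℝ) ^ (1 / 2 : ℝ)))) :
    (fun n : ℕ => 8 * (1 + W) ^ 2 / h n
        * atomRisk α K (1 - D) (truncLevel n) U Λ (h n) (J n) n
      + (1 + W) ^ 2 * ((truncLevel n)⁻¹ ^ 2 * (J n / n)) + W ^ 2 * h n ^ (2 * α) * K)
      =O[atTop] fun n : ℕ => Real.log n ^ (-(2 * α) / β) := by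
  have hlog : ∀ᶠ n : ℕ in atTop, 2 ≤ n ∧ (1 : ℝ) < n ∧ 0 < Real.log n ∧ 0 < h n := by
    filter_upwards [eventually_ge_atTop 2] with n hn
    have h5 : (1 : ℝ) < n := by exact_mod_cast hn
    have h4 : 0 < Real.log n := Real.log_pos h5
    exact ⟨hn, h5, h4, by rw [hh]; positivity⟩
  have hhO : ∀ e, (fun n => h n ^ e) =O[atTop] fun n : ℕ => Real.log n ^ (-(e / β)) := fun e => by
    refine IsBigO.trans (EventuallyEq.isBigO ?_)
      ((isBigO_refl (fun n : ℕ => Real.log n ^ (-(e / β))) atTop).const_mul_left (c ^ e))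
    filter_upwards [hlog] with n hn
    rw [hh, Real.mul_rpow hc.le (Real.rpow_nonneg hn.2.2.1.le _), ← Real.rpow_mul hn.2.2.1.le]
    congr 2
    ring
  have hsmall : ∀ e t : ℝ, (fun n : ℕ => Real.log (3 * n) ^ 2 * (h n ^ e * (n : ℝ) ^ (-(1 / 2) : ℝ)))
      =O[atTop] fun n : ℕ => Real.log n ^ t := fun e t => by
    refine (isBigO_log_three_mul.mul ((hhO e).mul (isBigO_refl _ _))).trans
      (IsBigO.trans (EventuallyEq.isBigO ?_) (isBigO_log_rpow_mul_inv_sqrt (2 + -(e / β)) t))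
    filter_upwards [hlog] with n hn
    rw [Real.rpow_add hn.2.2.1]
    ring
  -- By the hypothesis on `J`, `J n / n` is `n^(-1/2)` up to powers of `log n`; neither powers of
  -- the bandwidth nor the truncation logarithms change this.
  have hJsmall : ∀ e t : ℝ, (fun n : ℕ => Real.log (3 * n) ^ 2 * (h n ^ e * (J n / n)))
      =O[atTop] fun n : ℕ => Real.log n ^ t := fun e t => by
    have h1 := ((hsmall (e - 1) t).const_mul_left (2 * |C|)).add
      ((hsmall (e - 1 - b) t).const_mul_left (2 * |C|))
    refine IsBigO.trans (IsBigO.of_bound 1 ?_) h1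
    filter_upwards [hlog] with n ⟨hn, hn1, hl, hhn⟩
    have hn0 : (0 : ℝ) < n := by linarith
    have e1 : h n ^ e * (J n / n) = 2 * C * (h n ^ (e - 1) * (n : ℝ) ^ (-1 : ℝ)
        + h n ^ (e - 1 - b) * (n : ℝ) ^ (-(1 / 2) : ℝ)) := by
      rw [hJ n hn, Real.rpow_sub hhn, Real.rpow_one, Real.rpow_sub hhn, Real.rpow_sub hhn,
        Real.rpow_one, Real.rpow_neg_one, Real.rpow_neg hhn.le,
        show (-(1 / 2) : ℝ) = 1 / 2 - 1 by norm_num, Real.rpow_sub hn0, Real.rpow_one]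
      field_simp
    have e2 : (n : ℝ) ^ (-1 : ℝ) ≤ (n : ℝ) ^ (-(1 / 2) : ℝ) :=
      Real.rpow_le_rpow_of_exponent_le hn1.le (by norm_num)
    have hS : 0 ≤ h n ^ (e - 1) * (n : ℝ) ^ (-1 : ℝ)
        + h n ^ (e - 1 - b) * (n : ℝ) ^ (-(1 / 2) : ℝ) := by positivity
    rw [e1, one_mul, Real.norm_eq_abs, abs_mul, abs_mul, abs_mul, abs_of_nonneg (sq_nonneg _),
      abs_of_nonneg hS, abs_two]
    refine le_trans ?_ (le_abs_self _)
    calc Real.log (3 * n) ^ 2 * (2 * |C| * (h n ^ (e - 1) * (n : ℝ) ^ (-1 : ℝ)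
          + h n ^ (e - 1 - b) * (n : ℝ) ^ (-(1 / 2) : ℝ)))
        ≤ Real.log (3 * n) ^ 2 * (2 * |C| * (h n ^ (e - 1) * (n : ℝ) ^ (-(1 / 2) : ℝ)
          + h n ^ (e - 1 - b) * (n : ℝ) ^ (-(1 / 2) : ℝ))) := by gcongr
      _ = _ := by ring
  have hrate : -(2 * α) / β = -(2 * α / β) := neg_div _ _
  set Br : ℕ → ℝ := fun n => U ^ 2 * K / 2 * h n ^ (2 * α + 1) with hB
  have hB0 : Tendsto Br atTop (𝓝 0) := by
    refine ((hhO (2 * α + 1)).const_mul_left _).trans_tendsto ?_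
    exact (tendsto_rpow_neg_atTop (by positivity)).comp
      (Real.tendsto_log_atTop.comp tendsto_natCast_atTop_atTop)
  have hRem := truncRemainder_eventuallyEq hD hB0
  rw [hrate]
  refine IsBigO.add (IsBigO.add ?_ ?_) ?_
  · have h1 : (fun n => h n ^ (2 * α)) =O[atTop] fun n : ℕ => Real.log n ^ (-(2 * α / β)) :=
      hhO _
    have h2 := hJsmall 1 (-(2 * α / β))
    refine IsBigO.trans (EventuallyEq.isBigO ?_)
      ((h1.const_mul_left (8 * (1 + W) ^ 2 * (8 / D ^ 2 * (U ^ 2 * K / 2)))).add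
        (h2.const_mul_left (8 * (1 + W) ^ 2 * (8 * (U ^ 2 * Λ / 4)))))
    filter_upwards [hlog, hRem] with n ⟨hn, hn1, hl, hhn⟩ hr
    rw [hB] at hr
    rw [atomRisk, sub_sub_cancel, hr, inv_truncLevel, Real.rpow_add hhn, Real.rpow_one]
    field_simp
    ring
  · have h2 := hJsmall 0 (-(2 * α / β))
    refine (h2.const_mul_left ((1 + W) ^ 2)).congr_left fun n => ?_
    rw [inv_truncLevel, Real.rpow_zero, one_mul]
  · refine ((hhO (2 * α)).const_mul_left (W ^ 2 * K)).congr_left fun n => ?_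
    ring

theorem isRateOptimal_superEstimator {k φu φw : ℝ → ℝ} {α K pstar β γ : ℝ} (hα : 0 < α)
    (hK : 0 ≤ K) (hpstar : pstar < 1) (hk : IsDensity k) (hβ : 0 < β) (hγ : 0 < γ)
    (hss : SuperSmooth k β γ) (hu : IsAtomKernel α φu) (hw : IsDensityKernel α φw) {c : ℝ}
    (hc : 0 < c)
    (hlow : ∀ n : ℕ, 2 ≤ n →
      ENNReal.ofReal (c * Real.log n ^ (-(2 * α) / β)) ≤ minimaxRisk n k α K pstar) :
    IsRateOptimal k α K pstar (superEstimator k φu φw β γ)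
      (fun n => Real.log n ^ (-(2 * α) / β)) := by
  obtain ⟨U, hU0, hUα, hU⟩ := hu.exists_bound hα.le
  obtain ⟨W, hW0, hW, hC⟩ := hw.exists_bound hα.le
  obtain ⟨C, hC0, b, hJ⟩ := hss.invSqMass_le hk hβ hγ
  have h0 := hss.1
  have hki := hss.2.1
  set h : ℕ → ℝ := fun n => (4 / γ) ^ (1 / β) * Real.log n ^ (-(1 / β)) with hh
  set J : ℕ → ℝ := fun n => 2 / h n * (C * (1 + h n ^ (-b) *
    Real.exp (2 * ((h n)⁻¹ ^ β / γ)))) with hJd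
  have hlog : ∀ n : ℕ, 2 ≤ n → (0 : ℝ) < n ∧ 0 < Real.log n ∧ 0 < h n := fun n hn => by
    have h5 : (1 : ℝ) < n := by exact_mod_cast hn
    have h4 : 0 < Real.log n := Real.log_pos h5
    exact ⟨by linarith, h4, by rw [hh]; positivity⟩
  have hbig := super_bound_isBigO (K := K) (U := U) (W := W) (Λ := ∫ t, ‖phi k t‖) (C := C)
    (b := b) (c := (4 / γ) ^ (1 / β)) hα hβ (by positivity) (D := 1 - pstar) (by linarith)
    (h := h) (J := J) (fun n => rfl) (fun n hn => by
      obtain ⟨h1, h2, h3⟩ := hlog n hn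
      -- The constant `4 / γ` in the bandwidth is used here: the exponential growth of `|φ_Z|⁻²` at
      -- frequency `1/h` becomes exactly `n^(1/2)`, half of what the sample size can pay for.
      have e1 : (h n)⁻¹ ^ β = γ / 4 * Real.log n := by
        rw [hh, mul_inv, Real.mul_rpow (by positivity) (by positivity), ← Real.rpow_neg h2.le,
          neg_neg, ← Real.rpow_mul h2.le, ← Real.inv_rpow (by positivity),
          ← Real.rpow_mul (by positivity), one_div_mul_cancel hβ.ne', Real.rpow_one,
          Real.rpow_one, inv_div]
      have e2 : Real.exp (2 * ((h n)⁻¹ ^ β / γ)) = (n : ℝ) ^ (1 / 2 : ℝ) := by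
        rw [e1, Real.rpow_def_of_pos h1]
        congr 1
        field_simp
        norm_num
      rw [hJd]
      simp only
      rw [e2])
  refine isRateOptimal_of_isBigO (fun n hn => ?_) (fun n hn => ?_) (fun n hn => ?_) hbig hc hlow
  · exact isEstimator_fEst hk hw.measurable _
      (measurable_pEstTrunc hk h0 hu.measurable hU (hlog n hn).2.2 _)
  · have := (hlog n hn).2.1
    positivity
  · have hhn := (hlog n hn).2.2
    have hne : (Finset.univ : Finset (Fin n)).Nonempty := Finset.card_pos.1 (by simp; omega)
    simp only [maxRisk, iSup_le_iff]
    intro f hf p hp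
    have hJ0 : 0 ≤ J n := by rw [hJd]; positivity
    have key := mise_unsplit_le (n := n) (s := Finset.univ) (s' := Finset.univ) hk hki hf h0 hp.1
      hp.2 hpstar (truncLevel_pos hn) (truncLevel_lt_one hn) hu hU0 hUα hU hK hhn hw hW hC hhn
      (J := J n) (J' := J n) hJ0 hJ0 (hJ _ hhn) (hJ _ hhn) hne hne
    rw [Finset.card_univ, Fintype.card_fin] at key
    simp only [sub_sub_cancel]
    exact key

end AtomicDeconv

/-! ### Product measures and two-point lower bounds. -/

namespace AtomicDeconv

open ProbabilityTheory

section Product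

variable {n : ℕ} {μ : Measure ℝ} [IsProbabilityMeasure μ]

theorem lintegral_pi_prod {F : Fin n → ℝ → ℝ≥0∞} (hF : ∀ j, Measurable (F j)) :
    ∫⁻ X : Fin n → ℝ, ∏ j, F j (X j) ∂(Measure.pi fun _ => μ) = ∏ j, ∫⁻ x, F j x ∂μ := by
  have hind : iIndepFun (fun (j : Fin n) (X : Fin n → ℝ) => F j (X j)) (Measure.pi fun _ => μ) :=
    iIndepFun_pi (fun j => (hF j).aemeasurable)
  rw [lintegral_prod_eq_prod_lintegral_of_indepFun Finset.univ _ hind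
    fun j => (hF j).comp (measurable_pi_apply j)]
  refine Finset.prod_congr rfl fun j _ => ?_
  have hmp := measurePreserving_eval (μ := fun _ : Fin n => μ) j
  exact hmp.lintegral_comp (hF j)

/-- It suffices to compare on boxes, where the indicator of the box is a product over the
coordinates. -/
theorem pi_withDensity {L : ℝ → ℝ≥0∞} (hL : Measurable L)
    [IsProbabilityMeasure (μ.withDensity L)] :
    (Measure.pi fun _ : Fin n => μ.withDensity L)
      = (Measure.pi fun _ : Fin n => μ).withDensity fun X => ∏ j, L (X j) := by
  refine Measure.pi_eq (μ := fun _ : Fin n => μ.withDensity L) fun s hs => ?_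
  rw [withDensity_apply _ (MeasurableSet.univ_pi hs),
    ← lintegral_indicator (MeasurableSet.univ_pi hs)]
  have : ∀ X : Fin n → ℝ, (Set.univ.pi s).indicator (fun X => ∏ j, L (X j)) X
      = ∏ j, (s j).indicator L (X j) := fun X => by
    by_cases h : X ∈ Set.univ.pi s
    · rw [Set.indicator_of_mem h]
      refine Finset.prod_congr rfl fun j _ => ?_
      rw [Set.indicator_of_mem (h j (Set.mem_univ j))]
    · rw [Set.indicator_of_notMem h]
      simp only [Set.mem_pi, Set.mem_univ, true_implies, not_forall] at h
      obtain ⟨j, hj⟩ := h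
      exact (Finset.prod_eq_zero (Finset.mem_univ j) (Set.indicator_of_notMem hj _)).symm
  simp_rw [this]
  rw [lintegral_pi_prod fun j => hL.indicator (hs j)]
  refine Finset.prod_congr rfl fun j _ => ?_
  rw [lintegral_indicator (hs j), withDensity_apply _ (hs j)]

end Product

theorem add_sq_le_two_mul (a b : ℝ≥0∞) : (a + b) ^ 2 ≤ 2 * (a ^ 2 + b ^ 2) := by
  calc (a + b) ^ 2 = a ^ 2 + b ^ 2 + 2 * (a * b) := by ring
    _ ≤ a ^ 2 + b ^ 2 + (a ^ 2 + b ^ 2) := by gcongr; exact two_mul_le_sq_add_sq a b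
    _ = _ := by ring

/-- A two-point lower bound for the quadratic risk under laws with a square integrable density
ratio. -/
theorem two_point_lower_bound {Ω : Type*} [MeasurableSpace Ω] {P : Measure Ω}
    [IsProbabilityMeasure P] {L : Ω → ℝ≥0∞} (hL : Measurable L)
    [IsProbabilityMeasure (P.withDensity L)] (hL2 : ∫⁻ x, L x ^ 2 ∂P ≤ 3) {Y : Ω → ℝ}
    (hY : Measurable Y) (a b : ℝ) :
    ENNReal.ofReal ((b - a) ^ 2 / 8) ≤ ∫⁻ x, ENNReal.ofReal ((Y x - a) ^ 2) ∂P
      + ∫⁻ x, ENNReal.ofReal ((Y x - b) ^ 2) ∂(P.withDensity L) := by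
  have hsq : ∀ c : ℝ, ∀ x, ENNReal.ofReal ((Y x - c) ^ 2) = ‖Y x - c‖ₑ ^ 2 := fun c x => by
    rw [← ofReal_norm, ← ENNReal.ofReal_pow (norm_nonneg _), Real.norm_eq_abs, sq_abs]
  simp_rw [hsq]
  set Q := P.withDensity L
  have h1 : ‖b - a‖ₑ ≤ (∫⁻ x, ‖Y x - b‖ₑ ∂Q) + ∫⁻ x, ‖Y x - a‖ₑ ∂Q := by
    rw [← lintegral_add_left (by fun_prop)]
    calc ‖b - a‖ₑ = ∫⁻ _, ‖b - a‖ₑ ∂Q := by simp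
      _ ≤ _ := lintegral_mono fun x => by
        rw [show b - a = (Y x - a) - (Y x - b) by ring, add_comm]
        exact enorm_sub_le
  have h2 : (∫⁻ x, ‖Y x - b‖ₑ ∂Q) ^ 2 ≤ ∫⁻ x, ‖Y x - b‖ₑ ^ 2 ∂Q := by
    have := lintegral_mul_sq_le Q (f := fun _ => 1) (g := fun x => ‖Y x - b‖ₑ)
      (by fun_prop) (by fun_prop)
    simpa using this
  -- Change of measure by Cauchy–Schwarz: the error around `a` under `Q` is bounded by the risk
  -- under `P` and the second moment of the ratio.
  have h3 : (∫⁻ x, ‖Y x - a‖ₑ ∂Q) ^ 2 ≤ 3 * ∫⁻ x, ‖Y x - a‖ₑ ^ 2 ∂P := by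
    rw [lintegral_withDensity_eq_lintegral_mul _ hL (by fun_prop)]
    refine (lintegral_mul_sq_le P hL.aemeasurable (by fun_prop)).trans ?_
    gcongr
  have h4 : ENNReal.ofReal ((b - a) ^ 2) = ‖b - a‖ₑ ^ 2 := by
    rw [← ofReal_norm, ← ENNReal.ofReal_pow (norm_nonneg _), Real.norm_eq_abs, sq_abs]
  rw [ENNReal.ofReal_div_of_pos (by norm_num), ENNReal.ofReal_ofNat, h4]
  refine ENNReal.div_le_of_le_mul' ?_
  calc ‖b - a‖ₑ ^ 2 ≤ ((∫⁻ x, ‖Y x - b‖ₑ ∂Q) + ∫⁻ x, ‖Y x - a‖ₑ ∂Q) ^ 2 := by gcongr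
    _ ≤ 2 * ((∫⁻ x, ‖Y x - b‖ₑ ∂Q) ^ 2 + (∫⁻ x, ‖Y x - a‖ₑ ∂Q) ^ 2) := add_sq_le_two_mul _ _
    _ ≤ 2 * ((∫⁻ x, ‖Y x - b‖ₑ ^ 2 ∂Q) + 3 * ∫⁻ x, ‖Y x - a‖ₑ ^ 2 ∂P) := by gcongr
    _ = 6 * (∫⁻ x, ‖Y x - a‖ₑ ^ 2 ∂P) + 2 * ∫⁻ x, ‖Y x - b‖ₑ ^ 2 ∂Q := by ring
    _ ≤ 8 * (∫⁻ x, ‖Y x - a‖ₑ ^ 2 ∂P) + 8 * ∫⁻ x, ‖Y x - b‖ₑ ^ 2 ∂Q := by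
      gcongr <;> norm_num
    _ = _ := by ring

/-- Two-point lower bound for product laws: the density ratio of one coordinate has a second
moment which is at most `1 + 1/n`. -/
theorem two_point_lower_bound_pi {n : ℕ} {P : Measure ℝ} [IsProbabilityMeasure P]
    {L : ℝ → ℝ≥0∞} (hL : Measurable L) [IsProbabilityMeasure (P.withDensity L)] {x : ℝ}
    (hx : 0 ≤ x) (hnx : n * x ≤ 1) (hL2 : ∫⁻ y, L y ^ 2 ∂P ≤ ENNReal.ofReal (1 + x))
    {Y : (Fin n → ℝ) → ℝ} (hY : Measurable Y) (a b : ℝ) :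
    ENNReal.ofReal ((b - a) ^ 2 / 8)
      ≤ ∫⁻ X, ENNReal.ofReal ((Y X - a) ^ 2) ∂(Measure.pi fun _ => P)
      + ∫⁻ X, ENNReal.ofReal ((Y X - b) ^ 2) ∂(Measure.pi fun _ => P.withDensity L) := by
  have hpi := pi_withDensity (n := n) hL (μ := P)
  have : IsProbabilityMeasure ((Measure.pi fun _ : Fin n => P).withDensity
      fun X => ∏ j, L (X j)) := by
    rw [← hpi]; infer_instance
  rw [hpi]
  refine two_point_lower_bound (by fun_prop) ?_ hY a b
  simp_rw [← Finset.prod_pow]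
  rw [lintegral_pi_prod (F := fun _ y => L y ^ 2) fun _ => by fun_prop]
  rw [Finset.prod_const, Finset.card_univ, Fintype.card_fin]
  calc (∫⁻ y, L y ^ 2 ∂P) ^ n ≤ ENNReal.ofReal (1 + x) ^ n := by gcongr
    _ = ENNReal.ofReal ((1 + x) ^ n) := by rw [ENNReal.ofReal_pow (by linarith)]
    _ ≤ ENNReal.ofReal 3 := by
      refine ENNReal.ofReal_le_ofReal ?_
      calc (1 + x) ^ n ≤ Real.exp x ^ n := by
            gcongr
            linarith [Real.add_one_le_exp x]
        _ = Real.exp (n * x) := by rw [← Real.exp_nat_mul]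
        _ ≤ Real.exp 1 := Real.exp_le_exp.2 hnx
        _ ≤ 3 := by linarith [Real.exp_one_lt_d9]
    _ = 3 := by simp

end AtomicDeconv

/-! ### Localised waves whose Fourier transforms are bumps at `± ν`. -/

namespace AtomicDeconv

open scoped FourierTransform SchwartzMap ContDiff

/-- A smooth even bump function supported on `[-1/2, 1/2]`. -/
noncomputable def baseBump : ContDiffBump (0 : ℝ) := ⟨1 / 4, 1 / 2, by norm_num, by norm_num⟩

/-- Two symmetric copies of the bump function, centred at the frequencies `± ν`. -/
noncomputable def waveBump (ν s : ℝ) : ℝ := (baseBump (s - ν) + baseBump (s + ν)) / 2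

theorem baseBump_eq_zero {s : ℝ} (hs : 1 / 2 ≤ |s|) : baseBump s = 0 :=
  baseBump.zero_of_le_dist (by simpa [baseBump] using hs)

theorem waveBump_nonneg (ν s : ℝ) : 0 ≤ waveBump ν s := by
  have h1 : 0 ≤ baseBump (s - ν) := baseBump.nonneg
  have h2 : 0 ≤ baseBump (s + ν) := baseBump.nonneg
  unfold waveBump
  positivity

theorem waveBump_le_one (ν s : ℝ) : waveBump ν s ≤ 1 := by
  have h1 : baseBump (s - ν) ≤ 1 := baseBump.le_one
  have h2 : baseBump (s + ν) ≤ 1 := baseBump.le_one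
  unfold waveBump
  linarith

theorem waveBump_neg (ν s : ℝ) : waveBump ν (-s) = waveBump ν s := by
  unfold waveBump
  rw [show -s - ν = -(s + ν) by ring, show -s + ν = -(s - ν) by ring, baseBump.neg, baseBump.neg,
    add_comm]

theorem abs_sub_lt_of_waveBump_ne_zero {ν s : ℝ} (h : waveBump ν s ≠ 0) :
    |s - ν| < 1 / 2 ∨ |s + ν| < 1 / 2 := by
  by_contra! hc
  exact h (by rw [waveBump, baseBump_eq_zero hc.1, baseBump_eq_zero hc.2]; norm_num)

theorem abs_bounds_of_waveBump_ne_zero {ν s : ℝ} (h : waveBump ν s ≠ 0) :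
    ν - 1 / 2 < |s| ∧ |s| < |ν| + 1 / 2 := by
  rcases abs_sub_lt_of_waveBump_ne_zero h with h1 | h1 <;> rw [abs_lt] at h1 <;>
  rcases abs_cases s with ⟨h2, h3⟩ | ⟨h2, h3⟩ <;> rcases abs_cases ν with ⟨h4, h5⟩ | ⟨h4, h5⟩ <;>
  constructor <;> linarith

/-- Frequencies at distance at least one give disjoint bumps. By Parseval this makes the waves
orthogonal, and it keeps sums of waves bounded in frequency. -/
theorem waveBump_mul_eq_zero {ν ν' : ℝ} (hν : 0 ≤ ν) (hν' : ν + 1 ≤ ν') (s : ℝ) :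
    waveBump ν s * waveBump ν' s = 0 := by
  by_contra h
  have h1 := (abs_bounds_of_waveBump_ne_zero (left_ne_zero_of_mul h)).2
  have h2 := (abs_bounds_of_waveBump_ne_zero (right_ne_zero_of_mul h)).1
  rw [abs_of_nonneg hν] at h1
  linarith

theorem contDiff_waveBump (ν : ℝ) : ContDiff ℝ ∞ (waveBump ν) := by
  have h1 : ContDiff ℝ ∞ fun s : ℝ => baseBump (s - ν) := baseBump.contDiff.comp (by fun_prop)
  have h2 : ContDiff ℝ ∞ fun s : ℝ => baseBump (s + ν) := baseBump.contDiff.comp (by fun_prop)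
  exact (h1.add h2).div_const 2

theorem hasCompactSupport_waveBump (ν : ℝ) : HasCompactSupport (waveBump ν) := by
  refine HasCompactSupport.intro (isCompact_Icc (a := -(|ν| + 1 / 2)) (b := |ν| + 1 / 2))
    fun s hs => ?_
  by_contra h
  have := (abs_bounds_of_waveBump_ne_zero h).2
  exact hs (abs_le.1 this.le)

/-- The bump function `waveBump` as a complex Schwartz function. -/
noncomputable def waveSchwartz (ν : ℝ) : 𝓢(ℝ, ℂ) :=
  HasCompactSupport.toSchwartzMap (f := fun s => (waveBump ν s : ℂ))
    ((hasCompactSupport_waveBump ν).comp_left (g := ((↑) : ℝ → ℂ)) Complex.ofReal_zero)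
    (Complex.ofRealCLM.contDiff.comp (contDiff_waveBump ν))

theorem waveSchwartz_apply (ν s : ℝ) : waveSchwartz ν s = (waveBump ν s : ℂ) := rfl

/-- A localized oscillation of frequency `ν` whose Fourier transform is `waveBump`. -/
noncomputable def wave (ν x : ℝ) : ℝ := ((𝓕 (waveSchwartz ν)) x).re

/-- Conjugation turns the transform of a real function into the inverse transform, and evenness
identifies the two. -/
theorem fourier_ofReal_im_eq_zero {u : ℝ → ℝ} (hu : ∀ s, u (-s) = u s) (x : ℝ) :
    (𝓕 (fun s => (u s : ℂ)) x).im = 0 := by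
  rw [← Complex.conj_eq_iff_im]
  have h : (starRingEnd ℂ) (𝓕 (fun s => (u s : ℂ)) x) = 𝓕⁻ (fun s => (u s : ℂ)) x := by
    rw [Real.fourier_eq', Real.fourierInv_eq', ← integral_conj]
    refine integral_congr_ae (Eventually.of_forall fun s => ?_)
    simp only [smul_eq_mul, map_mul, ← Complex.exp_conj, Complex.conj_ofReal, Complex.conj_I]
    congr 2
    push_cast
    ring
  rw [h, Real.fourierInv_eq_fourier_comp_neg]
  simp_rw [hu]

theorem wave_eq_fourier (ν x : ℝ) : (wave ν x : ℂ) = (𝓕 (waveSchwartz ν)) x := by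
  refine Complex.ext (by simp [wave]) ?_
  rw [Complex.ofReal_im, SchwartzMap.fourier_coe]
  exact (fourier_ofReal_im_eq_zero (u := waveBump ν) (waveBump_neg ν) x).symm

theorem wave_eq_fourier' (ν x : ℝ) : (wave ν x : ℂ) = 𝓕 (fun s => (waveBump ν s : ℂ)) x := by
  rw [wave_eq_fourier, SchwartzMap.fourier_coe]
  rfl

theorem continuous_wave (ν : ℝ) : Continuous (wave ν) :=
  Complex.continuous_re.comp (𝓕 (waveSchwartz ν)).continuous

theorem integrable_wave (ν : ℝ) : Integrable (wave ν) :=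
  (𝓕 (waveSchwartz ν)).integrable.re

theorem integrable_waveBump (ν : ℝ) : Integrable (waveBump ν) :=
  (contDiff_waveBump ν).continuous.integrable_of_hasCompactSupport (hasCompactSupport_waveBump ν)

theorem fourierInv_wave (ν s : ℝ) : 𝓕⁻ (fun x => (wave ν x : ℂ)) s = waveBump ν s := by
  have h : (fun x => (wave ν x : ℂ)) = fun x => (𝓕 (waveSchwartz ν)) x :=
    funext fun x => wave_eq_fourier ν x
  have h2 : (𝓕⁻ (𝓕 (waveSchwartz ν))) s = waveSchwartz ν s := by
    rw [FourierTransform.fourierInv_fourier_eq]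
  rw [h, ← waveSchwartz_apply, ← h2, SchwartzMap.fourierInv_coe]

theorem integral_wave_mul_wave (ν ν' : ℝ) :
    ∫ x, wave ν x * wave ν' x = ∫ s, waveBump ν s * waveBump ν' s := by
  have h := SchwartzMap.integral_inner_fourier_fourier (waveSchwartz ν) (waveSchwartz ν')
  simp_rw [← wave_eq_fourier, waveSchwartz_apply, RCLike.inner_apply, Complex.conj_ofReal,
    ← Complex.ofReal_mul, integral_complex_ofReal] at h
  have h' := Complex.ofReal_injective h
  simp_rw [mul_comm (wave ν _), mul_comm (waveBump ν _)]
  exact h'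

theorem fourier_comp_add_right (f : ℝ → ℂ) (v x : ℝ) :
    𝓕 (fun s => f (s + v)) x = Complex.exp (2 * Real.pi * v * x * Complex.I) * 𝓕 f x := by
  rw [Real.fourier_eq', Real.fourier_eq', ← integral_const_mul,
    ← integral_add_right_eq_self (fun s => Complex.exp (2 * Real.pi * v * x * Complex.I) *
      (Complex.exp (↑(-2 * Real.pi * inner ℝ s x) * Complex.I) • f s)) v]
  refine integral_congr_ae (Eventually.of_forall fun s => ?_)
  simp only [smul_eq_mul, RCLike.inner_apply, conj_trivial]
  rw [← mul_assoc (Complex.exp _) (Complex.exp _), ← Complex.exp_add]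
  congr 2
  push_cast
  ring

/-- A shift in frequency is a modulation, so `wave ν` is `wave 0` times `cos (2πνx)`, and the
Schwartz decay of `wave 0` serves every frequency at once. The decay chosen is that of the Cauchy
density, so that small multiples of waves preserve its positivity. -/
theorem exists_abs_wave_le : ∃ C > 0, ∀ ν x, |wave ν x| ≤ C / (1 + x ^ 2) := by
  obtain ⟨C₀, hC₀, h0⟩ := (𝓕 (waveSchwartz 0)).decay 0 0
  obtain ⟨C₂, hC₂, h2⟩ := (𝓕 (waveSchwartz 0)).decay 2 0
  refine ⟨C₀ + C₂, by positivity, fun ν x => ?_⟩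
  have hb : ∀ s, waveBump 0 s = baseBump s := fun s => by
    rw [waveBump, sub_zero, add_zero]; ring
  have hi : ∀ v, Integrable fun s => ((baseBump (s + v) : ℝ) : ℂ) := fun v => by
    have := (integrable_waveBump 0).comp_add_right v
    simp_rw [hb] at this
    exact this.ofReal
  have h1 : 𝓕 (fun s => (waveBump ν s : ℂ)) x
      = (Complex.exp (2 * Real.pi * (-ν : ℝ) * x * Complex.I)
        + Complex.exp (2 * Real.pi * ν * x * Complex.I)) / 2
        * 𝓕 (fun s => (baseBump s : ℂ)) x := by
    have e : (fun s => (waveBump ν s : ℂ)) = fun s => (1 / 2 : ℂ) •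
        (((baseBump (s + (-ν)) : ℝ) : ℂ) + ((baseBump (s + ν) : ℝ) : ℂ)) := by
      ext s
      rw [waveBump, sub_eq_add_neg]
      push_cast
      simp only [smul_eq_mul]
      ring
    rw [e, Real.fourier_eq']
    have e2 : ∀ s : ℝ, Complex.exp (↑(-2 * Real.pi * inner ℝ s x) * Complex.I) • ((1 / 2 : ℂ) •
        (((baseBump (s + (-ν)) : ℝ) : ℂ) + ((baseBump (s + ν) : ℝ) : ℂ)))
        = (1 / 2 : ℂ) * (Complex.exp (↑(-2 * Real.pi * inner ℝ s x) * Complex.I) •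
          ((baseBump (s + (-ν)) : ℝ) : ℂ)) + (1 / 2 : ℂ) *
          (Complex.exp (↑(-2 * Real.pi * inner ℝ s x) * Complex.I) •
          ((baseBump (s + ν) : ℝ) : ℂ)) := fun s => by
      simp only [smul_eq_mul]; ring
    have hi2 : ∀ v, Integrable fun s : ℝ =>
        Complex.exp (↑(-2 * Real.pi * inner ℝ s x) * Complex.I) •
          ((baseBump (s + v) : ℝ) : ℂ) := fun v => by
      refine (hi v).bdd_mul (c := 1) (by fun_prop) (Eventually.of_forall fun s => ?_)
      rw [Complex.norm_exp_ofReal_mul_I]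
    simp_rw [e2]
    rw [integral_add ((hi2 _).const_mul _) ((hi2 _).const_mul _), integral_const_mul,
      integral_const_mul, ← Real.fourier_eq', ← Real.fourier_eq',
      fourier_comp_add_right (fun s => ((baseBump s : ℝ) : ℂ)),
      fourier_comp_add_right (fun s => ((baseBump s : ℝ) : ℂ))]
    ring
  have h3 : |wave ν x| ≤ ‖(𝓕 (waveSchwartz 0)) x‖ := by
    have e : |wave ν x| = ‖(wave ν x : ℂ)‖ := (RCLike.norm_ofReal _).symm
    have e' : (𝓕 (waveSchwartz 0)) x = 𝓕 (fun s => (baseBump s : ℂ)) x := by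
      rw [← wave_eq_fourier, wave_eq_fourier']
      simp_rw [hb]
    rw [e, wave_eq_fourier', h1, e', norm_mul]
    refine mul_le_of_le_one_left (norm_nonneg _) ?_
    have hn : ∀ v : ℝ, ‖Complex.exp (2 * Real.pi * v * x * Complex.I)‖ = 1 := fun v => by
      rw [show (2 * Real.pi * v * x * Complex.I : ℂ)
        = ((2 * Real.pi * v * x : ℝ) : ℂ) * Complex.I by push_cast; ring,
        Complex.norm_exp_ofReal_mul_I]
    rw [norm_div, Complex.norm_ofNat, div_le_one (by norm_num)]
    refine (norm_add_le _ _).trans ?_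
    rw [hn, hn]
    norm_num
  have h4 := h0 x
  have h5 := h2 x
  simp only [pow_zero, norm_iteratedFDeriv_zero, one_mul, Real.norm_eq_abs, sq_abs] at h4 h5
  refine h3.trans ?_
  rw [le_div_iff₀ (by positivity)]
  linarith

theorem integral_waveBump_sq_pos (ν : ℝ) : 0 < ∫ s, waveBump ν s * waveBump ν s := by
  have hc : Continuous fun s => waveBump ν s * waveBump ν s :=
    (contDiff_waveBump ν).continuous.mul (contDiff_waveBump ν).continuous
  refine hc.integral_pos_of_hasCompactSupport_nonneg_nonzero
    ((hasCompactSupport_waveBump ν).mul_left) (fun s => mul_self_nonneg _) (x := ν) ?_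
  have h1 : baseBump (ν - ν) = 1 := by
    rw [sub_self]
    exact baseBump.one_of_mem_closedBall (Metric.mem_closedBall_self baseBump.rIn_pos.le)
  have h2 : 0 ≤ baseBump (ν + ν) := baseBump.nonneg
  have : waveBump ν ν ≠ 0 := by
    unfold waveBump
    rw [h1]
    positivity
  exact mul_ne_zero this this

/-- The squared norm of `wave ν`, which does not depend on the frequency `ν ≥ 1`. -/
noncomputable def waveMass : ℝ := (∫ s, baseBump s * baseBump s) / 2

theorem integral_waveBump_sq {ν : ℝ} (hν : 1 ≤ ν) :
    ∫ s, waveBump ν s * waveBump ν s = waveMass := by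
  have h0 : ∀ s, baseBump (s - ν) * baseBump (s + ν) = 0 := fun s => by
    by_contra h
    have h1 : |s - ν| < 1 / 2 := by
      by_contra! hc; exact left_ne_zero_of_mul h (baseBump_eq_zero hc)
    have h2 : |s + ν| < 1 / 2 := by
      by_contra! hc; exact right_ne_zero_of_mul h (baseBump_eq_zero hc)
    rw [abs_lt] at h1 h2
    linarith
  have e : ∀ s, waveBump ν s * waveBump ν s = (1 / 4) * (baseBump (s - ν) * baseBump (s - ν))
      + (1 / 4) * (baseBump (s + ν) * baseBump (s + ν)) := fun s => by
    unfold waveBump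
    have := h0 s
    linear_combination (1 / 2) * this
  have hi : Integrable fun s => baseBump s * baseBump s :=
    (baseBump.continuous.mul baseBump.continuous).integrable_of_hasCompactSupport
      baseBump.hasCompactSupport.mul_left
  simp_rw [e]
  rw [integral_add ((hi.comp_sub_right ν).const_mul _) ((hi.comp_add_right ν).const_mul _),
    integral_const_mul, integral_const_mul,
    integral_sub_right_eq_self (fun s => baseBump s * baseBump s),
    integral_add_right_eq_self (fun s => baseBump s * baseBump s), waveMass]
  ring

theorem waveMass_pos : 0 < waveMass := by
  rw [← integral_waveBump_sq le_rfl]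
  exact integral_waveBump_sq_pos 1

end AtomicDeconv

/-! ### The Cauchy density and its Fourier transform. -/

namespace AtomicDeconv

open scoped FourierTransform

/-- The standard Cauchy density. -/
noncomputable def cauchyDensity (x : ℝ) : ℝ := Real.pi⁻¹ * (1 + x ^ 2)⁻¹

theorem cauchyDensity_pos (x : ℝ) : 0 < cauchyDensity x := by
  unfold cauchyDensity
  positivity

theorem integrable_cauchyDensity : Integrable cauchyDensity :=
  integrable_inv_one_add_sq.const_mul _

theorem continuous_cauchyDensity : Continuous cauchyDensity := by
  unfold cauchyDensity
  exact continuous_const.mul (Continuous.inv₀ (by fun_prop) fun x => by positivity)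

theorem isDensity_of_integral_eq_one {f : ℝ → ℝ} (hm : Measurable f) (h0 : ∀ x, 0 ≤ f x)
    (hi : Integrable f) (h1 : ∫ x, f x = 1) : IsDensity f :=
  ⟨hm, h0, by
    rw [← ofReal_integral_eq_lintegral_ofReal hi (Eventually.of_forall h0), h1,
      ENNReal.ofReal_one]⟩

theorem phi_eq_fourierInv {f : ℝ → ℝ} (hf : IsDensity f) (t : ℝ) :
    phi f t = 𝓕⁻ (fun x => (f x : ℂ)) (t / (2 * Real.pi)) := by
  rw [fourierInv_eq_integral_exp, phi_eq_integral hf]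
  have : 2 * Real.pi * (t / (2 * Real.pi)) = t := by field_simp
  rw [this]

theorem integrable_of_even {F : ℝ → ℝ} (hF : ∀ t, F (-t) = F t)
    (h : IntegrableOn F (Set.Ioi 0)) : Integrable F := by
  rw [← integrableOn_univ, ← Set.Iic_union_Ioi (a := (0 : ℝ))]
  refine IntegrableOn.union ?_ h
  rw [integrableOn_Iic_iff_integrableOn_Iio]
  have h' : IntegrableOn F (Set.Ioi (-0)) := by rwa [neg_zero]
  exact h'.comp_neg_Iio.congr_fun (fun t _ => hF t) measurableSet_Iio

theorem integrable_exp_neg_abs : Integrable fun t : ℝ => Real.exp (-|t|) := by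
  refine integrable_of_even (fun t => by rw [abs_neg]) ?_
  refine (integrableOn_exp_neg_Ioi 0).congr_fun (fun t ht => ?_) measurableSet_Ioi
  simp only
  rw [abs_of_pos ht]

theorem integral_exp_mul_exp_neg_abs (x : ℝ) :
    ∫ t : ℝ, Complex.exp (-(Complex.I * t * x)) * (Real.exp (-|t|) : ℂ)
      = ((2 / (1 + x ^ 2) : ℝ) : ℂ) := by
  have hi : Integrable fun t : ℝ =>
      Complex.exp (-(Complex.I * t * x)) * (Real.exp (-|t|) : ℂ) := by
    refine integrable_exp_neg_abs.ofReal.bdd_mul (c := 1) (by fun_prop)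
      (Eventually.of_forall fun t => ?_)
    rw [show -(Complex.I * t * x) = ((-(t * x) : ℝ) : ℂ) * Complex.I by push_cast; ring,
      Complex.norm_exp_ofReal_mul_I]
  rw [← intervalIntegral.integral_Iic_add_Ioi (b := (0 : ℝ)) hi.integrableOn hi.integrableOn]
  have e1 : ∫ t in Set.Iic (0 : ℝ), Complex.exp (-(Complex.I * t * x)) * (Real.exp (-|t|) : ℂ)
      = ∫ t in Set.Iic (0 : ℝ), Complex.exp ((1 - Complex.I * x) * t) := by
    refine setIntegral_congr_fun measurableSet_Iic fun t ht => ?_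
    rw [abs_of_nonpos ht, Complex.ofReal_exp, ← Complex.exp_add]
    congr 1
    push_cast
    ring
  have e2 : ∫ t in Set.Ioi (0 : ℝ), Complex.exp (-(Complex.I * t * x)) * (Real.exp (-|t|) : ℂ)
      = ∫ t in Set.Ioi (0 : ℝ), Complex.exp ((-1 - Complex.I * x) * t) := by
    refine setIntegral_congr_fun measurableSet_Ioi fun t ht => ?_
    rw [abs_of_pos ht, Complex.ofReal_exp, ← Complex.exp_add]
    congr 1
    push_cast
    ring
  have n1 : (1 - Complex.I * x : ℂ) ≠ 0 := fun h => by
    have := congrArg Complex.re h; simp at this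
  have n2 : (-1 - Complex.I * x : ℂ) ≠ 0 := fun h => by
    have := congrArg Complex.re h; simp at this
  have n3 : (1 + x ^ 2 : ℂ) ≠ 0 := by
    have : (1 + x ^ 2 : ℝ) ≠ 0 := by positivity
    exact_mod_cast this
  rw [e1, e2, integral_exp_mul_complex_Iic (by simp), integral_exp_mul_complex_Ioi (by simp)]
  simp only [Complex.ofReal_zero, mul_zero, Complex.exp_zero]
  push_cast
  have key : (1 - Complex.I * x) * (-1 - Complex.I * x) = -(1 + x ^ 2 : ℂ) := by
    linear_combination (x : ℂ) ^ 2 * Complex.I_sq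
  field_simp
  linear_combination (-2 : ℂ) * key

/-- The transform of `exp (-|2πs|)` is an elementary integral over two half-lines and equals the
Cauchy density; Fourier inversion gives the converse. -/
theorem fourierInv_cauchyDensity (s : ℝ) :
    𝓕⁻ (fun x => (cauchyDensity x : ℂ)) s = (Real.exp (-|2 * Real.pi * s|) : ℂ) := by
  set E : ℝ → ℂ := fun s => (Real.exp (-|2 * Real.pi * s|) : ℂ) with hE
  have h1 : 𝓕 E = fun x => (cauchyDensity x : ℂ) := by
    ext x
    rw [hE, fourier_comp_two_pi_mul (fun t => (Real.exp (-|t|) : ℂ)),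
      integral_exp_mul_exp_neg_abs, cauchyDensity]
    push_cast
    have := Real.pi_ne_zero
    have h2 : (Real.pi : ℂ) ≠ 0 := by exact_mod_cast this
    field_simp
  have hc : Continuous E := by fun_prop
  have hi : Integrable E :=
    (integrable_exp_neg_abs.comp_mul_left' (by positivity : 2 * Real.pi ≠ 0)).ofReal
  have := hc.fourierInv_fourier_eq hi (h1 ▸ integrable_cauchyDensity.ofReal)
  rw [← h1, this]

theorem integrable_cauchy_sobolev {α : ℝ} (hα : 0 ≤ α) :
    Integrable fun t : ℝ => Real.exp (-|t|) ^ 2 * (1 + |t| ^ (2 * α)) := by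
  refine integrable_of_even (fun t => by rw [abs_neg]) ?_
  have h1 : IntegrableOn (fun t : ℝ => t ^ (0 : ℝ) * Real.exp (-2 * t ^ (1 : ℝ))) (Set.Ioi 0) :=
    integrableOn_rpow_mul_exp_neg_mul_rpow (by norm_num) one_pos (by norm_num)
  have h2 : IntegrableOn (fun t : ℝ => t ^ (2 * α) * Real.exp (-2 * t ^ (1 : ℝ)))
      (Set.Ioi 0) :=
    integrableOn_rpow_mul_exp_neg_mul_rpow (by linarith) one_pos (by norm_num)
  have h3 : IntegrableOn (fun t : ℝ => t ^ (0 : ℝ) * Real.exp (-2 * t ^ (1 : ℝ))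
      + t ^ (2 * α) * Real.exp (-2 * t ^ (1 : ℝ))) (Set.Ioi 0) := Integrable.add h1 h2
  refine h3.congr_fun (fun t ht => ?_) measurableSet_Ioi
  simp only
  rw [Real.rpow_zero, Real.rpow_one, abs_of_pos ht, ← Real.exp_nat_mul, Nat.cast_ofNat,
    mul_neg, neg_mul]
  ring

end AtomicDeconv

/-! ### The hypercube of perturbed Cauchy densities. -/

namespace AtomicDeconv

open scoped FourierTransform

/-- The sign `± 1` encoded by a Boolean. -/
def boolSign (b : Bool) : ℝ := if b then 1 else -1

theorem abs_boolSign (b : Bool) : |boolSign b| = 1 := by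
  cases b <;> simp [boolSign]

/-- The Cauchy density perturbed by `N` oscillations with frequencies `N, …, 2N - 1`, amplitude
`a` and signs `θ`. -/
noncomputable def perturb (a : ℝ) {N : ℕ} (θ : Fin N → Bool) (x : ℝ) : ℝ :=
  cauchyDensity x + a * ∑ j, boolSign (θ j) * wave (N + j) x

section Perturb

variable {a C : ℝ} {N : ℕ}

theorem continuous_perturb (a : ℝ) (θ : Fin N → Bool) : Continuous (perturb a θ) := by
  unfold perturb
  have := continuous_cauchyDensity
  have h : ∀ j : Fin N, Continuous (wave (N + j)) := fun j => continuous_wave _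
  fun_prop

/-- Even if all `N` waves add up, they stay below `a N C / (1 + x²)`, a multiple of the Cauchy
density; the condition on `a` makes this at most one half of it. -/
theorem half_cauchyDensity_le_perturb (ha : 0 ≤ a) (hC : ∀ ν x, |wave ν x| ≤ C / (1 + x ^ 2))
    (haC : a * N * C ≤ 1 / (2 * Real.pi)) (θ : Fin N → Bool) (x : ℝ) :
    cauchyDensity x / 2 ≤ perturb a θ x := by
  have h1 : |∑ j, boolSign (θ j) * wave (N + j) x| ≤ N * (C / (1 + x ^ 2)) := by
    refine (Finset.abs_sum_le_sum_abs _ _).trans ?_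
    calc ∑ j, |boolSign (θ j) * wave (N + j) x| ≤ ∑ _j : Fin N, C / (1 + x ^ 2) := by
          refine Finset.sum_le_sum fun j _ => ?_
          rw [abs_mul, abs_boolSign, one_mul]
          exact hC _ _
      _ = N * (C / (1 + x ^ 2)) := by simp
  have h2 := (abs_le.1 h1).1
  have h3 : a * (N * (C / (1 + x ^ 2))) ≤ cauchyDensity x / 2 := by
    rw [cauchyDensity, show a * (N * (C / (1 + x ^ 2))) = (a * N * C) * (1 + x ^ 2)⁻¹ by
      rw [div_eq_mul_inv]; ring,
      show Real.pi⁻¹ * (1 + x ^ 2)⁻¹ / 2 = 1 / (2 * Real.pi) * (1 + x ^ 2)⁻¹ by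
      rw [one_div, mul_inv]; ring]
    gcongr
  have h4 := mul_le_mul_of_nonneg_left h2 ha
  unfold perturb
  linarith

theorem integrable_perturb (a : ℝ) (θ : Fin N → Bool) : Integrable (perturb a θ) :=
  integrable_cauchyDensity.add
    ((integrable_finsetSum _ fun _ _ => (integrable_wave _).const_mul _).const_mul a)

theorem fourierInv_perturb (a : ℝ) (θ : Fin N → Bool) (s : ℝ) :
    𝓕⁻ (fun x => (perturb a θ x : ℂ)) s
      = ((Real.exp (-|2 * Real.pi * s|) + a * ∑ j, boolSign (θ j) * waveBump (N + j) s : ℝ) :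
        ℂ) := by
  have hint : ∀ {u : ℝ → ℝ}, Integrable u → Integrable fun x : ℝ =>
      Complex.exp (Complex.I * (2 * Real.pi * s : ℝ) * x) * (u x : ℂ) := fun {u} hu => by
    refine hu.ofReal.bdd_mul (c := 1) (by fun_prop) (Eventually.of_forall fun x => ?_)
    rw [show Complex.I * (2 * Real.pi * s : ℝ) * x = ((2 * Real.pi * s * x : ℝ) : ℂ) * Complex.I
      by push_cast; ring, Complex.norm_exp_ofReal_mul_I]
  have hw : ∀ ν, ∫ x : ℝ, Complex.exp (Complex.I * (2 * Real.pi * s : ℝ) * x) * (wave ν x : ℂ)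
      = waveBump ν s := fun ν => by
    rw [← fourierInv_eq_integral_exp, fourierInv_wave]
  have hc : ∫ x : ℝ, Complex.exp (Complex.I * (2 * Real.pi * s : ℝ) * x) * (cauchyDensity x : ℂ)
      = (Real.exp (-|2 * Real.pi * s|) : ℂ) := by
    rw [← fourierInv_eq_integral_exp, fourierInv_cauchyDensity]
  rw [fourierInv_eq_integral_exp]
  have e : ∀ x : ℝ, Complex.exp (Complex.I * (2 * Real.pi * s : ℝ) * x) * (perturb a θ x : ℂ)
      = Complex.exp (Complex.I * (2 * Real.pi * s : ℝ) * x) * (cauchyDensity x : ℂ)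
        + a * ∑ j, (boolSign (θ j) : ℂ) *
          (Complex.exp (Complex.I * (2 * Real.pi * s : ℝ) * x) * (wave (N + j) x : ℂ)) :=
    fun x => by
      unfold perturb
      push_cast
      rw [mul_add, Finset.mul_sum, Finset.mul_sum, Finset.mul_sum]
      congr 1
      refine Finset.sum_congr rfl fun j _ => ?_
      ring
  have hi2 : ∀ j ∈ (Finset.univ : Finset (Fin N)), Integrable fun x : ℝ => (boolSign (θ j) : ℂ) *
      (Complex.exp (Complex.I * (2 * Real.pi * s : ℝ) * x) * (wave (N + j) x : ℂ)) :=
    fun j _ => (hint (integrable_wave _)).const_mul _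
  simp_rw [e]
  rw [integral_add (hint integrable_cauchyDensity) ((integrable_finsetSum _ hi2).const_mul _),
    integral_const_mul, integral_finsetSum _ hi2, hc]
  simp_rw [integral_const_mul, hw]
  push_cast
  rfl

theorem waveBump_zero {ν : ℝ} (hν : 1 ≤ ν) : waveBump ν 0 = 0 := by
  by_contra h
  have := (abs_bounds_of_waveBump_ne_zero h).1
  rw [abs_zero] at this
  linarith

/-- The total mass is the transform at frequency zero, where the bumps at `± ν` with `ν ≥ 1` vanish.
-/
theorem isDensity_perturb (ha : 0 ≤ a) (hN : 1 ≤ N) (hC : ∀ ν x, |wave ν x| ≤ C / (1 + x ^ 2))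
    (haC : a * N * C ≤ 1 / (2 * Real.pi)) (θ : Fin N → Bool) : IsDensity (perturb a θ) := by
  refine isDensity_of_integral_eq_one (continuous_perturb a θ).measurable (fun x => ?_)
    (integrable_perturb a θ) ?_
  · have := half_cauchyDensity_le_perturb ha hC haC θ x
    have := cauchyDensity_pos x
    linarith
  · have h := fourierInv_perturb a θ 0
    rw [fourierInv_eq_integral_exp] at h
    have hN' : (1 : ℝ) ≤ N := by exact_mod_cast hN
    have h0 : ∀ j : Fin N, waveBump (N + j) 0 = 0 := fun j =>
      waveBump_zero (by have : (0 : ℝ) ≤ (j : ℕ) := Nat.cast_nonneg _; linarith)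
    simp only [h0, mul_zero, Complex.ofReal_zero, zero_mul, Complex.exp_zero, one_mul, abs_zero,
      neg_zero, Real.exp_zero, Finset.sum_const_zero, add_zero, integral_complex_ofReal] at h
    exact_mod_cast h

/-- At most one bump is nonzero at a given frequency, so the signed sum is bounded by `1` and not by
`N`. -/
theorem abs_sum_waveBump_le (θ : Fin N → Bool) (s : ℝ) :
    |∑ j, boolSign (θ j) * waveBump (N + j) s| ≤ if |s| ≤ 2 * N then 1 else 0 := by
  by_cases h : ∃ j : Fin N, waveBump (N + j) s ≠ 0
  · obtain ⟨j, hj⟩ := h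
    have hs := (abs_bounds_of_waveBump_ne_zero hj).2
    have hjN : ((j : ℕ) : ℝ) + 1 ≤ N := by exact_mod_cast j.2
    rw [abs_of_nonneg (by positivity : (0 : ℝ) ≤ N + (j : ℕ))] at hs
    rw [if_pos (by linarith), Finset.sum_eq_single j ?_ (fun h => (h (Finset.mem_univ j)).elim)]
    · rw [abs_mul, abs_boolSign, one_mul, abs_of_nonneg (waveBump_nonneg _ _)]
      exact waveBump_le_one _ _
    · intro i _ hij
      rcases lt_or_gt_of_ne hij with hlt | hlt
      · have : ((i : ℕ) : ℝ) + 1 ≤ (j : ℕ) := by exact_mod_cast hlt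
        have h0 := waveBump_mul_eq_zero (ν := N + i) (ν' := N + j) (by positivity)
          (by linarith) s
        rw [(mul_eq_zero.1 h0).resolve_right hj, mul_zero]
      · have : ((j : ℕ) : ℝ) + 1 ≤ (i : ℕ) := by exact_mod_cast hlt
        have h0 := waveBump_mul_eq_zero (ν := N + j) (ν' := N + i) (by positivity)
          (by linarith) s
        rw [(mul_eq_zero.1 h0).resolve_left hj, mul_zero]
  · push Not at h
    rw [Finset.sum_eq_zero fun j _ => by rw [h j, mul_zero], abs_zero]
    split_ifs <;> norm_num

/-- In the variable `t = 2πs` the perturbation lives on `|t| ≤ 4πN`, an interval of length `8πN`,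
and is at most `a` there. After `(u + v)² ≤ 2u² + 2v²` its share is bounded by `1` through `haN`;
the Cauchy part gives the rest of the threshold on `K`. -/
theorem perturb_mem_sobolevClass {α K : ℝ} (hα : 0 ≤ α) (ha : 0 ≤ a) (hN : 1 ≤ N)
    (hC : ∀ ν x, |wave ν x| ≤ C / (1 + x ^ 2)) (haC : a * N * C ≤ 1 / (2 * Real.pi))
    (hK : 2 * (∫ t, Real.exp (-|t|) ^ 2 * (1 + |t| ^ (2 * α))) + 1 ≤ K)
    (haN : 16 * Real.pi * N * a ^ 2 * (1 + (4 * Real.pi * N) ^ (2 * α)) ≤ 1)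
    (θ : Fin N → Bool) : perturb a θ ∈ sobolevClass α K := by
  have hd := isDensity_perturb ha hN hC haC θ
  refine ⟨hd, ?_⟩
  set D := 1 + (4 * Real.pi * N) ^ (2 * α) with hD
  have hD0 : 0 ≤ D := by positivity
  set I := Set.Icc (-(4 * Real.pi * N)) (4 * Real.pi * N) with hI
  have hpt : ∀ t, ‖phi (perturb a θ) t‖ ^ 2 * (1 + |t| ^ (2 * α))
      ≤ 2 * (Real.exp (-|t|) ^ 2 * (1 + |t| ^ (2 * α)))
        + I.indicator (fun _ => 2 * a ^ 2 * D) t := fun t => by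
    have e : 2 * Real.pi * (t / (2 * Real.pi)) = t := by field_simp
    rw [phi_eq_fourierInv hd, fourierInv_perturb, e, Complex.norm_real, Real.norm_eq_abs, sq_abs]
    have h1 := abs_sum_waveBump_le θ (t / (2 * Real.pi))
    set S := ∑ j, boolSign (θ j) * waveBump (N + j) (t / (2 * Real.pi)) with hS
    have ht : |t / (2 * Real.pi)| ≤ 2 * N ↔ t ∈ I := by
      rw [hI, Set.mem_Icc, ← abs_le, abs_div, abs_of_pos (by positivity : 0 < 2 * Real.pi),
        div_le_iff₀ (by positivity)]
      rw [show 2 * (N : ℝ) * (2 * Real.pi) = 4 * Real.pi * N by ring]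
    have hw : 0 ≤ 1 + |t| ^ (2 * α) := by positivity
    have h2 : (Real.exp (-|t|) + a * S) ^ 2 ≤ 2 * Real.exp (-|t|) ^ 2 + 2 * a ^ 2 * S ^ 2 := by
      nlinarith [sq_nonneg (Real.exp (-|t|) - a * S)]
    have h3 : S ^ 2 * (1 + |t| ^ (2 * α)) ≤ I.indicator (fun _ => D) t := by
      by_cases hm : t ∈ I
      · rw [if_pos (ht.2 hm)] at h1
        rw [Set.indicator_of_mem hm]
        have h4 : S ^ 2 ≤ 1 := (sq_le_one_iff_abs_le_one S).2 h1
        have h5 : |t| ^ (2 * α) ≤ (4 * Real.pi * N) ^ (2 * α) :=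
          Real.rpow_le_rpow (abs_nonneg t) (abs_le.2 hm) (by positivity)
        calc S ^ 2 * (1 + |t| ^ (2 * α)) ≤ 1 * (1 + |t| ^ (2 * α)) := by gcongr
          _ ≤ D := by rw [hD]; linarith
      · rw [if_neg (fun h => hm (ht.1 h))] at h1
        have h4 : S = 0 := abs_eq_zero.1 (le_antisymm h1 (abs_nonneg S))
        rw [Set.indicator_of_notMem hm, h4]
        simp
    have h6 : I.indicator (fun _ => 2 * a ^ 2 * D) t = 2 * a ^ 2 * I.indicator (fun _ => D) t := by
      by_cases hm : t ∈ I <;> simp [hm]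
    rw [h6]
    calc (Real.exp (-|t|) + a * S) ^ 2 * (1 + |t| ^ (2 * α))
        ≤ (2 * Real.exp (-|t|) ^ 2 + 2 * a ^ 2 * S ^ 2) * (1 + |t| ^ (2 * α)) := by gcongr
      _ = 2 * (Real.exp (-|t|) ^ 2 * (1 + |t| ^ (2 * α)))
          + 2 * a ^ 2 * (S ^ 2 * (1 + |t| ^ (2 * α))) := by ring
      _ ≤ _ := by gcongr
  have hi1 : Integrable fun t => 2 * (Real.exp (-|t|) ^ 2 * (1 + |t| ^ (2 * α))) :=
    (integrable_cauchy_sobolev hα).const_mul 2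
  have hi2 : Integrable (I.indicator fun _ => 2 * a ^ 2 * D) :=
    (integrable_indicator_iff measurableSet_Icc).2 (integrableOn_const (by simp))
  have hn1 : ∀ t, 0 ≤ 2 * (Real.exp (-|t|) ^ 2 * (1 + |t| ^ (2 * α)))
      + I.indicator (fun _ => 2 * a ^ 2 * D) t := fun t =>
    add_nonneg (by positivity) (Set.indicator_nonneg (fun _ _ => by positivity) _)
  refine (lintegral_mono fun t => ENNReal.ofReal_le_ofReal (hpt t)).trans ?_
  have hi3 : Integrable fun t => 2 * (Real.exp (-|t|) ^ 2 * (1 + |t| ^ (2 * α)))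
      + I.indicator (fun _ => 2 * a ^ 2 * D) t := hi1.add hi2
  rw [← ofReal_integral_eq_lintegral_ofReal hi3 (Eventually.of_forall hn1)]
  refine ENNReal.ofReal_le_ofReal ?_
  have hR : 0 ≤ 4 * Real.pi * N := by positivity
  rw [integral_add hi1 hi2, integral_const_mul, integral_indicator measurableSet_Icc,
    setIntegral_const, Real.volume_real_Icc_of_le (by linarith), smul_eq_mul]
  refine le_trans (add_le_add le_rfl ?_) hK
  calc (4 * Real.pi * N - -(4 * Real.pi * N)) * (2 * a ^ 2 * D)
      = 16 * Real.pi * N * a ^ 2 * D := by ring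
    _ ≤ 1 := haN

end Perturb

end AtomicDeconv

/-! ### Waves smoothed by the error distribution. -/

namespace AtomicDeconv

open scoped FourierTransform

theorem exists_abs_deriv_baseBump_le : ∃ B, ∀ s, |deriv baseBump s| ≤ B := by
  obtain ⟨B, hB⟩ := (baseBump.hasCompactSupport.deriv (𝕜 := ℝ)).exists_bound_of_continuous
    ((baseBump.contDiff (n := 1)).continuous_deriv le_rfl)
  exact ⟨B, hB⟩

theorem hasDerivAt_waveBump (ν s : ℝ) :
    HasDerivAt (waveBump ν) ((deriv baseBump (s - ν) + deriv baseBump (s + ν)) / 2) s := by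
  have hd : ∀ u, HasDerivAt baseBump (deriv baseBump u) u := fun u =>
    ((baseBump.contDiff (n := 1)).differentiable one_ne_zero).differentiableAt.hasDerivAt
  have h1 : HasDerivAt (fun s => baseBump (s - ν)) (deriv baseBump (s - ν)) s :=
    (hd (s - ν)).comp_sub_const s ν
  have h2 : HasDerivAt (fun s => baseBump (s + ν)) (deriv baseBump (s + ν)) s :=
    (hd (s + ν)).comp_add_const s ν
  exact (h1.add h2).div_const 2

theorem deriv_baseBump_eq_zero {s : ℝ} (hs : 1 / 2 < |s|) : deriv baseBump s = 0 := by
  have : baseBump =ᶠ[𝓝 s] fun _ => (0 : ℝ) := by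
    filter_upwards [(isOpen_lt continuous_const continuous_abs).mem_nhds hs] with u hu
    exact baseBump_eq_zero (le_of_lt hu)
  rw [this.deriv_eq, deriv_const]

/-- The two intervals which carry `waveBump ν`. -/
def waveBand (ν : ℝ) : Set ℝ := Set.Icc (ν - 1 / 2) (ν + 1 / 2) ∪ Set.Icc (-ν - 1 / 2) (-ν + 1 / 2)

theorem measurableSet_waveBand (ν : ℝ) : MeasurableSet (waveBand ν) :=
  measurableSet_Icc.union measurableSet_Icc

theorem volume_waveBand_le (ν : ℝ) : volume (waveBand ν) ≤ 2 := by
  refine (measure_union_le _ _).trans (le_of_eq ?_)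
  rw [Real.volume_Icc, Real.volume_Icc, ← ENNReal.ofReal_add (by norm_num) (by norm_num)]
  norm_num

theorem lt_abs_of_notMem_waveBand {ν s : ℝ} (h : s ∉ waveBand ν) :
    1 / 2 < |s - ν| ∧ 1 / 2 < |s + ν| := by
  simp only [waveBand, Set.mem_union, not_or, Set.mem_Icc, not_and_or, not_le] at h
  constructor
  · rcases h.1 with h1 | h1
    · exact lt_abs.2 (Or.inr (by linarith))
    · exact lt_abs.2 (Or.inl (by linarith))
  · rcases h.2 with h1 | h1
    · exact lt_abs.2 (Or.inr (by linarith))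
    · exact lt_abs.2 (Or.inl (by linarith))

theorem le_abs_of_mem_waveBand {ν s : ℝ} (h : s ∈ waveBand ν) : ν - 1 / 2 ≤ |s| := by
  rcases h with h | h
  · exact h.1.trans (le_abs_self s)
  · exact le_trans (by linarith [h.2]) (neg_le_abs s)

section Smoothing

variable {κ : Measure ℝ} {δ : ℝ} {N ν : ℝ}

/-- The convolution of `wave ν` with a distribution. -/
noncomputable def smoothWave (κ : Measure ℝ) (ν x : ℝ) : ℝ := ∫ y, wave ν (x - y) ∂κ

/-- The Fourier transform of `smoothWave`. -/
noncomputable def smoothWaveBump (κ : Measure ℝ) (ν s : ℝ) : ℂ :=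
  waveBump ν s * charFun κ (2 * Real.pi * s)

/-- Convolution becomes multiplication by the characteristic function; the factor `2π` reconciles
the two normalisations of frequency. -/
theorem smoothWave_eq_fourier [IsProbabilityMeasure κ] (ν x : ℝ) :
    (smoothWave κ ν x : ℂ) = 𝓕 (smoothWaveBump κ ν) x := by
  have hF : Integrable (Function.uncurry fun s y : ℝ =>
      Complex.exp (((-2 * Real.pi * s * (x - y) : ℝ) : ℂ) * Complex.I) * (waveBump ν s : ℂ))
      (volume.prod κ) := by
    have h0 : Integrable fun s => (waveBump ν s : ℂ) := (integrable_waveBump ν).ofReal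
    have h1 : Integrable (fun z : ℝ × ℝ => (waveBump ν z.1 : ℂ)) (volume.prod κ) := h0.comp_fst κ
    refine h1.bdd_mul (c := 1) (by fun_prop) (Eventually.of_forall fun z => ?_)
    rw [Complex.norm_exp_ofReal_mul_I]
  have h := integral_integral_swap hF
  rw [Real.fourier_eq', smoothWave, ← integral_complex_ofReal]
  have e1 : ∀ y : ℝ, (wave ν (x - y) : ℂ) = ∫ s : ℝ,
      Complex.exp (((-2 * Real.pi * s * (x - y) : ℝ) : ℂ) * Complex.I) * (waveBump ν s : ℂ) :=
    fun y => by
      rw [wave_eq_fourier', Real.fourier_eq']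
      refine integral_congr_ae (Eventually.of_forall fun s => ?_)
      simp only [RCLike.inner_apply, conj_trivial, smul_eq_mul]
      congr 3
      push_cast
      ring
  simp_rw [e1]
  rw [← h]
  refine integral_congr_ae (Eventually.of_forall fun s => ?_)
  simp only
  rw [integral_mul_const, smoothWaveBump, charFun_eq_integral_exp, smul_eq_mul,
    mul_left_comm, mul_comm _ (waveBump ν s : ℂ)]
  congr 1
  rw [← integral_const_mul]
  refine integral_congr_ae (Eventually.of_forall fun y => ?_)
  simp only [RCLike.inner_apply, conj_trivial]
  rw [← Complex.exp_add]
  congr 1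
  push_cast
  ring

theorem hasDerivAt_smoothWaveBump (hφ : Differentiable ℝ (charFun κ)) (ν s : ℝ) :
    HasDerivAt (smoothWaveBump κ ν)
      (((deriv baseBump (s - ν) + deriv baseBump (s + ν)) / 2 : ℝ) * charFun κ (2 * Real.pi * s)
        + waveBump ν s * (2 * Real.pi * deriv (charFun κ) (2 * Real.pi * s))) s := by
  have h1 := (hasDerivAt_waveBump ν s).ofReal_comp
  have h2 : HasDerivAt (fun s : ℝ => charFun κ (2 * Real.pi * s))
      ((2 * Real.pi) • deriv (charFun κ) (2 * Real.pi * s)) s :=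
    (hφ (2 * Real.pi * s)).hasDerivAt.scomp s
      (by simpa using (hasDerivAt_id s).const_mul (2 * Real.pi))
  rw [Complex.real_smul] at h2
  push_cast at h2
  exact h1.mul h2

/-- On the band `|s| ≥ ν - 1/2 ≥ N/2`, and the factor `2π` more than makes up for the lost half. -/
theorem abs_two_pi_mul_ge (hN : 1 ≤ N) (hν : N ≤ ν) {s : ℝ} (hs : s ∈ waveBand ν) :
    N ≤ |2 * Real.pi * s| := by
  have h1 := le_abs_of_mem_waveBand hs
  have h2 := Real.pi_gt_three
  rw [abs_mul, abs_of_pos (by positivity)]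
  nlinarith

theorem norm_smoothWaveBump_le (hN : 1 ≤ N) (hν : N ≤ ν)
    (h1 : ∀ t, N ≤ |t| → ‖charFun κ t‖ ≤ δ) (s : ℝ) :
    ‖smoothWaveBump κ ν s‖ ≤ (waveBand ν).indicator (fun _ => δ) s := by
  rw [smoothWaveBump, norm_mul, Complex.norm_real, Real.norm_eq_abs,
    abs_of_nonneg (waveBump_nonneg _ _)]
  by_cases hs : s ∈ waveBand ν
  · rw [Set.indicator_of_mem hs]
    exact (mul_le_of_le_one_left (norm_nonneg _) (waveBump_le_one _ _)).trans
      (h1 _ (abs_two_pi_mul_ge hN hν hs))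
  · have h := lt_abs_of_notMem_waveBand hs
    rw [Set.indicator_of_notMem hs, waveBump, baseBump_eq_zero h.1.le, baseBump_eq_zero h.2.le]
    simp

theorem norm_deriv_smoothWaveBump_le (hφ : Differentiable ℝ (charFun κ)) (hN : 1 ≤ N)
    (hν : N ≤ ν) (h1 : ∀ t, N ≤ |t| → ‖charFun κ t‖ ≤ δ)
    (h2 : ∀ t, N ≤ |t| → ‖deriv (charFun κ) t‖ ≤ δ) {B : ℝ} (hB : ∀ s, |deriv baseBump s| ≤ B)
    (s : ℝ) : ‖deriv (smoothWaveBump κ ν) s‖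
      ≤ (waveBand ν).indicator (fun _ => (B + 2 * Real.pi) * δ) s := by
  rw [(hasDerivAt_smoothWaveBump hφ ν s).deriv]
  by_cases hs : s ∈ waveBand ν
  · have hs' := abs_two_pi_mul_ge hN hν hs
    rw [Set.indicator_of_mem hs]
    refine (norm_add_le _ _).trans ?_
    rw [norm_mul, norm_mul, norm_mul, Complex.norm_real, Complex.norm_real, Real.norm_eq_abs,
      Real.norm_eq_abs, abs_of_nonneg (waveBump_nonneg _ _), add_mul]
    have hp : ‖(2 * Real.pi : ℂ)‖ = 2 * Real.pi := by
      rw [show (2 * Real.pi : ℂ) = ((2 * Real.pi : ℝ) : ℂ) by push_cast; rfl, Complex.norm_real,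
        Real.norm_eq_abs, abs_of_pos (by positivity)]
    rw [hp]
    have hb : |(deriv baseBump (s - ν) + deriv baseBump (s + ν)) / 2| ≤ B := by
      rw [abs_div, abs_two, div_le_iff₀ (by norm_num)]
      refine (abs_add_le _ _).trans ?_
      linarith [hB (s - ν), hB (s + ν)]
    have hB0 : 0 ≤ B := (abs_nonneg _).trans (hB 0)
    refine add_le_add (mul_le_mul hb (h1 _ hs') (norm_nonneg _) hB0) ?_
    refine (mul_le_of_le_one_left (by positivity) (waveBump_le_one _ _)).trans ?_
    exact mul_le_mul_of_nonneg_left (h2 _ hs') (by positivity)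
  · have h := lt_abs_of_notMem_waveBand hs
    rw [Set.indicator_of_notMem hs, waveBump, baseBump_eq_zero h.1.le, baseBump_eq_zero h.2.le,
      deriv_baseBump_eq_zero h.1, deriv_baseBump_eq_zero h.2]
    simp

theorem integrable_of_norm_le_indicator {u : ℝ → ℂ} {c : ℝ} (hm : AEStronglyMeasurable u)
    (hu : ∀ s, ‖u s‖ ≤ (waveBand ν).indicator (fun _ => c) s) : Integrable u :=
  Integrable.mono' ((integrable_indicator_iff (measurableSet_waveBand ν)).2
    (integrableOn_const ((volume_waveBand_le ν).trans_lt (by simp)).ne)) hm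
    (Eventually.of_forall hu)

theorem lintegral_fourier_sq_le_of_norm_le_indicator {u : ℝ → ℂ} {c : ℝ} (hi : Integrable u)
    (hu : ∀ s, ‖u s‖ ≤ (waveBand ν).indicator (fun _ => c) s) :
    ∫⁻ x, ‖𝓕 u x‖ₑ ^ 2 ≤ ENNReal.ofReal (2 * c ^ 2) := by
  have h := lintegral_fourier_sub_sq_le (f := fun _ => 0) hi (integrable_zero ℝ ℂ volume)
  have h0 : ∀ s, 𝓕⁻ (fun _ : ℝ => (0 : ℂ)) s = 0 := fun s => by
    rw [fourierInv_eq_integral_exp]; simp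
  simp only [h0, sub_zero] at h
  refine h.trans ?_
  calc ∫⁻ s, ‖u s‖ₑ ^ 2 ≤ ∫⁻ s, (waveBand ν).indicator (fun _ => ENNReal.ofReal (c ^ 2)) s := by
        refine lintegral_mono fun s => ?_
        have := hu s
        rw [← ofReal_norm, ← ENNReal.ofReal_pow (norm_nonneg _)]
        by_cases hs : s ∈ waveBand ν
        · rw [Set.indicator_of_mem hs] at this ⊢
          gcongr
        · rw [Set.indicator_of_notMem hs] at this ⊢
          rw [le_antisymm this (norm_nonneg _)]
          simp
    _ = ENNReal.ofReal (c ^ 2) * volume (waveBand ν) := by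
        rw [lintegral_indicator (measurableSet_waveBand ν), setLIntegral_const]
    _ ≤ ENNReal.ofReal (c ^ 2) * 2 := by gcongr; exact volume_waveBand_le ν
    _ = ENNReal.ofReal (2 * c ^ 2) := by
        rw [mul_comm 2, ENNReal.ofReal_mul (sq_nonneg c), ENNReal.ofReal_ofNat]

/-- If the characteristic function of `κ` and its derivative are small at the frequencies beyond
`N`, then so is the weighted norm of the convolution of `κ` with a wave of frequency `ν ≥ N`. -/
theorem exists_lintegral_smoothWave_sq_le : ∃ C > 0, ∀ (κ : Measure ℝ) [IsProbabilityMeasure κ]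
    (N ν δ : ℝ), Differentiable ℝ (charFun κ) → 1 ≤ N → N ≤ ν →
    (∀ t, N ≤ |t| → ‖charFun κ t‖ ≤ δ ∧ ‖deriv (charFun κ) t‖ ≤ δ) →
    ∫⁻ x, ENNReal.ofReal ((1 + x ^ 2) * smoothWave κ ν x ^ 2) ≤ ENNReal.ofReal (C * δ ^ 2) := by
  obtain ⟨B, hB⟩ := exists_abs_deriv_baseBump_le
  refine ⟨2 + 2 * (B + 2 * Real.pi) ^ 2, by positivity, fun κ _ N ν δ hφ hN hν h => ?_⟩
  have hb1 := norm_smoothWaveBump_le (κ := κ) hN hν fun t ht => (h t ht).1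
  have hb2 := norm_deriv_smoothWaveBump_le (κ := κ) hφ hN hν (fun t ht => (h t ht).1)
    (fun t ht => (h t ht).2) hB
  have hd : Differentiable ℝ (smoothWaveBump κ ν) := fun s =>
    (hasDerivAt_smoothWaveBump hφ ν s).differentiableAt
  have hi1 : Integrable (smoothWaveBump κ ν) :=
    integrable_of_norm_le_indicator hd.continuous.aestronglyMeasurable hb1
  have hi2 : Integrable (deriv (smoothWaveBump κ ν)) :=
    integrable_of_norm_le_indicator (stronglyMeasurable_deriv _).aestronglyMeasurable hb2
  have e1 := lintegral_fourier_sq_le_of_norm_le_indicator hi1 hb1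
  have e2 := lintegral_fourier_sq_le_of_norm_le_indicator hi2 hb2
  -- Multiplication by `x` corresponds to differentiation in frequency. The weight `x²` is therefore
  -- paid for by the derivative of the smoothed bump, hence by that of the characteristic function.
  rw [Real.fourier_deriv hi1 hd hi2] at e2
  have hm : Measurable fun x => ‖𝓕 (smoothWaveBump κ ν) x‖ₑ ^ 2 := by
    have := continuous_fourier_of_integrable hi1
    exact (this.measurable.enorm.pow_const 2)
  calc ∫⁻ x, ENNReal.ofReal ((1 + x ^ 2) * smoothWave κ ν x ^ 2)
      ≤ ∫⁻ x, (‖𝓕 (smoothWaveBump κ ν) x‖ₑ ^ 2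
        + ‖(2 * Real.pi * Complex.I * x) • 𝓕 (smoothWaveBump κ ν) x‖ₑ ^ 2) := by
        refine lintegral_mono fun x => ?_
        rw [← smoothWave_eq_fourier, ← ofReal_norm, ← ofReal_norm,
          ← ENNReal.ofReal_pow (norm_nonneg _), ← ENNReal.ofReal_pow (norm_nonneg _),
          ← ENNReal.ofReal_add (by positivity) (by positivity)]
        refine ENNReal.ofReal_le_ofReal ?_
        rw [norm_smul, norm_mul, norm_mul, norm_mul, Complex.norm_real, Complex.norm_real,
          Complex.norm_real, Complex.norm_I, Complex.norm_ofNat, Real.norm_eq_abs,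
          Real.norm_eq_abs, Real.norm_eq_abs, mul_pow, mul_pow, sq_abs, mul_one, mul_pow, sq_abs,
          sq_abs, add_mul, one_mul]
        have h3 := Real.pi_gt_three
        have h4 : 1 ≤ (2 : ℝ) ^ 2 * Real.pi ^ 2 := by nlinarith
        have h5 : 0 ≤ x ^ 2 * smoothWave κ ν x ^ 2 := by positivity
        nlinarith
    _ ≤ ENNReal.ofReal (2 * δ ^ 2) + ENNReal.ofReal (2 * ((B + 2 * Real.pi) * δ) ^ 2) := by
        rw [lintegral_add_left hm]
        exact add_le_add e1 e2
    _ = _ := by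
        rw [← ENNReal.ofReal_add (by positivity) (by positivity)]
        congr 1
        ring

end Smoothing

end AtomicDeconv

/-! ### Likelihood ratios of neighbouring perturbations. -/

namespace AtomicDeconv

section Ratio

variable {κ : Measure ℝ} [IsProbabilityMeasure κ]

/-- The density of the convolution of a distribution with the density `f`. -/
noncomputable def smoothDensity (κ : Measure ℝ) (f : ℝ → ℝ) (x : ℝ) : ℝ := ∫ y, f (x - y) ∂κ

theorem integrable_comp_sub_left {f : ℝ → ℝ} (hm : Measurable f) {B : ℝ} (hB : ∀ x, |f x| ≤ B)
    (x : ℝ) : Integrable (fun y => f (x - y)) κ :=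
  Integrable.of_bound (C := B) (hm.comp (measurable_const.sub measurable_id)).aestronglyMeasurable
    (Eventually.of_forall fun y => hB (x - y))

theorem measurable_smoothDensity {f : ℝ → ℝ} (hm : Measurable f) :
    Measurable (smoothDensity κ f) := by
  have : StronglyMeasurable (Function.uncurry fun x y : ℝ => f (x - y)) :=
    (hm.comp (measurable_fst.sub measurable_snd)).stronglyMeasurable
  exact this.integral_prod_right.measurable

/-- Tonelli and translation invariance against an arbitrary test function; boundedness of `f`
ensures that the Bochner integral defining `smoothDensity` agrees with the lower integral. -/
theorem conv_densityLaw {f : ℝ → ℝ} (hm : Measurable f) (h0 : ∀ x, 0 ≤ f x) {B : ℝ}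
    (hB : ∀ x, |f x| ≤ B) :
    Measure.conv (densityLaw f) κ
      = volume.withDensity fun x => ENNReal.ofReal (smoothDensity κ f x) := by
  have hq := measurable_smoothDensity (κ := κ) hm
  have hfin : ∀ x, ENNReal.ofReal (smoothDensity κ f x) = ∫⁻ y, ENNReal.ofReal (f (x - y)) ∂κ :=
    fun x => ofReal_integral_eq_lintegral_ofReal (integrable_comp_sub_left hm hB x)
      (Eventually.of_forall fun y => h0 _)
  refine Measure.ext_of_lintegral _ fun g hg => ?_
  rw [Measure.lintegral_conv hg, densityLaw,
    lintegral_withDensity_eq_lintegral_mul _ hm.ennreal_ofReal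
      (Measurable.lintegral_prod_right' (f := fun z : ℝ × ℝ => g (z.1 + z.2)) (by fun_prop)),
    lintegral_withDensity_eq_lintegral_mul _ hq.ennreal_ofReal hg]
  simp only [Pi.mul_apply, hfin]
  calc ∫⁻ x, ENNReal.ofReal (f x) * ∫⁻ y, g (x + y) ∂κ
      = ∫⁻ x, ∫⁻ y, ENNReal.ofReal (f x) * g (x + y) ∂κ := by
        refine lintegral_congr fun x => ?_
        rw [lintegral_const_mul _ (by fun_prop)]
    _ = ∫⁻ y, (∫⁻ x, ENNReal.ofReal (f x) * g (x + y)) ∂κ :=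
        lintegral_lintegral_swap (by unfold Function.uncurry; fun_prop)
    _ = ∫⁻ y, (∫⁻ x, ENNReal.ofReal (f (x - y)) * g x) ∂κ := by
        refine lintegral_congr fun y => ?_
        rw [← lintegral_add_right_eq_self (μ := volume)
          (fun x => ENNReal.ofReal (f (x - y)) * g x) y]
        simp
    _ = ∫⁻ x, ∫⁻ y, ENNReal.ofReal (f (x - y)) * g x ∂κ :=
        lintegral_lintegral_swap (by unfold Function.uncurry; fun_prop)
    _ = _ := by
        refine lintegral_congr fun x => ?_
        rw [lintegral_mul_const _ (by fun_prop)]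

/-- Quadratic tails survive convolution: half of the mass of `κ` lies in some `[-m, m]`, and for
such `y` one has `1 + (x - y)² ≤ 2 (1 + m²) (1 + x²)`. The constant depends on `κ` alone, so it
serves the whole hypercube. -/
theorem exists_le_smoothDensity (κ : Measure ℝ) [IsProbabilityMeasure κ] :
    ∃ c > 0, ∀ f : ℝ → ℝ, Measurable f → (∃ B, ∀ x, |f x| ≤ B) →
      (∀ x, cauchyDensity x / 2 ≤ f x) → ∀ x, c / (1 + x ^ 2) ≤ smoothDensity κ f x := by
  obtain ⟨m, hm⟩ : ∃ m : ℕ, 1 / 2 ≤ κ.real (Set.Icc (-(m : ℝ)) m) := by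
    have hU : ⋃ m : ℕ, Set.Icc (-(m : ℝ)) m = Set.univ := by
      refine Set.eq_univ_of_forall fun x => Set.mem_iUnion.2 ?_
      obtain ⟨m, hm⟩ := exists_nat_ge |x|
      exact ⟨m, abs_le.1 hm⟩
    have hmono : Monotone fun m : ℕ => Set.Icc (-(m : ℝ)) m := fun m m' h =>
      Set.Icc_subset_Icc (neg_le_neg (by exact_mod_cast h)) (by exact_mod_cast h)
    have ht := tendsto_measure_iUnion_atTop (μ := κ) hmono
    rw [hU, measure_univ] at ht
    have ht' := (ENNReal.tendsto_toReal ENNReal.one_ne_top).comp ht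
    rw [ENNReal.toReal_one] at ht'
    obtain ⟨m, hm⟩ := (ht'.eventually (lt_mem_nhds (by norm_num : (1 / 2 : ℝ) < 1))).exists
    exact ⟨m, hm.le⟩
  refine ⟨1 / (8 * Real.pi * (1 + m ^ 2)), by positivity, fun f hf ⟨B, hB⟩ hlow x => ?_⟩
  set I := Set.Icc (-(m : ℝ)) m
  have h1 : ∀ y ∈ I, 1 / (4 * Real.pi * (1 + m ^ 2) * (1 + x ^ 2)) ≤ f (x - y) := fun y hy => by
    refine le_trans ?_ (hlow (x - y))
    have hy2 : y ^ 2 ≤ m ^ 2 := sq_le_sq' hy.1 hy.2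
    have hb : 1 + (x - y) ^ 2 ≤ 2 * (1 + m ^ 2) * (1 + x ^ 2) := by
      nlinarith [sq_nonneg (x + y), mul_nonneg (sq_nonneg (m : ℝ)) (sq_nonneg x)]
    rw [cauchyDensity, show Real.pi⁻¹ * (1 + (x - y) ^ 2)⁻¹ / 2
      = 1 / (2 * Real.pi * (1 + (x - y) ^ 2)) by field_simp]
    refine one_div_le_one_div_of_le (by positivity) ?_
    calc 2 * Real.pi * (1 + (x - y) ^ 2) ≤ 2 * Real.pi * (2 * (1 + m ^ 2) * (1 + x ^ 2)) := by
          gcongr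
      _ = _ := by ring
  have h0 : ∀ y, 0 ≤ f y := fun y => by
    have := cauchyDensity_pos y
    linarith [hlow y]
  have hi := integrable_comp_sub_left (κ := κ) hf hB x
  calc 1 / (8 * Real.pi * (1 + m ^ 2)) / (1 + x ^ 2)
      = 1 / 2 * (1 / (4 * Real.pi * (1 + m ^ 2) * (1 + x ^ 2))) := by
        field_simp; norm_num
    _ ≤ κ.real I * (1 / (4 * Real.pi * (1 + m ^ 2) * (1 + x ^ 2))) := by gcongr
    _ = ∫ _ in I, 1 / (4 * Real.pi * (1 + m ^ 2) * (1 + x ^ 2)) ∂κ := by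
        rw [setIntegral_const, smul_eq_mul]
    _ ≤ ∫ y in I, f (x - y) ∂κ :=
        setIntegral_mono_on (integrableOn_const (measure_ne_top κ I)) hi.integrableOn
          measurableSet_Icc h1
    _ ≤ ∫ y, f (x - y) ∂κ :=
        setIntegral_le_integral hi (Eventually.of_forall fun y => h0 _)

/-- The likelihood ratio of two densities which differ by a multiple of a wave of high frequency,
observed with an additive error of distribution `κ`. -/
theorem exists_density_ratio (κ : Measure ℝ) [IsProbabilityMeasure κ]
    (hφ : Differentiable ℝ (charFun κ)) : ∃ C > 0, ∀ (f f' : ℝ → ℝ) (b N ν δ : ℝ),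
    IsDensity f → IsDensity f' → (∃ B, ∀ x, |f x| ≤ B) → (∀ x, cauchyDensity x / 2 ≤ f x) →
    (∀ x, f' x = f x + b * wave ν x) → 1 ≤ N → N ≤ ν →
    (∀ t, N ≤ |t| → ‖charFun κ t‖ ≤ δ ∧ ‖deriv (charFun κ) t‖ ≤ δ) →
    ∃ L : ℝ → ℝ≥0∞, Measurable L ∧
      Measure.conv (densityLaw f') κ = (Measure.conv (densityLaw f) κ).withDensity L ∧
      ∫⁻ x, L x ^ 2 ∂(Measure.conv (densityLaw f) κ) ≤ ENNReal.ofReal (1 + C * b ^ 2 * δ ^ 2) := by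
  obtain ⟨c, hc, hlow⟩ := exists_le_smoothDensity κ
  obtain ⟨C₁, hC₁, hρ⟩ := exists_lintegral_smoothWave_sq_le
  obtain ⟨C₂, hC₂, hwave⟩ := exists_abs_wave_le
  refine ⟨C₁ / c, by positivity, fun f f' b N ν δ hf hf' ⟨B, hB⟩ hcf hff' hN hν hδ => ?_⟩
  have hw : ∀ x, |wave ν x| ≤ C₂ := fun x =>
    (hwave ν x).trans (div_le_self hC₂.le (by nlinarith [sq_nonneg x]))
  have hB' : ∀ x, |f' x| ≤ B + |b| * C₂ := fun x => by
    rw [hff']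
    refine (abs_add_le _ _).trans (add_le_add (hB x) ?_)
    rw [abs_mul]
    exact mul_le_mul_of_nonneg_left (hw x) (abs_nonneg b)
  set q := smoothDensity κ f with hq
  set q' := smoothDensity κ f' with hq'
  have hqm : Measurable q := measurable_smoothDensity hf.measurable
  have hqm' : Measurable q' := measurable_smoothDensity hf'.measurable
  have hqc : ∀ x, c / (1 + x ^ 2) ≤ q x := hlow f hf.measurable ⟨B, hB⟩ hcf
  have hq0 : ∀ x, 0 < q x := fun x => lt_of_lt_of_le (by positivity) (hqc x)
  have hq0' : ∀ x, 0 ≤ q' x := fun x => integral_nonneg fun y => hf'.nonneg _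
  have hqq' : ∀ x, q' x = q x + b * smoothWave κ ν x := fun x => by
    simp only [hq, hq', smoothDensity, smoothWave, hff']
    rw [integral_add (integrable_comp_sub_left hf.measurable hB x)
      ((integrable_comp_sub_left (continuous_wave ν).measurable hw x).const_mul b),
      integral_const_mul]
  have hP := conv_densityLaw (κ := κ) hf.measurable hf.nonneg hB
  have hP' := conv_densityLaw (κ := κ) hf'.measurable hf'.nonneg hB'
  have := hf.isProbabilityMeasure
  have := hf'.isProbabilityMeasure
  have hone : ∫⁻ x, ENNReal.ofReal (q x) = 1 := by
    have h : Measure.conv (densityLaw f) κ Set.univ = 1 := measure_univ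
    rwa [hP, withDensity_apply _ MeasurableSet.univ, Measure.restrict_univ] at h
  have hone' : ∫⁻ x, ENNReal.ofReal (q' x) = 1 := by
    have h : Measure.conv (densityLaw f') κ Set.univ = 1 := measure_univ
    rwa [hP', withDensity_apply _ MeasurableSet.univ, Measure.restrict_univ] at h
  have hLm : Measurable fun x => ENNReal.ofReal (q' x / q x) := (hqm'.div hqm).ennreal_ofReal
  refine ⟨fun x => ENNReal.ofReal (q' x / q x), hLm, ?_, ?_⟩
  · rw [hP, hP', ← withDensity_mul _ hqm.ennreal_ofReal hLm]
    congr 1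
    ext x
    rw [Pi.mul_apply, ← ENNReal.ofReal_mul (hq0 x).le, mul_div_cancel₀ _ (hq0 x).ne']
  · rw [hP, lintegral_withDensity_eq_lintegral_mul _ hqm.ennreal_ofReal (hLm.pow_const 2)]
    have e1 : ∀ x, ((fun x => ENNReal.ofReal (q x)) * fun x => ENNReal.ofReal (q' x / q x) ^ 2) x
        = ENNReal.ofReal (q' x ^ 2 / q x) := fun x => by
      rw [Pi.mul_apply, ← ENNReal.ofReal_pow (div_nonneg (hq0' x) (hq0 x).le),
        ← ENNReal.ofReal_mul (hq0 x).le]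
      congr 1
      have := (hq0 x).ne'
      field_simp
    simp_rw [e1]
    set R : ℝ → ℝ := fun x => (b * smoothWave κ ν x) ^ 2 / q x with hR
    -- The expansion of `(q' - q)² / q`, arranged without subtraction because it is integrated in
    -- `ℝ≥0∞`. Both densities integrate to one, so the second moment of the ratio is `1` plus the
    -- chi-square distance.
    have e2 : ∀ x, ENNReal.ofReal (q x) + ENNReal.ofReal (q' x ^ 2 / q x)
        = 2 * ENNReal.ofReal (q' x) + ENNReal.ofReal (R x) := fun x => by
      have h1 : 0 ≤ R x := div_nonneg (sq_nonneg _) (hq0 x).le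
      rw [← ENNReal.ofReal_add (hq0 x).le (div_nonneg (sq_nonneg _) (hq0 x).le),
        ← ENNReal.ofReal_ofNat, ← ENNReal.ofReal_mul (by norm_num),
        ← ENNReal.ofReal_add (mul_nonneg (by norm_num) (hq0' x)) h1]
      congr 1
      have := (hq0 x).ne'
      simp only [hR, hqq']
      field_simp
      ring
    have e3 : 1 + ∫⁻ x, ENNReal.ofReal (q' x ^ 2 / q x) = 1 + (1 + ∫⁻ x, ENNReal.ofReal (R x)) := by
      calc 1 + ∫⁻ x, ENNReal.ofReal (q' x ^ 2 / q x)
          = ∫⁻ x, (ENNReal.ofReal (q x) + ENNReal.ofReal (q' x ^ 2 / q x)) := by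
            rw [lintegral_add_left hqm.ennreal_ofReal, hone]
        _ = 2 * 1 + ∫⁻ x, ENNReal.ofReal (R x) := by
            simp_rw [e2]
            rw [lintegral_add_left (hqm'.ennreal_ofReal.const_mul 2),
              lintegral_const_mul _ hqm'.ennreal_ofReal, hone']
        _ = _ := by rw [← add_assoc, mul_one, one_add_one_eq_two]
    rw [(ENNReal.add_right_inj ENNReal.one_ne_top).1 e3,
      ENNReal.ofReal_add zero_le_one (by positivity), ENNReal.ofReal_one]
    gcongr
    -- Dividing by `q` costs at most `(1 + x²) / c`, which is the weight in the bound for smoothed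
    -- waves.
    calc ∫⁻ x, ENNReal.ofReal (R x)
        ≤ ∫⁻ x, ENNReal.ofReal (b ^ 2 / c) * ENNReal.ofReal ((1 + x ^ 2) * smoothWave κ ν x ^ 2) := by
          refine lintegral_mono fun x => ?_
          rw [← ENNReal.ofReal_mul (by positivity)]
          refine ENNReal.ofReal_le_ofReal ?_
          rw [hR]
          simp only
          rw [div_le_iff₀ (hq0 x)]
          have h1 := hqc x
          rw [div_le_iff₀ (by positivity)] at h1
          calc (b * smoothWave κ ν x) ^ 2 = (b * smoothWave κ ν x) ^ 2 / c * c := by field_simp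
            _ ≤ (b * smoothWave κ ν x) ^ 2 / c * (q x * (1 + x ^ 2)) := by gcongr
            _ = _ := by ring
      _ = ENNReal.ofReal (b ^ 2 / c) * ∫⁻ x, ENNReal.ofReal ((1 + x ^ 2) * smoothWave κ ν x ^ 2) :=
          lintegral_const_mul' _ _ ENNReal.ofReal_ne_top
      _ ≤ ENNReal.ofReal (b ^ 2 / c) * ENNReal.ofReal (C₁ * δ ^ 2) := by
          gcongr
          exact hρ κ N ν δ hφ hN hν hδ
      _ = ENNReal.ofReal (C₁ / c * b ^ 2 * δ ^ 2) := by
          rw [← ENNReal.ofReal_mul (by positivity)]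
          congr 1
          ring

end Ratio

end AtomicDeconv

/-! ### Bessel's inequality and Assouad's argument. -/

namespace AtomicDeconv

open scoped FourierTransform

section Bessel

variable {N : ℕ}

theorem memLp_wave (ν : ℝ) : MemLp (wave ν) 2 :=
  ((𝓕 (waveSchwartz ν)).memLp 2 volume).re

theorem integral_wave_mul_wave_eq (hN : 1 ≤ N) (i j : Fin N) :
    ∫ x, wave (N + i) x * wave (N + j) x = if i = j then waveMass else 0 := by
  have hN' : (1 : ℝ) ≤ N := by exact_mod_cast hN
  have h0 : ∀ l : Fin N, (0 : ℝ) ≤ (l : ℕ) := fun l => Nat.cast_nonneg _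
  rw [integral_wave_mul_wave]
  split_ifs with h
  · rw [h, integral_waveBump_sq (by linarith [h0 j])]
  · rcases lt_or_gt_of_ne h with hlt | hlt
    · have : ((i : ℕ) : ℝ) + 1 ≤ (j : ℕ) := by exact_mod_cast hlt
      simp [waveBump_mul_eq_zero (ν := N + i) (ν' := N + j) (by linarith [h0 i]) (by linarith)]
    · have : ((j : ℕ) : ℝ) + 1 ≤ (i : ℕ) := by exact_mod_cast hlt
      simp_rw [mul_comm (waveBump (N + i) _)]
      simp [waveBump_mul_eq_zero (ν := N + j) (ν' := N + i) (by linarith [h0 j]) (by linarith)]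

theorem memLp_sum_wave (c : Fin N → ℝ) : MemLp (fun x => ∑ j, c j * wave (N + j) x) 2 :=
  memLp_finsetSum _ fun j _ => (memLp_wave (N + (j : ℕ))).const_mul (c j)

theorem integral_mul_sum_wave {v : ℝ → ℝ} (hv : MemLp v 2) (c : Fin N → ℝ) :
    ∫ x, v x * ∑ j, c j * wave (N + j) x = ∑ j, c j * ∫ x, v x * wave (N + j) x := by
  have e : ∀ x, v x * ∑ j, c j * wave (N + j) x = ∑ j, c j * (v x * wave (N + j) x) := fun x => by
    rw [Finset.mul_sum]
    exact Finset.sum_congr rfl fun j _ => by ring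
  simp_rw [e]
  have hi : ∀ j ∈ (Finset.univ : Finset (Fin N)), Integrable fun x =>
      c j * (v x * wave (N + j) x) := fun j _ => (hv.integrable_mul (memLp_wave _)).const_mul (c j)
  rw [integral_finsetSum _ hi]
  simp_rw [integral_const_mul]

theorem integral_wave_mul_sum_wave (hN : 1 ≤ N) (c : Fin N → ℝ) (i : Fin N) :
    ∫ x, wave (N + i) x * ∑ j, c j * wave (N + j) x = c i * waveMass := by
  rw [integral_mul_sum_wave (memLp_wave _)]
  simp_rw [integral_wave_mul_wave_eq hN]
  simp

/-- Bessel's inequality for orthogonal waves of common squared norm `waveMass`, obtained by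
expanding the squared norm of `v - u / waveMass`. -/
theorem sum_sq_integral_mul_wave_le (hN : 1 ≤ N) {v : ℝ → ℝ} (hv : MemLp v 2) :
    (∑ j : Fin N, (∫ x, v x * wave (N + j) x) ^ 2) / waveMass ≤ ∫ x, v x ^ 2 := by
  set c : Fin N → ℝ := fun j => ∫ x, v x * wave (N + j) x with hc
  set u : ℝ → ℝ := fun x => ∑ j, c j * wave (N + j) x with hu
  have hm := waveMass_pos
  have hum : MemLp u 2 := memLp_sum_wave c
  have h1 : ∫ x, v x * u x = ∑ j, c j ^ 2 := by
    rw [integral_mul_sum_wave hv]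
    exact Finset.sum_congr rfl fun j _ => (sq (c j)).symm
  have h2 : ∫ x, u x * u x = waveMass * ∑ j, c j ^ 2 := by
    have : ∀ x, u x * u x = u x * ∑ j, c j * wave (N + j) x := fun x => rfl
    simp_rw [this]
    rw [integral_mul_sum_wave hum, Finset.mul_sum]
    refine Finset.sum_congr rfl fun j _ => ?_
    have h3 := integral_wave_mul_sum_wave hN c j
    simp_rw [mul_comm (u _)]
    rw [h3]
    ring
  have i1 : Integrable fun x => v x ^ 2 := hv.integrable_sq
  have i2 : Integrable fun x => 2 / waveMass * (v x * u x) := (hv.integrable_mul hum).const_mul _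
  have i3 : Integrable fun x => 1 / waveMass ^ 2 * (u x * u x) :=
    (hum.integrable_mul hum).const_mul _
  have h4 : 0 ≤ ∫ x, (v x ^ 2 - 2 / waveMass * (v x * u x) + 1 / waveMass ^ 2 * (u x * u x)) := by
    refine integral_nonneg fun x => ?_
    have : v x ^ 2 - 2 / waveMass * (v x * u x) + 1 / waveMass ^ 2 * (u x * u x)
        = (v x - u x / waveMass) ^ 2 := by
      field_simp
      ring
    rw [this]
    exact sq_nonneg _
  have i4 : Integrable fun x => v x ^ 2 - 2 / waveMass * (v x * u x) := i1.sub i2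
  rw [integral_add i4 i3, integral_sub i1 i2, integral_const_mul, integral_const_mul, h1,
    h2] at h4
  have h5 : 1 / waveMass ^ 2 * (waveMass * ∑ j, c j ^ 2) = (∑ j, c j ^ 2) / waveMass := by
    field_simp
  have h6 : 2 / waveMass * ∑ j, c j ^ 2 = 2 * ((∑ j, c j ^ 2) / waveMass) := by ring
  rw [h5, h6] at h4
  linarith

/-- This reduces the loss to `N` scalar problems: the coefficient of `g - cauchyDensity` against the
`j`-th wave estimates `a * boolSign (θ j) * waveMass`. If the loss is infinite nothing is claimed;
otherwise `g - cauchyDensity` lies in `L²` and the coefficients are genuine integrals, not the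
default value `0`. -/
theorem sum_sq_sub_le_lintegral (hN : 1 ≤ N) (a : ℝ) (θ : Fin N → Bool) {g : ℝ → ℝ}
    (hg : Measurable g) :
    ∑ j : Fin N, ENNReal.ofReal
      (((∫ x, (g x - cauchyDensity x) * wave (N + j) x) - a * boolSign (θ j) * waveMass) ^ 2)
      ≤ ENNReal.ofReal waveMass * ∫⁻ x, ENNReal.ofReal ((g x - perturb a θ x) ^ 2) := by
  have hm := waveMass_pos
  by_cases htop : ∫⁻ x, ENNReal.ofReal ((g x - perturb a θ x) ^ 2) = ∞
  · rw [htop, ENNReal.mul_top (by simpa using hm)]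
    exact le_top
  set v : ℝ → ℝ := fun x => g x - perturb a θ x with hv
  have hvm : Measurable v := hg.sub (continuous_perturb a θ).measurable
  have hi : Integrable fun x => v x ^ 2 :=
    ⟨(hvm.pow_const 2).aestronglyMeasurable, by
      rw [hasFiniteIntegral_iff_ofReal (Eventually.of_forall fun x => sq_nonneg (v x))]
      exact lt_top_iff_ne_top.2 htop⟩
  have hv2 : MemLp v 2 := (memLp_two_iff_integrable_sq hvm.aestronglyMeasurable).2 hi
  set u : ℝ → ℝ := fun x => ∑ j, (a * boolSign (θ j)) * wave (N + j) x with hu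
  have hum : MemLp u 2 := memLp_sum_wave _
  have e1 : ∀ x, g x - cauchyDensity x = v x + u x := fun x => by
    simp only [hv, hu, perturb, mul_assoc, ← Finset.mul_sum]
    ring
  have e2 : ∀ j : Fin N, (∫ x, (g x - cauchyDensity x) * wave (N + j) x)
      - a * boolSign (θ j) * waveMass = ∫ x, v x * wave (N + j) x := fun j => by
    simp_rw [e1, add_mul]
    have i1 : Integrable fun x => v x * wave (N + j) x := hv2.integrable_mul (memLp_wave _)
    have i2 : Integrable fun x => u x * wave (N + j) x := hum.integrable_mul (memLp_wave _)
    rw [integral_add i1 i2]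
    have h := integral_wave_mul_sum_wave hN (fun j => a * boolSign (θ j)) j
    simp_rw [mul_comm (u _)]
    rw [h]
    ring
  simp_rw [e2]
  rw [← ENNReal.ofReal_sum_of_nonneg fun j _ => sq_nonneg _,
    ← ofReal_integral_eq_lintegral_ofReal hi (Eventually.of_forall fun x => sq_nonneg _),
    ← ENNReal.ofReal_mul hm.le]
  refine ENNReal.ofReal_le_ofReal ?_
  have h := sum_sq_integral_mul_wave_le hN hv2
  rwa [div_le_iff₀' hm] at h

end Bessel

section Assouad

variable {N : ℕ}

/-- Change the `j`-th coordinate of a vertex of the cube. -/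
def flipBit (j : Fin N) (θ : Fin N → Bool) : Fin N → Bool := Function.update θ j (!θ j)

theorem flipBit_involutive (j : Fin N) : Function.Involutive (flipBit j) := fun θ => by
  simp [flipBit]

/-- Averaging over the vertices of the cube, as in Assouad's lemma. -/
theorem mul_le_of_le_add_flipBit {A : Fin N → (Fin N → Bool) → ℝ≥0∞} {R e : ℝ≥0∞}
    (h1 : ∀ θ, ∑ j, A j θ ≤ R) (h2 : ∀ j θ, e ≤ A j θ + A j (flipBit j θ)) :
    N * e ≤ 2 * R := by
  set M : ℝ≥0∞ := ((Fintype.card (Fin N → Bool) : ℕ) : ℝ≥0∞) with hM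
  have hM0 : M ≠ 0 := by simp [hM]
  have hMt : M ≠ ∞ := by simp [hM]
  have h3 : ∀ j, ∑ θ, A j (flipBit j θ) = ∑ θ, A j θ := fun j =>
    Equiv.sum_comp (flipBit_involutive j).toPerm (A j)
  refine (ENNReal.mul_le_mul_iff_right hM0 hMt).1 ?_
  calc M * (N * e) = ∑ j : Fin N, ∑ _θ : Fin N → Bool, e := by
        simp only [Finset.sum_const, Finset.card_univ, nsmul_eq_mul, Fintype.card_fin, hM]
        ring
    _ ≤ ∑ j, ∑ θ, (A j θ + A j (flipBit j θ)) :=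
        Finset.sum_le_sum fun j _ => Finset.sum_le_sum fun θ _ => h2 j θ
    _ = 2 * ∑ θ, ∑ j, A j θ := by
        simp_rw [Finset.sum_add_distrib, h3, ← two_mul]
        rw [Finset.sum_comm]
    _ ≤ 2 * ∑ _θ : Fin N → Bool, R := by
        gcongr with θ
        exact h1 θ
    _ = M * (2 * R) := by
        simp only [Finset.sum_const, Finset.card_univ, nsmul_eq_mul, hM]
        ring

theorem perturb_flipBit (a : ℝ) (j : Fin N) (θ : Fin N → Bool) (x : ℝ) :
    perturb a (flipBit j θ) x = perturb a θ x + -(2 * a * boolSign (θ j)) * wave (N + j) x := by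
  have h : ∀ i, boolSign (flipBit j θ i) * wave (N + i) x = boolSign (θ i) * wave (N + i) x
      + if i = j then -(2 * boolSign (θ j)) * wave (N + j) x else 0 := fun i => by
    by_cases hi : i = j
    · subst hi
      rw [if_pos rfl, flipBit, Function.update_self]
      cases θ i <;> simp [boolSign] <;> ring
    · rw [if_neg hi, flipBit, Function.update_of_ne hi, add_zero]
  unfold perturb
  simp_rw [h]
  rw [Finset.sum_add_distrib, Finset.sum_ite_eq' Finset.univ j, if_pos (Finset.mem_univ j)]
  ring

theorem obsLaw_zero (k f : ℝ → ℝ) :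
    obsLaw k 0 f = Measure.conv (densityLaw f) (densityLaw k) := by
  simp [obsLaw, signalLaw]

/-- Only `p = 0` is used, which every `pstar ≥ 0` admits. Flipping one sign changes the density by
`2a` times a wave, hence the factor `4` in `4 * D`; the condition on `n` keeps neighbouring product
laws indistinguishable, and each of the `N` coordinates then contributes an error of order `a²`. -/
theorem exists_le_minimaxRisk_of_perturb {k : ℝ → ℝ} (hk : IsDensity k)
    (hφ : Differentiable ℝ (phi k)) {C : ℝ} (hC : ∀ ν x, |wave ν x| ≤ C / (1 + x ^ 2)) :
    ∃ D > 0, ∀ (α K pstar a δ : ℝ) (n N : ℕ), 0 ≤ α → 0 ≤ pstar → 0 ≤ a → 1 ≤ N →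
      a * N * C ≤ 1 / (2 * Real.pi) →
      2 * (∫ t, Real.exp (-|t|) ^ 2 * (1 + |t| ^ (2 * α))) + 1 ≤ K →
      16 * Real.pi * N * a ^ 2 * (1 + (4 * Real.pi * N) ^ (2 * α)) ≤ 1 →
      (∀ t : ℝ, N ≤ |t| → ‖phi k t‖ ≤ δ ∧ ‖deriv (phi k) t‖ ≤ δ) →
      n * (D * a ^ 2 * δ ^ 2) ≤ 1 →
      ENNReal.ofReal (waveMass / 4 * (N * a ^ 2)) ≤ minimaxRisk n k α K pstar := by
  have := hk.isProbabilityMeasure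
  obtain ⟨D, hD, hratio⟩ := exists_density_ratio (densityLaw k) hφ
  have hm := waveMass_pos
  refine ⟨4 * D, by positivity, fun α K pstar a δ n N hα hp ha hN haC hK haN hδ hn => ?_⟩
  refine le_iInf₂ fun fe hfe => ?_
  set R := maxRisk k α K pstar fe with hR
  have hdens : ∀ θ : Fin N → Bool, IsDensity (perturb a θ) := isDensity_perturb ha hN hC haC
  have hmise : ∀ θ : Fin N → Bool, mise k fe 0 (perturb a θ) ≤ R := fun θ => by
    rw [hR, maxRisk]
    have hp0 : (0 : ℝ) ∈ Set.Icc 0 pstar := ⟨le_rfl, hp⟩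
    exact le_iSup₂_of_le (perturb a θ) (perturb_mem_sobolevClass hα ha hN hC haC hK haN θ)
      (le_iSup₂_of_le 0 hp0 le_rfl)
  have hfeX : ∀ X, Measurable (fe X) := fun X => hfe.comp measurable_prodMk_left
  set Y : Fin N → (Fin n → ℝ) → ℝ := fun j X =>
    ∫ x, (fe X x - cauchyDensity x) * wave (N + j) x with hY
  have hYm : ∀ j, Measurable (Y j) := fun j => by
    have : StronglyMeasurable (Function.uncurry fun (X : Fin n → ℝ) (x : ℝ) =>
        (fe X x - cauchyDensity x) * wave (N + j) x) := by
      refine Measurable.stronglyMeasurable ?_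
      exact (hfe.sub (continuous_cauchyDensity.measurable.comp measurable_snd)).mul
        ((continuous_wave _).measurable.comp measurable_snd)
    exact this.integral_prod_right.measurable
  set A : Fin N → (Fin N → Bool) → ℝ≥0∞ := fun j θ =>
    ∫⁻ X, ENNReal.ofReal ((Y j X - a * boolSign (θ j) * waveMass) ^ 2)
      ∂(sampleLaw n k 0 (perturb a θ)) with hA
  have h1 : ∀ θ, ∑ j, A j θ ≤ ENNReal.ofReal waveMass * R := fun θ => by
    calc ∑ j, A j θ = ∫⁻ X, ∑ j, ENNReal.ofReal ((Y j X - a * boolSign (θ j) * waveMass) ^ 2)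
          ∂(sampleLaw n k 0 (perturb a θ)) := by
          rw [lintegral_finsetSum]
          exact fun j _ => (((hYm j).sub_const _).pow_const 2).ennreal_ofReal
      _ ≤ ∫⁻ X, ENNReal.ofReal waveMass * (∫⁻ x, ENNReal.ofReal ((fe X x - perturb a θ x) ^ 2))
          ∂(sampleLaw n k 0 (perturb a θ)) :=
          lintegral_mono fun X => sum_sq_sub_le_lintegral hN a θ (hfeX X)
      _ = ENNReal.ofReal waveMass * mise k fe 0 (perturb a θ) := by
          rw [lintegral_const_mul' _ _ ENNReal.ofReal_ne_top, mise]
      _ ≤ _ := by gcongr; exact hmise θ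
  have hbd : ∀ θ : Fin N → Bool, ∃ B, ∀ x, |perturb a θ x| ≤ B := fun θ => by
    refine ⟨Real.pi⁻¹ + a * ∑ _j : Fin N, C, fun x => ?_⟩
    have hx : 1 ≤ 1 + x ^ 2 := by nlinarith [sq_nonneg x]
    have hC0 : 0 ≤ C := by
      have := (abs_nonneg _).trans (hC 0 0)
      simpa using this
    unfold perturb
    refine (abs_add_le _ _).trans (add_le_add ?_ ?_)
    · rw [abs_of_pos (cauchyDensity_pos x), cauchyDensity]
      exact mul_le_of_le_one_right (by positivity) (inv_le_one_of_one_le₀ hx)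
    · rw [abs_mul, abs_of_nonneg ha]
      refine mul_le_mul_of_nonneg_left ((Finset.abs_sum_le_sum_abs _ _).trans
        (Finset.sum_le_sum fun j _ => ?_)) ha
      rw [abs_mul, abs_boolSign, one_mul]
      exact (hC _ x).trans (div_le_self hC0 hx)
  -- The two values to be separated are `± a * waveMass`; the squared difference over `8` is `a²
  -- waveMass² / 2`.
  have h2 : ∀ j θ, ENNReal.ofReal (a ^ 2 * waveMass ^ 2 / 2) ≤ A j θ + A j (flipBit j θ) :=
    fun j θ => by
      have hbj : boolSign (θ j) ^ 2 = 1 := by rw [← sq_abs, abs_boolSign, one_pow]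
      have hfl : boolSign (flipBit j θ j) = -boolSign (θ j) := by
        rw [flipBit, Function.update_self]
        cases θ j <;> simp [boolSign]
      obtain ⟨L, hLm, hL, hL2⟩ := hratio (perturb a θ) (perturb a (flipBit j θ))
        (-(2 * a * boolSign (θ j))) N (N + (j : ℕ)) δ (hdens θ) (hdens _) (hbd θ)
        (half_cauchyDensity_le_perturb ha hC haC θ) (perturb_flipBit a j θ)
        (by exact_mod_cast hN) (by have : (0 : ℝ) ≤ (j : ℕ) := Nat.cast_nonneg _; linarith) hδ
      have hP := isProbabilityMeasure_obsLaw hk (hdens θ) le_rfl zero_le_one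
      have hP' := isProbabilityMeasure_obsLaw hk (hdens (flipBit j θ)) le_rfl zero_le_one
      simp only [hA, sampleLaw]
      rw [obsLaw_zero] at hP hP' ⊢
      rw [obsLaw_zero]
      rw [hL] at hP' ⊢
      have e : D * (-(2 * a * boolSign (θ j))) ^ 2 * δ ^ 2 = 4 * D * a ^ 2 * δ ^ 2 := by
        linear_combination (4 * D * a ^ 2 * δ ^ 2) * hbj
      rw [e] at hL2
      have h := two_point_lower_bound_pi (n := n) hLm (by positivity) hn hL2 (hYm j)
        (a * boolSign (θ j) * waveMass) (a * boolSign (flipBit j θ j) * waveMass)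
      refine le_trans (ENNReal.ofReal_le_ofReal (le_of_eq ?_)) h
      rw [hfl]
      linear_combination (-(a ^ 2 * waveMass ^ 2 / 2)) * hbj
  have h3 := mul_le_of_le_add_flipBit h1 h2
  have h4 : ENNReal.ofReal (2 * waveMass) * ENNReal.ofReal (waveMass / 4 * (N * a ^ 2))
      ≤ ENNReal.ofReal (2 * waveMass) * R := by
    calc _ = N * ENNReal.ofReal (a ^ 2 * waveMass ^ 2 / 2) := by
          rw [← ENNReal.ofReal_mul (by positivity), ← ENNReal.ofReal_natCast,
            ← ENNReal.ofReal_mul (by positivity)]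
          congr 1
          ring
      _ ≤ 2 * (ENNReal.ofReal waveMass * R) := h3
      _ = _ := by rw [ENNReal.ofReal_mul (by norm_num), ENNReal.ofReal_ofNat, mul_assoc]
  exact (ENNReal.mul_le_mul_iff_right (by simpa using hm) ENNReal.ofReal_ne_top).1 h4

end Assouad

end AtomicDeconv

/-! ### Choice of the amplitude and of the number of waves. -/

namespace AtomicDeconv

/-- A bound on the Sobolev norm of the Cauchy density and of its perturbations. -/
noncomputable def sobolevThreshold (α : ℝ) : ℝ :=
  2 * (∫ t, Real.exp (-|t|) ^ 2 * (1 + |t| ^ (2 * α))) + 1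

theorem sobolevThreshold_pos (α : ℝ) : 0 < sobolevThreshold α := by
  have : 0 ≤ ∫ t, Real.exp (-|t|) ^ 2 * (1 + |t| ^ (2 * α)) :=
    integral_nonneg fun t => by positivity
  unfold sobolevThreshold
  positivity

/-- With `a` of order `N^(-(α+1/2))` the Sobolev constraint is met up to constants, positivity holds
because `N^(1/2-α) ≤ 1`, and the separation `N a²` is of order `N^(-2α)`. -/
theorem exists_le_minimaxRisk {k : ℝ → ℝ} (hk : IsDensity k) (hφ : Differentiable ℝ (phi k))
    {α : ℝ} (hα : 1 / 2 ≤ α) {B : ℝ} (hB : 0 ≤ B) :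
    ∃ c > 0, ∀ (K pstar δ : ℝ) (n N : ℕ), sobolevThreshold α ≤ K → 0 ≤ pstar → 1 ≤ N →
      (∀ t : ℝ, N ≤ |t| → ‖phi k t‖ ≤ δ ∧ ‖deriv (phi k) t‖ ≤ δ) →
      n * δ ^ 2 * (N : ℝ) ^ (-(2 * α + 1)) ≤ B →
      ENNReal.ofReal (c * (N : ℝ) ^ (-(2 * α))) ≤ minimaxRisk n k α K pstar := by
  obtain ⟨C, hC, hwave⟩ := exists_abs_wave_le
  obtain ⟨D, hD, hrisk⟩ := exists_le_minimaxRisk_of_perturb hk hφ hwave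
  have hm := waveMass_pos
  have hπ := Real.pi_pos
  -- The summands are the constants of the three constraints on `a`: positivity, Sobolev norm,
  -- indistinguishability. The leading `1` gives `E ≥ 1`, so that `x ≤ E` implies `(1 / E)² x ≤ 1`.
  set E := 1 + 2 * Real.pi * C + 32 * Real.pi * (4 * Real.pi) ^ (2 * α) + D * B with hE
  have hP : 0 ≤ 32 * Real.pi * (4 * Real.pi) ^ (2 * α) := by positivity
  have hDB : 0 ≤ D * B := by positivity
  have hPC : 0 ≤ 2 * Real.pi * C := by positivity
  have hE1 : 1 ≤ E := by rw [hE]; linarith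
  have hE0 : 0 < E := by linarith
  refine ⟨waveMass / 4 * (1 / E) ^ 2, by positivity, fun K pstar δ n N hK hp hN hδ hn => ?_⟩
  have hN1 : (1 : ℝ) ≤ N := by exact_mod_cast hN
  have hN0 : (0 : ℝ) < N := by linarith
  set a : ℝ := 1 / E * (N : ℝ) ^ (-(α + 1 / 2)) with ha
  have ha0 : 0 ≤ a := by positivity
  have ha2 : a ^ 2 = (1 / E) ^ 2 * (N : ℝ) ^ (-(2 * α + 1)) := by
    rw [ha, mul_pow, ← Real.rpow_natCast ((N : ℝ) ^ (-(α + 1 / 2))), ← Real.rpow_mul hN0.le]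
    congr 2
    push_cast
    ring
  have hNa2 : N * a ^ 2 = (1 / E) ^ 2 * (N : ℝ) ^ (-(2 * α)) := by
    have : (N : ℝ) ^ (-(2 * α)) = N * (N : ℝ) ^ (-(2 * α + 1)) := by
      nth_rewrite 2 [← Real.rpow_one (N : ℝ)]
      rw [← Real.rpow_add hN0]
      congr 1
      ring
    rw [ha2, this]
    ring
  have hEsq : ∀ x, 0 ≤ x → x ≤ E → (1 / E) ^ 2 * x ≤ 1 := fun x hx hxE => by
    rw [one_div, inv_pow, inv_mul_le_iff₀ (by positivity)]
    nlinarith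
  have h1 : a * N * C ≤ 1 / (2 * Real.pi) := by
    have e1 : (N : ℝ) ^ (-(α + 1 / 2)) * N ≤ 1 := by
      nth_rewrite 2 [← Real.rpow_one (N : ℝ)]
      rw [← Real.rpow_add hN0]
      exact Real.rpow_le_one_of_one_le_of_nonpos hN1 (by linarith)
    rw [le_div_iff₀ (by positivity)]
    calc a * N * C * (2 * Real.pi)
        = 1 / E * (2 * Real.pi * C) * ((N : ℝ) ^ (-(α + 1 / 2)) * N) := by rw [ha]; ring
      _ ≤ 1 / E * (2 * Real.pi * C) * 1 := by gcongr
      _ ≤ 1 := by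
        rw [mul_one, one_div, inv_mul_le_iff₀ hE0, mul_one, hE]
        linarith
  have h2 : 16 * Real.pi * N * a ^ 2 * (1 + (4 * Real.pi * N) ^ (2 * α)) ≤ 1 := by
    have e1 : 1 ≤ (4 * Real.pi * N) ^ (2 * α) := by
      refine Real.one_le_rpow ?_ (by linarith)
      nlinarith [Real.pi_gt_three]
    have e2 : (N : ℝ) ^ (-(2 * α)) * (N : ℝ) ^ (2 * α) = 1 := by
      rw [← Real.rpow_add hN0, neg_add_cancel, Real.rpow_zero]
    calc 16 * Real.pi * N * a ^ 2 * (1 + (4 * Real.pi * N) ^ (2 * α))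
        ≤ 16 * Real.pi * N * a ^ 2 *
          ((4 * Real.pi * N) ^ (2 * α) + (4 * Real.pi * N) ^ (2 * α)) := by gcongr
      _ = 32 * Real.pi * (N * a ^ 2) * (4 * Real.pi * N) ^ (2 * α) := by ring
      _ = (1 / E) ^ 2 * (32 * Real.pi * (4 * Real.pi) ^ (2 * α)) *
          ((N : ℝ) ^ (-(2 * α)) * (N : ℝ) ^ (2 * α)) := by
        rw [hNa2, Real.mul_rpow (by positivity) hN0.le]
        ring
      _ ≤ 1 := by
        rw [e2, mul_one]
        exact hEsq _ hP (by rw [hE]; linarith)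
  have h3 : n * (D * a ^ 2 * δ ^ 2) ≤ 1 := by
    calc n * (D * a ^ 2 * δ ^ 2)
        = (1 / E) ^ 2 * (D * (n * δ ^ 2 * (N : ℝ) ^ (-(2 * α + 1)))) := by rw [ha2]; ring
      _ ≤ (1 / E) ^ 2 * (D * B) := by gcongr
      _ ≤ 1 := hEsq _ hDB (by rw [hE]; linarith)
  have h := hrisk α K pstar a δ n N (by linarith) hp ha0 hN h1 hK h2 hδ h3
  rwa [hNa2, ← mul_assoc] at h

/-- With `δ` of order `N^(-β)` the condition reads `n ≲ N^(2α+2β+1)`, so `N` is the rounded-up root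
of `n` of that order. -/
theorem PolyDecay.exists_le_minimaxRisk {k : ℝ → ℝ} (hk : IsDensity k) {α β : ℝ}
    (hα : 1 / 2 ≤ α) (hβ : 0 < β) (h : PolyDecay k β) :
    ∃ c > 0, ∀ K pstar : ℝ, sobolevThreshold α ≤ K → 0 ≤ pstar → ∀ n : ℕ, 1 ≤ n →
      ENNReal.ofReal (c * (n : ℝ) ^ (-(2 * α) / (2 * α + 2 * β + 1)))
        ≤ minimaxRisk n k α K pstar := by
  obtain ⟨hφ, d, hd, hdec⟩ := h
  obtain ⟨c, hc, hrisk⟩ := AtomicDeconv.exists_le_minimaxRisk hk hφ hα (sq_nonneg d)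
  refine ⟨c * 2 ^ (-(2 * α)), by positivity, fun K pstar hK hp n hn => ?_⟩
  set τ := 2 * α + 2 * β + 1 with hτ
  have hτ0 : 0 < τ := by rw [hτ]; linarith
  have hn1 : (1 : ℝ) ≤ n := by exact_mod_cast hn
  have hn0 : (0 : ℝ) < n := by linarith
  set x : ℝ := (n : ℝ) ^ (1 / τ) with hx
  have hx1 : 1 ≤ x := Real.one_le_rpow hn1 (by positivity)
  set N := ⌈x⌉₊ with hNdef
  have hxN : x ≤ N := Nat.le_ceil x
  have hN1 : (1 : ℝ) ≤ N := hx1.trans hxN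
  have hN0 : (0 : ℝ) < N := by linarith
  have hN2 : (N : ℝ) ≤ 2 * x := by
    have := Nat.ceil_lt_add_one (by linarith : 0 ≤ x)
    linarith
  have hdec' : ∀ t : ℝ, (N : ℝ) ≤ |t| → d / (1 + |t| ^ β) ≤ d * (N : ℝ) ^ (-β) := fun t ht => by
    rw [div_eq_mul_inv, Real.rpow_neg hN0.le]
    have := Real.rpow_le_rpow hN0.le ht hβ.le
    gcongr
    linarith
  have hnN : (n : ℝ) ≤ (N : ℝ) ^ τ := by
    calc (n : ℝ) = x ^ τ := by
          rw [hx, ← Real.rpow_mul hn0.le, one_div_mul_cancel hτ0.ne', Real.rpow_one]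
      _ ≤ (N : ℝ) ^ τ := Real.rpow_le_rpow (by linarith) hxN hτ0.le
  have hB : n * (d * (N : ℝ) ^ (-β)) ^ 2 * (N : ℝ) ^ (-(2 * α + 1)) ≤ d ^ 2 := by
    have e : ((N : ℝ) ^ (-β)) ^ 2 * (N : ℝ) ^ (-(2 * α + 1)) = ((N : ℝ) ^ τ)⁻¹ := by
      rw [← Real.rpow_natCast, ← Real.rpow_mul hN0.le, ← Real.rpow_add hN0, ← Real.rpow_neg hN0.le]
      congr 1
      rw [hτ]
      push_cast
      ring
    calc n * (d * (N : ℝ) ^ (-β)) ^ 2 * (N : ℝ) ^ (-(2 * α + 1))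
        = d ^ 2 * (n * (((N : ℝ) ^ (-β)) ^ 2 * (N : ℝ) ^ (-(2 * α + 1)))) := by ring
      _ = d ^ 2 * (n * ((N : ℝ) ^ τ)⁻¹) := by rw [e]
      _ ≤ d ^ 2 * 1 := by
        gcongr
        rw [mul_inv_le_iff₀ (by positivity), one_mul]
        exact hnN
      _ = d ^ 2 := mul_one _
  refine le_trans (ENNReal.ofReal_le_ofReal ?_) (hrisk K pstar (d * (N : ℝ) ^ (-β)) n N hK hp
    (by exact_mod_cast hN1)
    (fun t ht => ⟨(hdec t).1.trans (hdec' t ht), (hdec t).2.trans (hdec' t ht)⟩) hB)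
  rw [mul_assoc]
  refine mul_le_mul_of_nonneg_left ?_ hc.le
  calc (2 : ℝ) ^ (-(2 * α)) * (n : ℝ) ^ (-(2 * α) / τ) = (2 * x) ^ (-(2 * α)) := by
        rw [Real.mul_rpow (by norm_num) (by linarith), hx, ← Real.rpow_mul hn0.le]
        congr 2
        ring
    _ ≤ (N : ℝ) ^ (-(2 * α)) := Real.rpow_le_rpow_of_nonpos hN0 hN2 (by linarith)

/-- Once `N^β ≥ (γ/2) log n`, the factor `exp (-2 N^β / γ)` in `δ²` already cancels `n`; the power
of `N` in the condition is simply bounded by one. -/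
theorem ExpDecay.exists_le_minimaxRisk {k : ℝ → ℝ} (hk : IsDensity k) {α β γ : ℝ}
    (hα : 1 / 2 ≤ α) (hβ : 0 < β) (hγ : 0 < γ) (h : ExpDecay k β γ) :
    ∃ c > 0, ∀ K pstar : ℝ, sobolevThreshold α ≤ K → 0 ≤ pstar → ∀ n : ℕ, 2 ≤ n →
      ENNReal.ofReal (c * Real.log n ^ (-(2 * α) / β)) ≤ minimaxRisk n k α K pstar := by
  obtain ⟨hφ, d, hd, hdec⟩ := h
  obtain ⟨c, hc, hrisk⟩ := AtomicDeconv.exists_le_minimaxRisk hk hφ hα (sq_nonneg d)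
  have hlog2 : 0 < Real.log 2 := Real.log_pos one_lt_two
  -- The second summand converts the rounding `N ≤ x + 2` into a multiple of `(log n)^(1/β)`, using
  -- `log n ≥ log 2`.
  set E : ℝ := (γ / 2) ^ (1 / β) + 2 * (Real.log 2)⁻¹ ^ (1 / β) with hE
  have hE0 : 0 < E := by positivity
  refine ⟨c * E ^ (-(2 * α)), by positivity, fun K pstar hK hp n hn => ?_⟩
  have hn2 : (2 : ℝ) ≤ n := by exact_mod_cast hn
  have hn0 : (0 : ℝ) < n := by linarith
  have hL2 : Real.log 2 ≤ Real.log n := Real.log_le_log two_pos hn2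
  have hL : 0 < Real.log n := by linarith
  set x : ℝ := (γ / 2 * Real.log n) ^ (1 / β) with hx
  have hx0 : 0 < x := by positivity
  set N := ⌈x⌉₊ + 1 with hNdef
  have hxN : x ≤ N := by
    rw [hNdef]
    push_cast
    linarith [Nat.le_ceil x]
  have hN1 : 1 ≤ N := by omega
  have hN0 : (0 : ℝ) < N := by exact_mod_cast hN1
  have hNE : (N : ℝ) ≤ E * Real.log n ^ (1 / β) := by
    have h1 : (N : ℝ) ≤ x + 2 := by
      rw [hNdef]
      push_cast
      linarith [Nat.ceil_lt_add_one hx0.le]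
    have h2 : 1 ≤ (Real.log 2)⁻¹ ^ (1 / β) * Real.log n ^ (1 / β) := by
      rw [← Real.mul_rpow (by positivity) hL.le]
      refine Real.one_le_rpow ?_ (by positivity)
      rw [inv_mul_eq_div, one_le_div hlog2]
      exact hL2
    have h3 : x = (γ / 2) ^ (1 / β) * Real.log n ^ (1 / β) :=
      Real.mul_rpow (by positivity) hL.le
    rw [hE, add_mul, ← h3]
    linarith
  have hNβ : γ / 2 * Real.log n ≤ (N : ℝ) ^ β := by
    calc γ / 2 * Real.log n = x ^ β := by
          rw [hx, ← Real.rpow_mul (by positivity), one_div_mul_cancel hβ.ne', Real.rpow_one]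
      _ ≤ (N : ℝ) ^ β := Real.rpow_le_rpow hx0.le hxN hβ.le
  have hdec' : ∀ t : ℝ, (N : ℝ) ≤ |t| →
      d * Real.exp (-(|t| ^ β / γ)) ≤ d * Real.exp (-((N : ℝ) ^ β / γ)) := fun t ht => by
    have := Real.rpow_le_rpow hN0.le ht hβ.le
    gcongr
  have hB : n * (d * Real.exp (-((N : ℝ) ^ β / γ))) ^ 2 * (N : ℝ) ^ (-(2 * α + 1)) ≤ d ^ 2 := by
    have e1 : (N : ℝ) ^ (-(2 * α + 1)) ≤ 1 :=
      Real.rpow_le_one_of_one_le_of_nonpos (by exact_mod_cast hN1) (by linarith)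
    have e2 : n * Real.exp (-((N : ℝ) ^ β / γ)) ^ 2 ≤ 1 := by
      have e3 : Real.log n ≤ 2 * ((N : ℝ) ^ β / γ) := by
        rw [← mul_div_assoc, le_div_iff₀ hγ]
        linarith
      calc n * Real.exp (-((N : ℝ) ^ β / γ)) ^ 2
          = Real.exp (Real.log n - 2 * ((N : ℝ) ^ β / γ)) := by
            rw [← Real.exp_nat_mul, sub_eq_add_neg, Real.exp_add, Real.exp_log hn0]
            congr 2
            push_cast
            ring
        _ ≤ 1 := Real.exp_le_one_iff.2 (by linarith)
    calc n * (d * Real.exp (-((N : ℝ) ^ β / γ))) ^ 2 * (N : ℝ) ^ (-(2 * α + 1))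
        = d ^ 2 * (n * Real.exp (-((N : ℝ) ^ β / γ)) ^ 2) * (N : ℝ) ^ (-(2 * α + 1)) := by ring
      _ ≤ d ^ 2 * 1 * 1 := by gcongr
      _ = d ^ 2 := by ring
  refine le_trans (ENNReal.ofReal_le_ofReal ?_)
    (hrisk K pstar (d * Real.exp (-((N : ℝ) ^ β / γ))) n N hK hp hN1
      (fun t ht => ⟨(hdec t).1.trans (hdec' t ht), (hdec t).2.trans (hdec' t ht)⟩) hB)
  rw [mul_assoc]
  refine mul_le_mul_of_nonneg_left ?_ hc.le
  calc E ^ (-(2 * α)) * Real.log n ^ (-(2 * α) / β)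
      = (E * Real.log n ^ (1 / β)) ^ (-(2 * α)) := by
        rw [Real.mul_rpow hE0.le (by positivity), ← Real.rpow_mul hL.le]
        congr 2
        ring
    _ ≤ (N : ℝ) ^ (-(2 * α)) := Real.rpow_le_rpow_of_nonpos hN0 hNE (by linarith)

end AtomicDeconv

theorem theorem3 (α : ℝ) (hα : 1 / 2 ≤ α) :
    ∃ K₀ > 0, ∀ K ≥ K₀, ∀ pstar : ℝ, 0 ≤ pstar → pstar < 1 →
      ∀ k : ℝ → ℝ, IsDensity k → ∀ β > 0,
        (PolyDecay k β →
          (∃ c > 0, ∀ n : ℕ, 1 ≤ n →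
            ENNReal.ofReal (c * (n : ℝ) ^ (-(2 * α) / (2 * α + 2 * β + 1)))
              ≤ minimaxRisk n k α K pstar) ∧
          (OrdinarySmooth k β → ∀ φu φw : ℝ → ℝ, IsAtomKernel α φu → IsDensityKernel α φw →
            ∀ d > 0, IsRateOptimal k α K pstar (ordinaryEstimator k φu φw α β d)
              (fun n => (n : ℝ) ^ (-(2 * α) / (2 * α + 2 * β + 1))))) ∧
        (∀ γ > 0, ExpDecay k β γ →
          (∃ c > 0, ∀ n : ℕ, 2 ≤ n →
            ENNReal.ofReal (c * Real.log n ^ (-(2 * α) / β))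
              ≤ minimaxRisk n k α K pstar) ∧
          (∀ γ' > 0, SuperSmooth k β γ' → ∀ φu φw : ℝ → ℝ,
            IsAtomKernel α φu → IsDensityKernel α φw →
              IsRateOptimal k α K pstar (superEstimator k φu φw β γ')
                (fun n => Real.log n ^ (-(2 * α) / β)))) := by
  have hα0 : 0 < α := by linarith
  refine ⟨sobolevThreshold α, sobolevThreshold_pos α,
    fun K hK pstar hp hp1 k hk β hβ => ⟨fun hdec => ?_, fun γ hγ hdec => ?_⟩⟩
  all_goals have hK0 : 0 ≤ K := (sobolevThreshold_pos α).le.trans hK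
  · obtain ⟨c, hc, hlow⟩ := hdec.exists_le_minimaxRisk hk hα hβ
    have hlow' := hlow K pstar hK hp
    exact ⟨⟨c, hc, hlow'⟩, fun hos φu φw hu hw d hd =>
      isRateOptimal_ordinaryEstimator hα0 hK0 hp1 hk hβ hd hos hu hw hc
        fun n hn => hlow' n (by omega)⟩
  · obtain ⟨c, hc, hlow⟩ := hdec.exists_le_minimaxRisk hk hα hβ hγ
    have hlow' := hlow K pstar hK hp
    exact ⟨⟨c, hc, hlow'⟩, fun γ' hγ' hss φu φw hu hw =>
      isRateOptimal_superEstimator hα0 hK0 hp1 hk hβ hγ' hss hu hw hc hlow'⟩
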